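/- **Algebra.** Let $V$ be a real vector space of dimension $6$. Let $V\oplus V^*$ act on $\Lambda^*V^*$ by $(v+\xi)\cdot\varphi=\iota(v)\varphi+\xi\wedge\varphi$; this is a Clifford action for the natural symmetric form on $V\oplus V^*$ (up to a constant, the pairing of $v$ with $\xi$) and defines the spin representation $\sigma$ of $\mathfrak{so}(V\oplus V^*)$ on even and on odd forms. Let $\langle\varphi,\psi\rangle=\sum_m(-1)^m\varphi_{2m}\wedge\psi_{6-2m}$ for even forms and $\langle\varphi,\psi\rangle=\sum_m(-1)^m\varphi_{2m+1}\wedge\psi_{5-2m}$ for odd forms, with values in $\Lambda^6V^*$. The moment map $\mu(\rho)\in\mathfrak{so}(V\oplus V^*)\otimes\Lambda^6V^*$ is defined by $\operatorname{tr}(\mu(\rho)a)=\tfrac12\langle\sigma(a)\rho,\rho\rangle$ for all $a\in\mathfrak{so}(V\oplus V^*)$, and $q(\rho)=\operatorname{tr}\mu(\rho)^2\in(\Lambda^6V^*)^2$. Let $U=\{\rho : q(\rho)<0\}$ (within the even, or within the odd forms). If $V$ is oriented, put $\phi(\rho)=\sqrt{-q(\rho)/3}\in\Lambda^6V^*$ for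 $\rho\in U$, the positive square root. A complex form $\varphi\in\Lambda^*V^*\otimes\mathbf C$ is a pure spinor if its annihilator in $(V\oplus V^*)\otimes\mathbf C$ has complex dimension $6$. For an even (odd) $\rho\in U$ let $\hat\rho$ be the unique real even (odd) form such that $\varphi=\tfrac12(\rho+i\hat\rho)$ is a pure spinor and $\langle\varphi,\bar\varphi\rangle$ is $i$ times a positive element of $\Lambda^6V^*$. **Theorem.** Let $M$ be a compact oriented smooth $6$-manifold (without boundary), and let $\rho$ be a smooth closed form on $M$, in general of mixed degree, either even or odd, which is stable, that is, which lies in $U$ at each point of $M$. Let $V(\rho)=\int_M\phi(\rho)$ be the volume functional on stable forms. Then $\rho$ is a critical point of $V$ in its de Rham cohomology class (that is, $\frac{d}{dt}V(\rho+t\,d\alpha)\big|_{t=0}=0$ for all smooth forms $\alpha$ of the opposite parity) if and only if $\rho+i\hat\rho$ defines a generalized Calabi–Yau structure on $M$, that is, it is a smooth closed complex form, even or odd, which at each point is a pure spinor and satisfies $\langle\rho+i\hat\rho,\overline{\rho+i\hat\rho}\rangle\neq0$. Moreover, $\rho+i\hat\rho$ defines a generalized Calabi–Yau structure if and only if $d\hat\rho=0$.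 -/

import Mathlib

open scoped Manifold ContDiff TensorProduct

noncomputable section

namespace StableForm

/-! ### Linear algebra of mixed exterior forms on a real vector space -/

section Algebra

variable (V : Type*) [AddCommGroup V] [Module ℝ V]
variable (F : Type*) [CommRing F] [Algebra ℝ F]

/-- Mixed exterior forms `⨁ₖ Λᵏ V* ⊗ F`, for `F = ℝ` or `F = ℂ`. (If `V` has finite dimension
`n`, the components of degree `k > n` vanish automatically.) -/
abbrev Mixed : Type _ := (k : ℕ) → V [⋀^Fin k]→ₗ[ℝ] F

variable {V F}

/-- `φ` is even (`p = 0`) or odd (`p = 1`): all components of the other parity vanish. -/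
def HasParity (p : ZMod 2) (φ : Mixed V F) : Prop :=
  ∀ k : ℕ, (k : ZMod 2) ≠ p → φ k = 0

/-- Interior product `(φ, v) ↦ ι(v) φ`, inserting `v` as the first argument. -/
def interior : Mixed V F →ₗ[ℝ] V →ₗ[ℝ] Mixed V F :=
  LinearMap.mk₂ ℝ (fun φ v k => (φ (k + 1)).curryLeft v)
    (fun φ ψ v => by ext; simp) (fun c φ v => by ext; simp)
    (fun φ v w => by ext; simp) (fun c φ v => by ext; simp)

/-- The exterior product `ξ ∧ α` of a `1`-form and a `k`-form:
`(ξ ∧ α) (v₀, …, vₖ) = ∑ᵢ (-1)ⁱ ξ(vᵢ) α(v₀, …, v̂ᵢ, …, vₖ)`. -/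
def oneWedge (ξ : V →ₗ[ℝ] F) {k : ℕ} (α : V [⋀^Fin k]→ₗ[ℝ] F) : V [⋀^Fin (k + 1)]→ₗ[ℝ] F :=
  AlternatingMap.alternatizeUncurryFin
    { toFun := fun v => ξ v • α
      map_add' := fun v w => by simp [add_smul]
      map_smul' := fun c v => by ext; simp }

theorem oneWedge_apply (ξ : V →ₗ[ℝ] F) {k : ℕ} (α : V [⋀^Fin k]→ₗ[ℝ] F) (v : Fin (k + 1) → V) :
    oneWedge ξ α v = ∑ i : Fin (k + 1), (-1) ^ (i : ℕ) • (ξ (v i) * α (i.removeNth v)) := by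
  simp [oneWedge, AlternatingMap.alternatizeUncurryFin_apply]

/-- Exterior multiplication `(φ, ξ) ↦ ξ ∧ φ` of a mixed form by a `1`-form. -/
def exterior : Mixed V F →ₗ[F] (V →ₗ[ℝ] F) →ₗ[F] Mixed V F :=
  LinearMap.mk₂ F (fun φ ξ k => match k with
      | 0 => 0
      | k + 1 => oneWedge ξ (φ k))
    (fun φ ψ ξ => by
      funext k; cases k <;> ext <;> simp [oneWedge_apply, mul_add, Finset.sum_add_distrib])
    (fun c φ ξ => by
      funext k; cases k <;> ext <;>
        simp [oneWedge_apply, Finset.mul_sum, mul_left_comm])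
    (fun φ ξ η => by
      funext k; cases k <;> ext <;> simp [oneWedge_apply, add_mul, Finset.sum_add_distrib])
    (fun c φ ξ => by
      funext k; cases k <;> ext <;>
        simp [oneWedge_apply, Finset.mul_sum, mul_assoc, mul_left_comm])

/-- The exterior product of an `a`-form and a `b`-form, as an `n`-form where `n = a + b`. -/
def wedge {a b n : ℕ} (h : a + b = n) (α : V [⋀^Fin a]→ₗ[ℝ] F) (β : V [⋀^Fin b]→ₗ[ℝ] F) :
    V [⋀^Fin n]→ₗ[ℝ] F :=
  ((LinearMap.mul' ℝ F).compAlternatingMap (α.domCoprod β)).domDomCongr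
    (finSumFinEquiv.trans (finCongr h))

theorem wedge_add_left {a b n : ℕ} (h : a + b = n) (α α' : V [⋀^Fin a]→ₗ[ℝ] F)
    (β : V [⋀^Fin b]→ₗ[ℝ] F) : wedge h (α + α') β = wedge h α β + wedge h α' β := by
  ext v
  simp only [wedge, ← AlternatingMap.domCoprod'_apply, TensorProduct.add_tmul, map_add]
  simp

theorem wedge_smul_left {a b n : ℕ} (h : a + b = n) (c : ℝ) (α : V [⋀^Fin a]→ₗ[ℝ] F)
    (β : V [⋀^Fin b]→ₗ[ℝ] F) : wedge h (c • α) β = c • wedge h α β := by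
  have : (c • α).domCoprod β = c • α.domCoprod β := by
    rw [← AlternatingMap.domCoprod'_apply, ← AlternatingMap.domCoprod'_apply, ← map_smul]; rfl
  ext v
  simp only [wedge, this]
  simp

/-- The `Λ⁶V*`-valued bilinear form on mixed forms of a six-dimensional space,
`⟨φ, ψ⟩ = (σφ ∧ ψ)₆`, where `σ = (-1)ᵐ` on forms of degree `2m` and of degree `2m + 1`. -/
def pairing (φ ψ : Mixed V F) : V [⋀^Fin 6]→ₗ[ℝ] F :=
  ∑ k : Fin 7, (-1 : ℤ) ^ ((k : ℕ) / 2) • wedge (by omega : (k : ℕ) + (6 - (k : ℕ)) = 6)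
    (φ k) (ψ (6 - (k : ℕ)))

theorem pairing_add_left (φ φ' ψ : Mixed V F) :
    pairing (φ + φ') ψ = pairing φ ψ + pairing φ' ψ := by
  simp [pairing, wedge_add_left, Finset.sum_add_distrib]

theorem pairing_smul_left (c : ℝ) (φ ψ : Mixed V F) :
    pairing (c • φ) ψ = c • pairing φ ψ := by
  simp only [pairing, Pi.smul_apply, wedge_smul_left, Finset.smul_sum]
  exact Finset.sum_congr rfl fun k _ => smul_comm _ _ _

/-- The coefficient `c` of a top-degree form `τ = c ν` with respect to a given volume form `ν`
(it is read off on any vectors on which `ν` does not vanish). -/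
def coeff (ν : V [⋀^Fin 6]→ₗ[ℝ] ℝ) (τ : V [⋀^Fin 6]→ₗ[ℝ] F) : F :=
  (ν (Classical.epsilon fun v => ν v ≠ 0))⁻¹ • τ (Classical.epsilon fun v => ν v ≠ 0)

/-- The natural symmetric bilinear form on `V ⊕ V*`, normalised to be the polar form of the
Clifford relation `(v + ξ)² = ξ(v)`. -/
def polar : (V × Module.Dual ℝ V) →ₗ[ℝ] Module.Dual ℝ (V × Module.Dual ℝ V) :=
  LinearMap.mk₂ ℝ (fun u w => u.2 w.1 + w.2 u.1)
    (fun u u' w => by simp; ring) (fun c u w => by simp; ring)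
    (fun u w w' => by simp; ring) (fun c u w => by simp; ring)

/-- The Clifford action `(φ, v + ξ) ↦ (v + ξ) · φ = ι(v) φ + ξ ∧ φ` of `V ⊕ V*` on forms. -/
def clifford : Mixed V ℝ →ₗ[ℝ] (V × Module.Dual ℝ V) →ₗ[ℝ] Mixed V ℝ :=
  LinearMap.mk₂ ℝ (fun φ u => interior φ u.1 + exterior φ u.2)
    (fun φ ψ u => by simp [add_add_add_comm]) (fun c φ u => by simp)
    (fun φ u w => by simp [add_add_add_comm]) (fun c φ u => by simp)

/-- The element `u ∧ w : x ↦ (w, x) u - (u, x) w` of `𝔰𝔬(V ⊕ V*)`, for the form `polar`.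
These elements span `𝔰𝔬(V ⊕ V*)`. -/
def bivector (u w : V × Module.Dual ℝ V) : Module.End ℝ (V × Module.Dual ℝ V) :=
  (polar w).smulRight u - (polar u).smulRight w

/-- The action of `u ∧ w ∈ 𝔰𝔬(V ⊕ V*)` in the spin representation: `½ (u w - w u)` in the
Clifford algebra. -/
def spinAction (u w : V × Module.Dual ℝ V) (φ : Mixed V ℝ) : Mixed V ℝ :=
  (1 / 2 : ℝ) • (clifford (clifford φ w) u - clifford (clifford φ u) w)

/-- The bilinear form `(u, w) ↦ ¼ ⟨σ(u ∧ w) ρ, ρ⟩` on `V ⊕ V*`, where `σ` is the spin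
representation and `⟨ , ⟩` is made real-valued by the volume form `ν`. -/
def momentForm (ν : V [⋀^Fin 6]→ₗ[ℝ] ℝ) (ρ : Mixed V ℝ) :
    (V × Module.Dual ℝ V) →ₗ[ℝ] Module.Dual ℝ (V × Module.Dual ℝ V) :=
  LinearMap.mk₂ ℝ (fun u w => (1 / 4 : ℝ) * coeff ν (pairing (spinAction u w ρ) ρ))
    (fun u u' w => by
      have : spinAction (u + u') w ρ = spinAction u w ρ + spinAction u' w ρ := by
        simp only [spinAction, map_add, LinearMap.add_apply, ← smul_add]; congr 1; abel
      rw [this, pairing_add_left]; simp [coeff]; ring)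
    (fun c u w => by
      have : spinAction (c • u) w ρ = c • spinAction u w ρ := by
        funext k; ext x; simp [spinAction]; ring
      rw [this, pairing_smul_left]; simp [coeff]; ring)
    (fun u w w' => by
      have : spinAction u (w + w') ρ = spinAction u w ρ + spinAction u w' ρ := by
        simp only [spinAction, map_add, LinearMap.add_apply, ← smul_add]; congr 1; abel
      rw [this, pairing_add_left]; simp [coeff]; ring)
    (fun c u w => by
      have : spinAction u (c • w) ρ = c • spinAction u w ρ := by
        funext k; ext x; simp [spinAction]; ring
      rw [this, pairing_smul_left]; simp [coeff]; ring)

variable [FiniteDimensional ℝ V]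

/-- The moment map of the spin representation, with values in `𝔰𝔬(V ⊕ V*)`, identified with its
dual by `tr XY`: the endomorphism `μ = μ(ρ)` with `(μ u, w) = ¼ ⟨σ(u ∧ w) ρ, ρ⟩`
for all `u, w`, that is, `tr (μ a) = ½ ⟨σ(a) ρ, ρ⟩` for all `a` in `𝔰𝔬(V ⊕ V*)`
(see `polar_momentMap` and `trace_momentMap_mul_bivector`). -/
def momentMap (ν : V [⋀^Fin 6]→ₗ[ℝ] ℝ) (ρ : Mixed V ℝ) :
    Module.End ℝ (V × Module.Dual ℝ V) :=
  LinearMap.prod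
    ((Module.evalEquiv ℝ V).symm.toLinearMap ∘ₗ
      LinearMap.lcomp ℝ ℝ (LinearMap.inr ℝ V (Module.Dual ℝ V)) ∘ₗ momentForm ν ρ)
    (LinearMap.lcomp ℝ ℝ (LinearMap.inl ℝ V (Module.Dual ℝ V)) ∘ₗ momentForm ν ρ)

theorem polar_momentMap (ν : V [⋀^Fin 6]→ₗ[ℝ] ℝ) (ρ : Mixed V ℝ) (u w : V × Module.Dual ℝ V) :
    polar (momentMap ν ρ u) w = momentForm ν ρ u w := by
  obtain ⟨w₁, w₂⟩ := w
  have : ((w₁, w₂) : V × Module.Dual ℝ V) = (w₁, 0) + (0, w₂) := by simp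
  have h0 : momentForm ν ρ u (0, w₂) + momentForm ν ρ u (w₁, 0) =
      momentForm ν ρ u ((w₁, 0) + (0, w₂)) := by rw [map_add, add_comm]
  rw [this, ← h0]
  simp [polar, momentMap, add_comm]

theorem trace_momentMap_mul_bivector (ν : V [⋀^Fin 6]→ₗ[ℝ] ℝ) (ρ : Mixed V ℝ)
    (u w : V × Module.Dual ℝ V) :
    LinearMap.trace ℝ _ (momentMap ν ρ * bivector u w) =
      (1 / 2 : ℝ) * coeff ν (pairing (spinAction u w ρ) ρ) := by
  have hsymm : ∀ x y : V × Module.Dual ℝ V, polar x y = polar y x := fun x y => by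
    simp [polar, add_comm]
  have h : momentMap ν ρ * bivector u w =
      (polar w).smulRight (momentMap ν ρ u) - (polar u).smulRight (momentMap ν ρ w) := by
    ext x <;> simp [bivector]
  have hneg : spinAction w u ρ = (-1 : ℝ) • spinAction u w ρ := by
    funext k; ext x; simp [spinAction]; ring
  have h1 : momentForm ν ρ u w = (1 / 4 : ℝ) * coeff ν (pairing (spinAction u w ρ) ρ) := rfl
  have h2 : momentForm ν ρ w u = (1 / 4 : ℝ) * coeff ν (pairing (spinAction w u ρ) ρ) := rfl
  rw [hneg, pairing_smul_left] at h2
  have hsub : ∀ A B : Module.End ℝ (V × Module.Dual ℝ V),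
      LinearMap.trace ℝ _ (A - B) = LinearMap.trace ℝ _ A - LinearMap.trace ℝ _ B :=
    fun A B => map_sub (LinearMap.trace ℝ _) A B
  refine (congrArg _ h).trans ((hsub _ _).trans ?_)
  rw [LinearMap.trace_smulRight, LinearMap.trace_smulRight, hsymm, hsymm u, polar_momentMap,
    polar_momentMap, h1, h2]
  simp [coeff]; ring

/-- The invariant quartic `q(ρ) = tr μ(ρ)²`. -/
def quartic (ν : V [⋀^Fin 6]→ₗ[ℝ] ℝ) (ρ : Mixed V ℝ) : ℝ :=
  LinearMap.trace ℝ _ (momentMap ν ρ * momentMap ν ρ)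

end Algebra

/-! ### Complex spinors and the form `ρ̂` -/

section Complex

variable {V : Type*} [AddCommGroup V] [Module ℝ V]

/-- The Clifford action `v + ξ ↦ (v + ξ) · φ` of `(V ⊕ V*) ⊗ ℂ = (V ⊗ ℂ) ⊕ Hom(V, ℂ)` on a
complex mixed form `φ`. -/
def cliffordC (φ : Mixed V ℂ) : ((ℂ ⊗[ℝ] V) × (V →ₗ[ℝ] ℂ)) →ₗ[ℂ] Mixed V ℂ :=
  LinearMap.coprod (LinearMap.liftBaseChange ℂ (interior φ)) (exterior φ)

/-- The annihilator `E_φ ⊆ (V ⊕ V*) ⊗ ℂ`. -/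
def annihilator (φ : Mixed V ℂ) : Submodule ℂ ((ℂ ⊗[ℝ] V) × (V →ₗ[ℝ] ℂ)) :=
  LinearMap.ker (cliffordC φ)

/-- `φ` is a pure spinor: its annihilator (which is always isotropic if `φ ≠ 0`) has the maximal
dimension `dim V`. -/
def IsPure (φ : Mixed V ℂ) : Prop :=
  Module.finrank ℂ (annihilator φ) = Module.finrank ℝ V

/-- The complex conjugate of a complex mixed form. -/
def conj (φ : Mixed V ℂ) : Mixed V ℂ := fun k =>
  Complex.conjAe.toLinearMap.compAlternatingMap (φ k)

/-- The complex mixed form `ρ + i ψ`, for real mixed forms `ρ` and `ψ`. -/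
def complexForm (ρ ψ : Mixed V ℝ) : Mixed V ℂ := fun k =>
  Complex.ofRealCLM.toLinearMap.compAlternatingMap (ρ k) +
    Complex.I • Complex.ofRealCLM.toLinearMap.compAlternatingMap (ψ k)

/-- `ψ = ρ̂`: writing `ρ + i ψ = 2 φ`, so that `ρ = φ + φ̄`, the form `φ` is a pure spinor of the
same parity `p` as `ρ`, and `⟨φ, φ̄⟩` is a positive multiple of `i ν`. (Without the last condition,
`ρ` determines `φ` only up to complex conjugation.) -/
def IsHat (p : ZMod 2) (ν : V [⋀^Fin 6]→ₗ[ℝ] ℝ) (ρ ψ : Mixed V ℝ) : Prop :=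
  HasParity p ψ ∧ IsPure (complexForm ρ ψ) ∧
    ∃ c : ℝ, 0 < c ∧
      coeff ν (pairing (complexForm ρ ψ) (conj (complexForm ρ ψ))) = c * Complex.I

end Complex

/-! ### Differential forms on a six-dimensional manifold -/

section Manifold

/-- The model space `ℝ⁶`. -/
abbrev E6 : Type := EuclideanSpace ℝ (Fin 6)

variable (M : Type*) [TopologicalSpace M] [ChartedSpace E6 M]
variable (F : Type*) [NormedAddCommGroup F] [NormedSpace ℝ F]

/-- Differential `k`-forms on `M` with values in `F` (not assumed continuous). -/
abbrev Form (k : ℕ) : Type _ := (x : M) → TangentSpace (𝓡 6) x [⋀^Fin k]→L[ℝ] F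

/-- Differential forms of mixed degree. -/
abbrev MixedForm : Type _ := (k : ℕ) → Form M F k

variable {M F}

instance (x : M) : FiniteDimensional ℝ (TangentSpace (𝓡 6) x) :=
  inferInstanceAs (FiniteDimensional ℝ E6)

/-- The expression of a form in the preferred chart at `x₀`: its pull-back under the inverse of
the chart, which is a form on `ℝ⁶` (meaningful on the target of the chart). -/
def Form.inChart {k : ℕ} (τ : Form M F k) (x₀ : M) (y : E6) : E6 [⋀^Fin k]→L[ℝ] F :=
  (τ ((chartAt E6 x₀).symm y)).compContinuousLinearMap
    (mfderiv (𝓡 6) (𝓡 6) (chartAt E6 x₀).symm y ∘L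
      (NormedSpace.fromTangentSpace y).symm.toContinuousLinearMap)

/-- A form is smooth if it is smooth in all charts. -/
def Form.IsSmooth {k : ℕ} (τ : Form M F k) : Prop :=
  ∀ x₀ : M, ContDiffOn ℝ ∞ (τ.inChart x₀) (chartAt E6 x₀).target

/-- The exterior derivative of a form, computed at `x` in the preferred chart at `x`. -/
def Form.d {k : ℕ} (τ : Form M F k) : Form M F (k + 1) := fun x =>
  (extDeriv (τ.inChart x) (chartAt E6 x x)).compContinuousLinearMap
    ((NormedSpace.fromTangentSpace (chartAt E6 x x)).toContinuousLinearMap ∘L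
      mfderiv (𝓡 6) (𝓡 6) (chartAt E6 x) x)

/-- A mixed form is smooth if all its components are. -/
def MixedForm.IsSmooth (ρ : MixedForm M F) : Prop := ∀ k, (ρ k).IsSmooth

/-- The exterior derivative of a mixed form. -/
def MixedForm.d (ρ : MixedForm M F) : MixedForm M F
  | 0 => 0
  | k + 1 => (ρ k).d

/-- The value of a mixed form at a point. -/
def MixedForm.at (ρ : MixedForm M F) (x : M) (k : ℕ) : TangentSpace (𝓡 6) x [⋀^Fin k]→ₗ[ℝ] F :=
  (ρ k x).toAlternatingMap

/-- An even (`p = 0`) or odd (`p = 1`) differential form. -/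
def MixedForm.HasParity (p : ZMod 2) (ρ : MixedForm M F) : Prop :=
  ∀ k : ℕ, (k : ZMod 2) ≠ p → ρ k = 0

/-- The complex differential form `ρ + i ψ`, for real differential forms `ρ` and `ψ`. -/
def MixedForm.complexForm (ρ ψ : MixedForm M ℝ) : MixedForm M ℂ := fun k x =>
  Complex.ofRealCLM.compContinuousAlternatingMap (ρ k x) +
    Complex.I • Complex.ofRealCLM.compContinuousAlternatingMap (ψ k x)

/-- A generalized Calabi–Yau structure on the six-dimensional manifold `M`: a smooth closed
complex form, even or odd, which at each point is a pure spinor with `⟨φ, φ̄⟩ ≠ 0`. -/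
structure IsGeneralizedCalabiYau (φ : MixedForm M ℂ) : Prop where
  isSmooth : φ.IsSmooth
  even_or_odd : φ.HasParity 0 ∨ φ.HasParity 1
  closed : φ.d = 0
  isPure : ∀ x, IsPure (φ.at x)
  pairing_ne_zero : ∀ x, pairing (φ.at x) (conj (φ.at x)) ≠ 0

/-- The orientations of `M` are given by volume forms: smooth nowhere vanishing `6`-forms. -/
structure Form.IsVolumeForm (ν : Form M ℝ 6) : Prop where
  isSmooth : ν.IsSmooth
  ne_zero : ∀ x, ν x ≠ 0

/-- `ρ` is stable: at each point it lies in the open set `U`, where `q < 0`. -/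
def IsStable (ν : Form M ℝ 6) (ρ : MixedForm M ℝ) : Prop :=
  ∀ x, quartic (ν x).toAlternatingMap (ρ.at x) < 0

/-- The `6`-form `φ(ρ) = √(-q(ρ)/3)`, positive with respect to the orientation given by `ν`: since
`q` takes values in `(Λ⁶T*)²`, it only depends on that orientation. -/
def phi (ν : Form M ℝ 6) (ρ : MixedForm M ℝ) : Form M ℝ 6 := fun x =>
  √(-quartic (ν x).toAlternatingMap (ρ.at x) / 3) • ν x

open Classical in
/-- The form `ρ̂` associated with a stable form `ρ` of parity `p`; at each point it is the
form `ψ` determined by `IsHat` (and zero where there is none). -/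
def hat (p : ZMod 2) (ν : Form M ℝ 6) (ρ : MixedForm M ℝ) : MixedForm M ℝ := fun k x =>
  if h : ∃ ψ : (k : ℕ) → TangentSpace (𝓡 6) x [⋀^Fin k]→L[ℝ] ℝ,
      IsHat p (ν x).toAlternatingMap (ρ.at x) (fun k => (ψ k).toAlternatingMap)
  then h.choose k else 0

section Integral

variable (M) in
/-- A smooth partition of unity subordinate to the chart domains. -/
def partition [IsManifold (𝓡 6) ∞ M] [CompactSpace M] [T2Space M] :
    SmoothPartitionOfUnity M (𝓡 6) M Set.univ :=
  (SmoothPartitionOfUnity.exists_isSubordinate_chartAt_source (𝓡 6) M).choose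

/-- The integral `∫_M τ` of a `6`-form over the compact manifold `M` with the orientation given by
`ν`. It is the sum of the integrals of `χᵢ τ`, for a partition of unity `χᵢ` subordinate to charts,
computed as Lebesgue integrals in the charts, where the sign accounts for charts which do not
preserve the orientation. -/
def integral [IsManifold (𝓡 6) ∞ M] [CompactSpace M] [T2Space M] (ν τ : Form M ℝ 6) : ℝ :=
  ∑ᶠ i : M, ∫ y in (chartAt E6 i).target,
    partition M i ((chartAt E6 i).symm y) *
      (SignType.sign (ν.inChart i y (EuclideanSpace.basisFun (Fin 6) ℝ)) : ℝ) *
      τ.inChart i y (EuclideanSpace.basisFun (Fin 6) ℝ)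

/-- The volume functional `V(ρ) = ∫_M φ(ρ)`. -/
def volumeFunctional [IsManifold (𝓡 6) ∞ M] [CompactSpace M] [T2Space M]
    (ν : Form M ℝ 6) (ρ : MixedForm M ℝ) : ℝ :=
  integral ν (phi ν ρ)

/-- `ρ`, a form of parity `p`, is a critical point of `V` in its de Rham cohomology class
`{ρ + dα}`: for each smooth form `α` of the opposite parity, the derivative of `V` at `ρ` in the
direction `dα` exists and is zero. -/
def IsCriticalInClass [IsManifold (𝓡 6) ∞ M] [CompactSpace M] [T2Space M]
    (p : ZMod 2) (ν : Form M ℝ 6) (ρ : MixedForm M ℝ) : Prop :=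
  ∀ α : MixedForm M ℝ, α.IsSmooth → α.HasParity (p + 1) →
    HasDerivAt (fun t : ℝ => volumeFunctional ν (ρ + t • α.d)) 0 0

end Integral

end Manifold

end StableForm
end

/-!
Let `V` be a real vector space of dimension six. Mixed forms on `V` are spinors for `V ⊕ V*`, and
all vectors act on them by self-adjoint operators for the skew pairing `⟨ , ⟩`
(`pairing_clifford`, `pairing_swap`).

*Linear algebra.* Write `μ` for the moment map of a form `ρ` of pure parity. The key fact is that
there is a spinor `X`, cubic in `ρ`, with `μ(u) · ρ = u · X` for all vectors `u`
(`exists_clifford_moment`). It can be checked on `1 + ν`, for a volume form `ν`; it then holds for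
all even forms because the symmetrized cubic map is equivariant and the orbit of `1 + ν` under the
spin group and scaling is open (`SpinorModule.exists_act_eq_of_orbitSpan`, `even_le_orbitSpan`),
and Clifford multiplication by a unit vector exchanges the two parities. Consequently `μ²` is a
scalar, which is `q(ρ)` up to a constant. If `q(ρ) < 0`, then `μ` is a multiple of a complex
structure, the corresponding multiple of `X` is `ρ̂` (`isHat_of_quartic_neg`), and there is no
other choice for `ρ̂`, since a pure spinor has vanishing moment map (`IsHat.eq`). Moreover `X` is
the gradient of `q` up to a constant, so that `√(-q/3)` has derivative `½ ⟨ρ̂, β⟩` at `ρ` in the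
direction `β` (`hasDerivAt_sqrt_quartic`).

*Analysis.* All of this is natural and depends smoothly on `ρ`. Hence `ρ̂` is a smooth form
(`hat_isSmooth`), and the first variation of the volume is `δV(β) = ½ ∫ ⟨ρ̂, β⟩`
(`hasDerivAt_volumeFunctional`). Since exterior multiplication by a `1`-form is self-adjoint,
integration by parts gives `∫ ⟨ρ̂, dα⟩ = -∫ ⟨dρ̂, α⟩` (`integral_pairingForm_d`), first for `α`
supported in a chart. A partition of unity shows that `ρ` is critical if `dρ̂ = 0`
(`integral_pairingForm_d_eq_zero`); conversely, bump forms and the nondegeneracy of the pairing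
show that `dρ̂ = 0` if `ρ` is critical (`d_eq_zero_of_integral`). Finally, `ρ + i ρ̂` is at each
point a pure spinor with `⟨φ, φ̄⟩ ≠ 0`, and `ρ` is closed, so `ρ + i ρ̂` is a generalized
Calabi–Yau structure if and only if `dρ̂ = 0` (`isGeneralizedCalabiYau_iff`).
-/

noncomputable section

namespace StableForm

/-! ### Exterior products as antisymmetrizations -/

section
open Equiv

variable {V : Type*} [AddCommGroup V] [Module ℝ V]
variable {F : Type*} [CommRing F] [Algebra ℝ F]

/-- `wedge` is a sum over shuffles; in the sum over all permutations each shuffle is counted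
`a! b!` times. -/
theorem factorial_smul_wedge_apply {a b n : ℕ} (h : a + b = n) (α : V [⋀^Fin a]→ₗ[ℝ] F)
    (β : V [⋀^Fin b]→ₗ[ℝ] F) (v : Fin n → V) :
    (a.factorial * b.factorial) • wedge h α β v =
      ∑ σ : Perm (Fin n), Perm.sign σ • (α (fun i => v (σ (Fin.cast h (Fin.castAdd b i)))) *
        β (fun j => v (σ (Fin.cast h (Fin.natAdd a j))))) := by
  subst h
  have := MultilinearMap.domCoprod_alternization_eq α β
  have h2 := congrArg (fun f => LinearMap.mul' ℝ F (f (v ∘ finSumFinEquiv))) this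
  simp only [Fintype.card_fin] at h2
  simp only [wedge]
  trans LinearMap.mul' ℝ F (((a.factorial * b.factorial) • (α.domCoprod β)) (v ∘ finSumFinEquiv))
  · rw [AlternatingMap.smul_apply, map_nsmul]
    rfl
  rw [← h2, MultilinearMap.alternatization_apply, map_sum]
  refine Fintype.sum_equiv (finSumFinEquiv.permCongr) _ _ fun σ => ?_
  rw [Perm.sign_permCongr, Units.smul_def, map_zsmul, ← Units.smul_def]
  simp

/-- Under antisymmetrization the `k + 1` terms of `ξ ∧ φ` contribute equally: the `j`-th one differs
from the first by a cyclic permutation of sign `(-1)ʲ`. -/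
theorem sum_sign_smul_oneWedge_mul {k l n : ℕ} (h : k + 1 + l = n) (ξ : V →ₗ[ℝ] F)
    (φ : V [⋀^Fin k]→ₗ[ℝ] F) (ψ : V [⋀^Fin l]→ₗ[ℝ] F) (v : Fin n → V) :
    ∑ σ : Perm (Fin n), Perm.sign σ •
        (oneWedge ξ φ (fun i => v (σ (Fin.cast h (Fin.castAdd l i)))) *
          ψ (fun j => v (σ (Fin.cast h (Fin.natAdd (k + 1) j))))) =
      (k + 1) • ∑ σ : Perm (Fin n), Perm.sign σ •
        (ξ (v (σ (Fin.cast h (Fin.castAdd l 0)))) *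
          φ (fun i => v (σ (Fin.cast h (Fin.castAdd l i.succ)))) *
          ψ (fun j => v (σ (Fin.cast h (Fin.natAdd (k + 1) j))))) := by
  subst h
  simp only [oneWedge_apply, Finset.sum_mul, Finset.smul_sum]
  rw [Finset.sum_comm]
  trans ∑ _j : Fin (k + 1), ∑ σ : Perm (Fin (k + 1 + l)), Perm.sign σ •
        (ξ (v (σ ((Fin.castAdd l 0)))) *
          φ (fun i => v (σ ((Fin.castAdd l i.succ)))) *
          ψ (fun j => v (σ ((Fin.natAdd (k + 1) j)))))
  swap
  · simp [Finset.smul_sum]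
  refine Finset.sum_congr rfl fun j _ => ?_
  let c : Perm (Fin (k + 1 + l)) :=
    finSumFinEquiv.permCongr (Perm.sumCongr (Fin.cycleRange j) 1)
  have hs : Perm.sign c = (-1) ^ (j : ℕ) := by
    simp [c, Perm.sign_permCongr]
  have h1 : ∀ i, c (Fin.castAdd l i) = Fin.castAdd l (Fin.cycleRange j i) := by
    intro i; simp [c, Equiv.permCongr_apply]
  have h2 : ∀ i, c (Fin.natAdd (k + 1) i) = Fin.natAdd (k + 1) i := by
    intro i; simp [c, Equiv.permCongr_apply]
  rw [← Equiv.sum_comp (Equiv.mulRight c)]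
  refine Finset.sum_congr rfl fun σ _ => ?_
  have hr : (j.removeNth fun i => v (σ (Fin.castAdd l (j.cycleRange i)))) =
      fun i => v (σ (Fin.castAdd l i.succ)) := by
    funext i; simp [Fin.removeNth, Fin.cycleRange_succAbove]
  simp only [Equiv.coe_mulRight, Perm.sign_mul, hs, Perm.mul_apply, Fin.cast_eq_self,
    h1, h2, Fin.cycleRange_self, hr]
  rw [mul_smul]
  congr 1
  rw [smul_mul_assoc, Units.smul_def, ← smul_assoc]
  have : ((((-1 : ℤˣ) ^ (j : ℕ) : ℤˣ) : ℤ) • (-1 : ℤ) ^ (j : ℕ)) = 1 := by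
    push_cast; rw [smul_eq_mul, ← mul_pow]; simp
  rw [this, one_smul]

/-- The analogue of `sum_sign_smul_oneWedge_mul` for a `1`-form in the second factor. -/
theorem sum_sign_smul_mul_oneWedge {k l n : ℕ} (h : k + (l + 1) = n) (ξ : V →ₗ[ℝ] F)
    (φ : V [⋀^Fin k]→ₗ[ℝ] F) (ψ : V [⋀^Fin l]→ₗ[ℝ] F) (v : Fin n → V) :
    ∑ σ : Perm (Fin n), Perm.sign σ •
        (φ (fun i => v (σ (Fin.cast h (Fin.castAdd (l + 1) i)))) *
          oneWedge ξ ψ (fun j => v (σ (Fin.cast h (Fin.natAdd k j))))) =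
      (l + 1) • ∑ σ : Perm (Fin n), Perm.sign σ •
        (φ (fun i => v (σ (Fin.cast h (Fin.castAdd (l + 1) i)))) *
          (ξ (v (σ (Fin.cast h (Fin.natAdd k 0)))) *
          ψ (fun j => v (σ (Fin.cast h (Fin.natAdd k j.succ)))))) := by
  subst h
  simp only [oneWedge_apply, Finset.mul_sum, Finset.smul_sum]
  rw [Finset.sum_comm]
  trans ∑ _j : Fin (l + 1), ∑ σ : Perm (Fin (k + (l + 1))), Perm.sign σ •
        (φ (fun i => v (σ ((Fin.castAdd (l + 1) i)))) *
          (ξ (v (σ ((Fin.natAdd k 0)))) *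
          ψ (fun j => v (σ ((Fin.natAdd k j.succ))))))
  swap
  · simp [Finset.smul_sum]
  refine Finset.sum_congr rfl fun j _ => ?_
  let c : Perm (Fin (k + (l + 1))) :=
    finSumFinEquiv.permCongr (Perm.sumCongr 1 (Fin.cycleRange j))
  have hs : Perm.sign c = (-1) ^ (j : ℕ) := by
    simp [c, Perm.sign_permCongr]
  have h1 : ∀ i, c (Fin.natAdd k i) = Fin.natAdd k (Fin.cycleRange j i) := by
    intro i; simp [c, Equiv.permCongr_apply]
  have h2 : ∀ i, c (Fin.castAdd (l + 1) i) = Fin.castAdd (l + 1) i := by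
    intro i; simp [c, Equiv.permCongr_apply]
  rw [← Equiv.sum_comp (Equiv.mulRight c)]
  refine Finset.sum_congr rfl fun σ _ => ?_
  have hr : (j.removeNth fun i => v (σ (Fin.natAdd k (j.cycleRange i)))) =
      fun i => v (σ (Fin.natAdd k i.succ)) := by
    funext i; simp [Fin.removeNth, Fin.cycleRange_succAbove]
  simp only [Equiv.coe_mulRight, Perm.sign_mul, hs, Perm.mul_apply, Fin.cast_eq_self,
    h1, h2, Fin.cycleRange_self, hr]
  rw [mul_smul]
  congr 1
  rw [mul_smul_comm, Units.smul_def, ← smul_assoc]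
  have : ((((-1 : ℤˣ) ^ (j : ℕ) : ℤˣ) : ℤ) • (-1 : ℤ) ^ (j : ℕ)) = 1 := by
    push_cast; rw [smul_eq_mul, ← mul_pow]; simp
  rw [this, one_smul]

theorem factorial_smul_cancel {W : Type*} [AddCommGroup W] [Module ℝ W] (m : ℕ) {x y : W}
    (h : m.factorial • x = m.factorial • y) : x = y := by
  have h2 : ((m.factorial : ℕ) : ℝ) • x = ((m.factorial : ℕ) : ℝ) • y := by
    simpa only [Nat.cast_smul_eq_nsmul] using h
  exact smul_right_injective W (by exact_mod_cast m.factorial_ne_zero) h2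

/-- The exterior product is associative for triples with a `1`-form in the middle; the sign
comes from moving the `1`-form past a `k`-form. -/
theorem wedge_oneWedge_left {k l n : ℕ} (h : k + 1 + l = n) (h' : k + (l + 1) = n)
    (ξ : V →ₗ[ℝ] F) (φ : V [⋀^Fin k]→ₗ[ℝ] F) (ψ : V [⋀^Fin l]→ₗ[ℝ] F) :
    wedge h (oneWedge ξ φ) ψ = (-1 : ℤ) ^ k • wedge h' φ (oneWedge ξ ψ) := by
  ext v
  rw [AlternatingMap.smul_apply]
  have e1 := factorial_smul_wedge_apply h (oneWedge ξ φ) ψ v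
  have e2 := factorial_smul_wedge_apply h' φ (oneWedge ξ ψ) v
  rw [sum_sign_smul_oneWedge_mul] at e1
  rw [sum_sign_smul_mul_oneWedge] at e2
  refine factorial_smul_cancel (k + 1) (factorial_smul_cancel (l + 1) ?_)
  subst h
  let c : Perm (Fin (k + 1 + l)) := Fin.cycleRange ⟨k, by omega⟩
  have key : ∑ σ : Perm (Fin (k + 1 + l)), Perm.sign σ •
        (ξ (v (σ (Fin.castAdd l 0))) * φ (fun i => v (σ (Fin.castAdd l i.succ))) *
          ψ (fun j => v (σ (Fin.natAdd (k + 1) j)))) =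
      (-1 : ℤ) ^ k • ∑ σ : Perm (Fin (k + 1 + l)), Perm.sign σ •
        (φ (fun i => v (σ (Fin.cast h' (Fin.castAdd (l + 1) i)))) *
          (ξ (v (σ (Fin.cast h' (Fin.natAdd k 0)))) *
          ψ (fun j => v (σ (Fin.cast h' (Fin.natAdd k j.succ)))))) := by
    rw [← Equiv.sum_comp (Equiv.mulRight c) (fun σ => Perm.sign σ •
        (φ (fun i => v (σ (Fin.cast h' (Fin.castAdd (l + 1) i)))) *
          (ξ (v (σ (Fin.cast h' (Fin.natAdd k 0)))) *
          ψ (fun j => v (σ (Fin.cast h' (Fin.natAdd k j.succ))))))), Finset.smul_sum]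
    refine Finset.sum_congr rfl fun σ _ => ?_
    have c1 : ∀ i : Fin k, c (Fin.cast h' (Fin.castAdd (l + 1) i)) = Fin.castAdd l i.succ := by
      intro i
      rw [Fin.ext_iff, Fin.coe_cycleRange_of_lt]
      · simp
      · simp [Fin.lt_def]
    have c2 : c (Fin.cast h' (Fin.natAdd k 0)) = Fin.castAdd l 0 := by
      have : Fin.cast h' (Fin.natAdd k 0) = ⟨k, by omega⟩ := by ext; simp
      rw [this]
      have : NeZero (k + 1 + l) := ⟨by omega⟩
      rw [Fin.cycleRange_self]; ext; simp
    have c3 : ∀ j : Fin l, c (Fin.cast h' (Fin.natAdd k j.succ)) = Fin.natAdd (k + 1) j := by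
      intro j
      rw [Fin.cycleRange_of_gt]
      · ext; simp; omega
      · simp [Fin.lt_def]
    have hs : Perm.sign c = (-1) ^ k := Fin.sign_cycleRange _
    simp only [Equiv.coe_mulRight, Perm.sign_mul, hs, Perm.mul_apply, c1, c2, c3]
    rw [mul_comm (Perm.sign σ), mul_smul, Units.smul_def ((-1 : ℤˣ) ^ k), ← smul_assoc]
    have : (-1 : ℤ) ^ k • ((((-1 : ℤˣ) ^ k : ℤˣ) : ℤ)) = 1 := by
      push_cast; rw [smul_eq_mul, ← mul_pow]; simp
    rw [this, one_smul]
    congr 1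
    ring
  simp only [Fin.cast_eq_self] at e1
  rw [key] at e1
  have e1' : ((l + 1).factorial * (k + 1).factorial) •
      wedge rfl (oneWedge ξ φ) ψ v = (l + 1) • ((k + 1).factorial * l.factorial) •
      wedge rfl (oneWedge ξ φ) ψ v := by
    rw [smul_smul, Nat.factorial_succ l]; congr 1; ring
  have e2' : ((l + 1).factorial * (k + 1).factorial) • (-1 : ℤ) ^ k •
      wedge h' φ (oneWedge ξ ψ) v = (k + 1) • (-1 : ℤ) ^ k • (k.factorial * (l + 1).factorial) •
      wedge h' φ (oneWedge ξ ψ) v := by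
    rw [smul_comm (k + 1), smul_smul (k + 1), smul_comm ((-1 : ℤ) ^ k), Nat.factorial_succ k]
    congr 1; ring
  rw [smul_smul, smul_smul, e1', e1, e2', e2]
  rw [smul_comm ((-1 : ℤ) ^ k), smul_comm (k + 1) (l + 1)]
end

/-! ### The Clifford action on forms and the invariant pairing -/

section
variable {V : Type*} [AddCommGroup V] [Module ℝ V]

theorem wedge_zero_left {n : ℕ} (h : 0 + n = n) (c : V [⋀^Fin 0]→ₗ[ℝ] ℝ) (τ : V [⋀^Fin n]→ₗ[ℝ] ℝ) :
    wedge h c τ = c ![] • τ := by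
  ext v
  refine factorial_smul_cancel n ?_
  have := factorial_smul_wedge_apply h c τ v
  rw [Nat.factorial_zero, one_mul] at this
  rw [this]
  have hc : ∀ w, c w = c ![] := fun w => by congr 1; exact Subsingleton.elim _ _
  have hτ : ∀ σ : Equiv.Perm (Fin n), τ (fun j => v (σ (Fin.cast h (Fin.natAdd 0 j)))) =
      Equiv.Perm.sign σ • τ v := fun σ => by
    rw [← τ.map_perm]; congr 1; funext j; simp only [Function.comp]; congr 2; ext; simp
  simp_rw [hτ, hc]
  rw [Finset.sum_congr rfl (g := fun _ => c ![] * τ v) (fun σ _ => by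
    rw [mul_smul_comm, smul_smul, Int.units_mul_self, one_smul])]
  simp [Fintype.card_perm]

theorem wedge_zero_right {n : ℕ} (h : n + 0 = n) (τ : V [⋀^Fin n]→ₗ[ℝ] ℝ)
    (c : V [⋀^Fin 0]→ₗ[ℝ] ℝ) : wedge h τ c = c ![] • τ := by
  ext v
  refine factorial_smul_cancel n ?_
  have := factorial_smul_wedge_apply h τ c v
  rw [Nat.factorial_zero, mul_one] at this
  rw [this]
  have hc : ∀ w, c w = c ![] := fun w => by congr 1; exact Subsingleton.elim _ _
  have hτ : ∀ σ : Equiv.Perm (Fin n), τ (fun j => v (σ (Fin.cast h (Fin.castAdd 0 j)))) =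
      Equiv.Perm.sign σ • τ v := fun σ => by
    rw [← τ.map_perm]; congr 1
  simp_rw [hτ, hc]
  rw [Finset.sum_congr rfl (g := fun _ => c ![] * τ v) (fun σ _ => by
    rw [smul_mul_assoc, smul_smul, Int.units_mul_self, one_smul, mul_comm])]
  simp [Fintype.card_perm]

theorem interior_apply {F : Type*} [CommRing F] [Algebra ℝ F] (φ : Mixed V F) (v : V) (k : ℕ)
    (w : Fin k → V) :
    interior φ v k w = φ (k + 1) (Fin.cons v w) := rfl

theorem exterior_zero {F : Type*} [CommRing F] [Algebra ℝ F] (φ : Mixed V F) (ξ : V →ₗ[ℝ] F) :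
    exterior φ ξ 0 = 0 := rfl

theorem exterior_succ {F : Type*} [CommRing F] [Algebra ℝ F] (φ : Mixed V F) (ξ : V →ₗ[ℝ] F)
    (k : ℕ) :
    exterior φ ξ (k + 1) = oneWedge ξ (φ k) := rfl

theorem exterior_succ_apply (φ : Mixed V ℝ) (ξ : V →ₗ[ℝ] ℝ) (k : ℕ) (v : Fin (k + 1) → V) :
    exterior φ ξ (k + 1) v =
      ∑ i : Fin (k + 1), (-1 : ℝ) ^ (i : ℕ) * (ξ (v i) * φ k (i.removeNth v)) := by
  rw [exterior_succ, oneWedge_apply]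
  refine Finset.sum_congr rfl fun i _ => ?_
  rw [zsmul_eq_mul]; push_cast; rfl

theorem interior_interior (φ : Mixed V ℝ) (v w : V) :
    interior (interior φ v) w + interior (interior φ w) v = 0 := by
  funext k; ext x
  have := (φ (k + 1 + 1)).map_swap (Fin.cons v (Fin.cons w x)) (i := 0) (j := 1) (by simp)
  simp only [Pi.add_apply, AlternatingMap.add_apply, interior_apply, Pi.zero_apply,
    AlternatingMap.zero_apply]
  have h2 : (Fin.cons v (Fin.cons w x : Fin (k + 1) → V) : Fin (k + 1 + 1) → V) ∘
      (Equiv.swap 0 1) = Fin.cons w (Fin.cons v x) := by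
    funext i
    refine Fin.cases ?_ (fun i => ?_) i
    · simp
    · refine Fin.cases ?_ (fun i => ?_) i
      · simp
      · have : Equiv.swap (0 : Fin (k + 1 + 1)) 1 i.succ.succ = i.succ.succ :=
          Equiv.swap_apply_of_ne_of_ne (by simp) (by simp [Fin.ext_iff])
        simp [this]
  rw [h2] at this
  rw [this]; simp

theorem exterior_exterior (φ : Mixed V ℝ) (ξ η : V →ₗ[ℝ] ℝ) :
    exterior (exterior φ ξ) η + exterior (exterior φ η) ξ = 0 := by
  funext k
  rcases k with _ | _ | k
  · simp [exterior_zero]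
  · ext x; simp [exterior_succ, exterior_zero, oneWedge_apply]
  · simp only [Pi.add_apply, exterior_succ, Pi.zero_apply]
    let f : V →ₗ[ℝ] V →ₗ[ℝ] V [⋀^Fin k]→ₗ[ℝ] ℝ := LinearMap.mk₂ ℝ
      (fun x y => (ξ x * η y + η x * ξ y) • φ k)
      (fun a b c => by simp [add_mul, add_smul]; abel)
      (fun a b c => by rw [smul_smul]; congr 1; simp; ring)
      (fun a b c => by rw [← add_smul]; congr 1; simp; ring)
      (fun a b c => by rw [smul_smul]; congr 1; simp; ring)
    have := AlternatingMap.alternatizeUncurryFin_alternatizeUncurryFinLM_comp_of_symmetric (f := f)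
      (fun x y => by simp only [f, LinearMap.mk₂_apply]; congr 1; ring)
    rw [← this]
    ext x
    simp only [AlternatingMap.add_apply, oneWedge_apply,
      AlternatingMap.alternatizeUncurryFin_apply, LinearMap.comp_apply,
      AlternatingMap.alternatizeUncurryFinLM_apply, f, LinearMap.mk₂_apply,
      AlternatingMap.smul_apply, ← Finset.sum_add_distrib, ← smul_add, Finset.mul_sum]
    refine Finset.sum_congr rfl fun i _ => ?_
    congr 1
    refine Finset.sum_congr rfl fun j _ => ?_
    rw [mul_smul_comm, mul_smul_comm, ← smul_add]
    congr 1
    simp; ring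

theorem interior_exterior (φ : Mixed V ℝ) (v : V) (ξ : V →ₗ[ℝ] ℝ) :
    interior (exterior φ ξ) v + exterior (interior φ v) ξ = ξ v • φ := by
  funext k; ext x
  simp only [Pi.add_apply, AlternatingMap.add_apply, interior_apply, Pi.smul_apply,
    AlternatingMap.smul_apply, exterior_succ, oneWedge_apply, Fin.sum_univ_succ]
  rcases k with _ | k
  · simp [exterior_zero]
  · have h1 : ∀ i : Fin (k + 1), (i.succ.removeNth (Fin.cons v x : Fin (k + 1 + 1) → V)) =
        Fin.cons v (i.removeNth x) := by
      intro i; funext j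
      refine Fin.cases ?_ (fun j => ?_) j <;> simp [Fin.removeNth]
    have h0 : ((0 : Fin (k + 1 + 1)).removeNth (Fin.cons v x : Fin (k + 1 + 1) → V)) = x := by
      funext j; simp [Fin.removeNth]
    simp only [exterior_succ, oneWedge_apply, h0, h1, interior_apply, Fin.cons_zero, Fin.cons_succ]
    rw [add_assoc, ← Finset.sum_add_distrib, Finset.sum_eq_zero]
    · simp
    · intro i _; simp [pow_succ]

theorem clifford_apply (φ : Mixed V ℝ) (u : V × Module.Dual ℝ V) :
    clifford φ u = interior φ u.1 + exterior φ u.2 := rfl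

/-- The Clifford relation. -/
theorem clifford_clifford (φ : Mixed V ℝ) (u w : V × Module.Dual ℝ V) :
    clifford (clifford φ w) u + clifford (clifford φ u) w = polar u w • φ := by
  have h1 := interior_interior φ w.1 u.1
  have h2 := exterior_exterior φ w.2 u.2
  have h3 := interior_exterior φ u.1 w.2
  have h4 := interior_exterior φ w.1 u.2
  have : polar u w = w.2 u.1 + u.2 w.1 := by simp [polar, add_comm]
  simp only [clifford_apply, map_add, LinearMap.add_apply]
  rw [this, add_smul, ← h3, ← h4]
  have e : ∀ a b c d e f g h : Mixed V ℝ, a + c = 0 → b + d = 0 →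
      a + e + (f + b) + (c + g + (h + d)) = (f + g) + (h + e) := by
    intro a b c d e f g h h1 h2
    have : a + e + (f + b) + (c + g + (h + d)) = (a + c) + (b + d) + ((f + g) + (h + e)) := by abel
    rw [this, h1, h2]; simp
  exact e _ _ _ _ _ _ _ _ h1 h2

/-- Exterior multiplication by a `1`-form is self-adjoint: the signs in the pairing compensate for
the sign `(-1)ᵏ` from moving the `1`-form past a `k`-form. -/
theorem pairing_exterior (φ ψ : Mixed V ℝ) (ξ : V →ₗ[ℝ] ℝ) :
    pairing (exterior φ ξ) ψ = pairing φ (exterior ψ ξ) := by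
  have hw : ∀ (k l : ℕ) (h : k + 1 + l = 6) (h' : k + (l + 1) = 6),
      wedge h (exterior φ ξ (k + 1)) (ψ l) =
        (-1 : ℤ) ^ k • wedge h' (φ k) (exterior ψ ξ (l + 1)) :=
    fun k l h h' => wedge_oneWedge_left h h' ξ (φ k) (ψ l)
  have z1 : ∀ (β : V [⋀^Fin 6]→ₗ[ℝ] ℝ), wedge (by omega : 0 + 6 = 6) (exterior φ ξ 0) β = 0 := by
    intro β; rw [wedge_zero_left]; simp [exterior_zero]
  have z2 : ∀ (β : V [⋀^Fin 6]→ₗ[ℝ] ℝ), wedge (by omega : 6 + 0 = 6) β (exterior ψ ξ 0) = 0 := by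
    intro β; rw [wedge_zero_right]; simp [exterior_zero]
  simp only [pairing, Fin.sum_univ_seven]
  have e0 := hw 0 5 (by omega) (by omega)
  have e1 := hw 1 4 (by omega) (by omega)
  have e2 := hw 2 3 (by omega) (by omega)
  have e3 := hw 3 2 (by omega) (by omega)
  have e4 := hw 4 1 (by omega) (by omega)
  have e5 := hw 5 0 (by omega) (by omega)
  have e6 := z1 (ψ 6)
  have e7 := z2 (φ 6)
  simp only [Nat.reduceAdd] at e0 e1 e2 e3 e4 e5 e6 e7
  simp [e0, e1, e2, e3, e4, e5, e6, e7]

theorem wedge_add_right {a b n : ℕ} (h : a + b = n) (α : V [⋀^Fin a]→ₗ[ℝ] ℝ)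
    (β β' : V [⋀^Fin b]→ₗ[ℝ] ℝ) : wedge h α (β + β') = wedge h α β + wedge h α β' := by
  ext v
  refine factorial_smul_cancel a (factorial_smul_cancel b ?_)
  simp only [smul_smul, AlternatingMap.add_apply, smul_add]
  rw [mul_comm]
  simp only [factorial_smul_wedge_apply, ← Finset.sum_add_distrib, ← smul_add, mul_add,
    AlternatingMap.add_apply]

theorem wedge_smul_right {a b n : ℕ} (h : a + b = n) (c : ℝ) (α : V [⋀^Fin a]→ₗ[ℝ] ℝ)
    (β : V [⋀^Fin b]→ₗ[ℝ] ℝ) : wedge h α (c • β) = c • wedge h α β := by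
  ext v
  refine factorial_smul_cancel a (factorial_smul_cancel b ?_)
  simp only [smul_smul, AlternatingMap.smul_apply]
  rw [mul_comm, smul_comm _ c]
  simp only [factorial_smul_wedge_apply, Finset.smul_sum, AlternatingMap.smul_apply]
  refine Finset.sum_congr rfl fun σ _ => ?_
  rw [mul_smul_comm, smul_comm]

theorem wedge_apply_eq_sum {a b n : ℕ} (h : a + b = n) (α : V [⋀^Fin a]→ₗ[ℝ] ℝ)
    (β : V [⋀^Fin b]→ₗ[ℝ] ℝ) (v : Fin n → V) : wedge h α β v =
      ((a.factorial * b.factorial : ℕ) : ℝ)⁻¹ * ∑ σ : Equiv.Perm (Fin n),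
        ((Equiv.Perm.sign σ : ℤˣ) : ℤ) * (α (fun i => v (σ (Fin.cast h (Fin.castAdd b i)))) *
        β (fun j => v (σ (Fin.cast h (Fin.natAdd a j))))) := by
  have h1 := factorial_smul_wedge_apply h α β v
  have h2 : ((a.factorial * b.factorial : ℕ) : ℝ) ≠ 0 := by
    exact_mod_cast (Nat.mul_pos a.factorial_pos b.factorial_pos).ne'
  rw [eq_inv_mul_iff_mul_eq₀ h2, ← nsmul_eq_mul, h1]
  refine Finset.sum_congr rfl fun σ _ => ?_
  rw [Units.smul_def, zsmul_eq_mul]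

theorem zero_wedge {a b n : ℕ} (h : a + b = n) (β : V [⋀^Fin b]→ₗ[ℝ] ℝ) :
    wedge h (0 : V [⋀^Fin a]→ₗ[ℝ] ℝ) β = 0 := by
  have := wedge_smul_left h 0 (0 : V [⋀^Fin a]→ₗ[ℝ] ℝ) β
  rwa [zero_smul, zero_smul] at this

theorem wedge_zero {a b n : ℕ} (h : a + b = n) (α : V [⋀^Fin a]→ₗ[ℝ] ℝ) :
    wedge h α (0 : V [⋀^Fin b]→ₗ[ℝ] ℝ) = 0 := by
  have := wedge_smul_right h 0 α (0 : V [⋀^Fin b]→ₗ[ℝ] ℝ)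
  rwa [zero_smul, zero_smul] at this

theorem pairing_add_right (φ ψ ψ' : Mixed V ℝ) :
    pairing φ (ψ + ψ') = pairing φ ψ + pairing φ ψ' := by
  simp [pairing, wedge_add_right, Finset.sum_add_distrib]

theorem pairing_smul_right (c : ℝ) (φ ψ : Mixed V ℝ) :
    pairing φ (c • ψ) = c • pairing φ ψ := by
  simp only [pairing, Pi.smul_apply, wedge_smul_right, Finset.smul_sum]
  exact Finset.sum_congr rfl fun k _ => smul_comm _ _ _

/-- The pairing as a bilinear map. -/
def pairingₗ : Mixed V ℝ →ₗ[ℝ] Mixed V ℝ →ₗ[ℝ] V [⋀^Fin 6]→ₗ[ℝ] ℝ :=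
  LinearMap.mk₂ ℝ pairing pairing_add_left pairing_smul_left pairing_add_right
    pairing_smul_right

theorem pairingₗ_apply (φ ψ : Mixed V ℝ) : pairingₗ φ ψ = pairing φ ψ := rfl

/-- A `k`-form as a mixed form. -/
def ofDegree (k : ℕ) (α : V [⋀^Fin k]→ₗ[ℝ] ℝ) : Mixed V ℝ := Pi.single k α

theorem ofDegree_self (k : ℕ) (α : V [⋀^Fin k]→ₗ[ℝ] ℝ) : ofDegree k α k = α := by
  simp [ofDegree]

theorem ofDegree_of_ne {k l : ℕ} (h : l ≠ k) (α : V [⋀^Fin k]→ₗ[ℝ] ℝ) : ofDegree k α l = 0 := by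
  simp [ofDegree, h]

theorem exterior_ofDegree {k : ℕ} (α : V [⋀^Fin k]→ₗ[ℝ] ℝ) (ξ : V →ₗ[ℝ] ℝ) :
    exterior (ofDegree k α) ξ = ofDegree (k + 1) (oneWedge ξ α) := by
  funext l
  rcases l with _ | l
  · rw [ofDegree_of_ne (by omega), exterior_zero]
  · rw [exterior_succ]
    by_cases h : l = k
    · subst h; rw [ofDegree_self, ofDegree_self]
    · rw [ofDegree_of_ne h, ofDegree_of_ne (by omega)]; ext; simp [oneWedge_apply]

theorem interior_ofDegree_succ {k : ℕ} (α : V [⋀^Fin (k + 1)]→ₗ[ℝ] ℝ) (v : V) :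
    interior (ofDegree (k + 1) α) v = ofDegree k (α.curryLeft v) := by
  funext l; ext w
  rw [interior_apply]
  by_cases h : l = k
  · subst h; rw [ofDegree_self, ofDegree_self]; rfl
  · rw [ofDegree_of_ne h, ofDegree_of_ne (by omega)]; simp

theorem interior_ofDegree_zero (α : V [⋀^Fin 0]→ₗ[ℝ] ℝ) (v : V) :
    interior (ofDegree 0 α) v = 0 := by
  funext l; ext w
  rw [interior_apply, ofDegree_of_ne (by omega)]; simp

theorem alternating_sum_apply {F : Type*} [AddCommGroup F] [Module ℝ F] {ι : Type*} (s : Finset ι)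
    {k : ℕ} (f : ι → V [⋀^Fin k]→ₗ[ℝ] F) (v : Fin k → V) : (∑ i ∈ s, f i) v = ∑ i ∈ s, f i v :=
  map_sum (⟨⟨fun g : V [⋀^Fin k]→ₗ[ℝ] F => g v, rfl⟩, fun _ _ => rfl⟩ :
    (V [⋀^Fin k]→ₗ[ℝ] F) →+ F) f s

theorem pairing_apply_eq_sum {F : Type*} [CommRing F] [Algebra ℝ F] (φ ψ : Mixed V F)
    (v : Fin 6 → V) : pairing φ ψ v = ∑ k : Fin 7, ((-1 : ℤ) ^ ((k : ℕ) / 2) : ℤ) *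
      wedge (by omega : (k : ℕ) + (6 - (k : ℕ)) = 6) (φ k) (ψ (6 - (k : ℕ))) v := by
  rw [pairing, alternating_sum_apply]
  refine Finset.sum_congr rfl fun k _ => ?_
  rw [AlternatingMap.smul_apply, zsmul_eq_mul]

/-- Euler's formula for the degree: `∑ᵢ eⁱ ∧ ι(eᵢ) α = k α` for a `k`-form `α`. -/
theorem sum_oneWedge_curryLeft {ι : Type*} [Fintype ι] [DecidableEq ι] (e : Module.Basis ι ℝ V)
    {k : ℕ} (α : V [⋀^Fin (k + 1)]→ₗ[ℝ] ℝ) :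
    ∑ i, oneWedge (e.coord i) (α.curryLeft (e i)) = ((k : ℝ) + 1) • α := by
  have h := AlternatingMap.alternatizeUncurryFin_curryLeft α
  have : ((k : ℝ) + 1) • α = (k + 1) • α := by
    rw [← Nat.cast_smul_eq_nsmul ℝ]; push_cast; rfl
  rw [this, ← h]
  ext v
  rw [alternating_sum_apply]
  simp only [oneWedge_apply, AlternatingMap.alternatizeUncurryFin_apply]
  rw [Finset.sum_comm]
  refine Finset.sum_congr rfl fun j _ => ?_
  rw [← Finset.smul_sum]
  congr 1
  conv_rhs => rw [← e.sum_repr (v j), map_sum, alternating_sum_apply]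
  simp

theorem alternating_eq_zero_of_finrank_lt [FiniteDimensional ℝ V] {k : ℕ}
    (hk : Module.finrank ℝ V < k) (α : V [⋀^Fin k]→ₗ[ℝ] ℝ) : α = 0 := by
  ext v
  refine α.map_linearDependent v fun h => ?_
  have := h.fintype_card_le_finrank
  simp at this; omega

variable [FiniteDimensional ℝ V]

theorem mixed_eq_sum (h6 : Module.finrank ℝ V = 6) (φ : Mixed V ℝ) :
    φ = ∑ k : Fin 7, ofDegree k (φ k) := by
  funext l
  rw [Finset.sum_apply]
  by_cases hl : l < 7
  · rw [Finset.sum_eq_single ⟨l, hl⟩, ofDegree_self]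
    · intro b _ hb
      exact ofDegree_of_ne (fun h => hb (Fin.ext h.symm)) _
    · simp
  · exact (alternating_eq_zero_of_finrank_lt (by omega) _).trans
      (alternating_eq_zero_of_finrank_lt (by omega) _).symm

/-- Mixed forms are generated by constants under exterior multiplication. -/
theorem mixed_induction (h6 : Module.finrank ℝ V = 6) {P : Mixed V ℝ → Prop}
    (hadd : ∀ φ ψ, P φ → P ψ → P (φ + ψ)) (hsmul : ∀ (c : ℝ) φ, P φ → P (c • φ))
    (h0 : ∀ α, P (ofDegree 0 α)) (h1 : ∀ φ ξ, P φ → P (exterior φ ξ)) (φ : Mixed V ℝ) : P φ := by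
  have hz : P 0 := by simpa using hsmul 0 _ (h0 0)
  have hsum : ∀ {ι : Type} (s : Finset ι) (f : ι → Mixed V ℝ), (∀ i, P (f i)) →
      P (∑ i ∈ s, f i) := fun s f hf => Finset.sum_induction f P hadd hz fun i _ => hf i
  have hk : ∀ (k : ℕ) (α : V [⋀^Fin k]→ₗ[ℝ] ℝ), P (ofDegree k α) := by
    intro k
    induction k with
    | zero => exact h0
    | succ k ih =>
      intro α
      let e := Module.finBasis ℝ V
      have h := sum_oneWedge_curryLeft e α
      have h2 : α = ((k : ℝ) + 1)⁻¹ • ∑ i, oneWedge (e.coord i) (α.curryLeft (e i)) := by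
        rw [h, smul_smul, inv_mul_cancel₀ (by positivity), one_smul]
      have h3 : ofDegree (k + 1) α = ((k : ℝ) + 1)⁻¹ •
          ∑ i, exterior (ofDegree k (α.curryLeft (e i))) (e.coord i) := by
        conv_lhs => rw [h2]
        simp only [exterior_ofDegree]
        rw [ofDegree, Pi.single_smul]; congr 1
        exact map_sum (AddMonoidHom.single (fun k => V [⋀^Fin k]→ₗ[ℝ] ℝ) (k + 1)) _ _
      rw [h3]
      exact hsmul _ _ (hsum _ _ fun i => h1 _ _ (ih _))
  rw [mixed_eq_sum h6 φ]
  exact hsum _ _ fun k => hk _ _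

omit [FiniteDimensional ℝ V] in
theorem pairing_ofDegree_zero_left (α : V [⋀^Fin 0]→ₗ[ℝ] ℝ) (ψ : Mixed V ℝ) :
    pairing (ofDegree 0 α) ψ = α ![] • ψ 6 := by
  have h : ∀ (k : ℕ) (hk : k ≠ 0) (h : k + (6 - k) = 6),
      wedge h (ofDegree 0 α k) (ψ (6 - k)) = 0 := by
    intro k hk h
    rw [ofDegree_of_ne hk, zero_wedge]
  rw [pairing, Finset.sum_eq_single 0]
  · have := wedge_zero_left (by omega : 0 + 6 = 6) α (ψ 6)
    rw [← this, ← ofDegree_self 0 α]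
    exact one_smul ℤ _
  · intro k _ hk
    rw [h k (fun h => hk (Fin.ext h)), smul_zero]
  · simp

omit [FiniteDimensional ℝ V] in
theorem pairing_ofDegree_zero_right (α : V [⋀^Fin 0]→ₗ[ℝ] ℝ) (φ : Mixed V ℝ) :
    pairing φ (ofDegree 0 α) = -(α ![] • φ 6) := by
  have h : ∀ (k : ℕ) (hk : 6 - k ≠ 0) (h : k + (6 - k) = 6),
      wedge h (φ k) (ofDegree 0 α (6 - k)) = 0 := by
    intro k hk h
    rw [ofDegree_of_ne hk, wedge_zero]
  simp only [pairing, Fin.sum_univ_seven]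
  have e0 := h 0 (by omega) (by omega)
  have e1 := h 1 (by omega) (by omega)
  have e2 := h 2 (by omega) (by omega)
  have e3 := h 3 (by omega) (by omega)
  have e4 := h 4 (by omega) (by omega)
  have e5 := h 5 (by omega) (by omega)
  have e6 := wedge_zero_right (by omega : 6 + 0 = 6) (φ 6) α
  rw [← ofDegree_self 0 α] at e6
  simp only [ofDegree_self 0 α] at e6
  simp [e0, e1, e2, e3, e4, e5, e6, ofDegree_self]

/-- Interior multiplication is self-adjoint. For constants both sides vanish for degree reasons, and
the Clifford relation allows an induction over exterior multiplications. -/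
theorem pairing_interior (h6 : Module.finrank ℝ V = 6) (φ ψ : Mixed V ℝ) (v : V) :
    pairing (interior φ v) ψ = pairing φ (interior ψ v) := by
  revert ψ
  refine mixed_induction h6 (P := fun φ => ∀ ψ, pairing (interior φ v) ψ = pairing φ (interior ψ v))
    ?_ ?_ ?_ ?_ φ
  · intro φ φ' h h' ψ
    simp only [map_add, LinearMap.add_apply, pairing_add_left, h, h']
  · intro c φ h ψ
    simp only [map_smul, LinearMap.smul_apply, pairing_smul_left, h]
  · intro α ψ
    rw [interior_ofDegree_zero, pairing_ofDegree_zero_left]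
    have : interior ψ v 6 = 0 := by
      ext w; rw [interior_apply, alternating_eq_zero_of_finrank_lt (by omega) (ψ (6 + 1))]; simp
    rw [this, smul_zero]
    have h0 := pairing_smul_left 0 (0 : Mixed V ℝ) ψ
    rwa [zero_smul, zero_smul] at h0
  · intro φ ξ h ψ
    have h1 := interior_exterior φ v ξ
    have h2 := interior_exterior ψ v ξ
    have h1' : interior (exterior φ ξ) v = ξ v • φ + (-1 : ℝ) • exterior (interior φ v) ξ := by
      rw [← h1]; funext k; ext x; simp
    have h2' : exterior (interior ψ v) ξ = ξ v • ψ + (-1 : ℝ) • interior (exterior ψ ξ) v := by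
      rw [← h2]; funext k; ext x; simp
    rw [pairing_exterior, h2', h1', pairing_add_left, pairing_add_right, pairing_smul_left,
      pairing_smul_left, pairing_smul_right, pairing_smul_right, pairing_exterior, h]

theorem pairing_clifford (h6 : Module.finrank ℝ V = 6) (φ ψ : Mixed V ℝ)
    (u : V × Module.Dual ℝ V) : pairing (clifford φ u) ψ = pairing φ (clifford ψ u) := by
  rw [clifford_apply, clifford_apply, pairing_add_left, pairing_add_right, pairing_interior h6,
    pairing_exterior]

theorem pairing_swap (h6 : Module.finrank ℝ V = 6) (φ ψ : Mixed V ℝ) :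
    pairing φ ψ = -pairing ψ φ := by
  revert ψ
  refine mixed_induction h6 (P := fun φ => ∀ ψ, pairing φ ψ = -pairing ψ φ) ?_ ?_ ?_ ?_ φ
  · intro φ φ' h h' ψ
    rw [pairing_add_left, pairing_add_right, h, h', neg_add]
  · intro c φ h ψ
    rw [pairing_smul_left, pairing_smul_right, h, smul_neg]
  · intro α ψ
    rw [pairing_ofDegree_zero_left, pairing_ofDegree_zero_right, neg_neg]
  · intro φ ξ h ψ
    rw [pairing_exterior, h, pairing_exterior]

/-- The pairing is nondegenerate. -/
theorem eq_zero_of_pairing_eq_zero (h6 : Module.finrank ℝ V = 6) {ν : V [⋀^Fin 6]→ₗ[ℝ] ℝ}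
    (hν : ν ≠ 0) (φ : Mixed V ℝ) (h : ∀ ψ, pairing φ ψ = 0) : φ = 0 := by
  -- Contraction with a vector preserves the hypothesis and lowers the degree to `0`, where `ψ = ν`
  -- detects the constant term.
  have : ∀ (k : ℕ) (φ : Mixed V ℝ), (∀ ψ, pairing φ ψ = 0) → φ k = 0 := by
    intro k
    induction k with
    | zero =>
      intro φ h
      have h1 := h (ofDegree 6 ν)
      have h2 : pairing (ofDegree 0 (φ 0)) (ofDegree 6 ν) = 0 := by
        rw [← h1]
        simp only [pairing]
        refine Finset.sum_congr rfl fun k _ => ?_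
        by_cases hk : k = 0
        · subst hk; simp [ofDegree_self]
        · have hk' : (k : ℕ) ≠ 0 := fun h => hk (Fin.ext h)
          congr 1
          rw [ofDegree_of_ne (k := 6) (by omega : 6 - (k : ℕ) ≠ 6), wedge_zero, wedge_zero]
      rw [pairing_ofDegree_zero_left, ofDegree_self, smul_eq_zero] at h2
      ext w
      have : w = ![] := Subsingleton.elim _ _
      rw [this]
      simpa using h2.resolve_right hν
    | succ k ih =>
      intro φ h
      ext w
      have := ih (interior φ (w 0)) fun ψ => by rw [pairing_interior h6, h]
      have h3 := congrArg (fun f => f (Fin.tail w)) this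
      rw [interior_apply, Fin.cons_self_tail] at h3
      simpa using h3
  funext k
  exact this k φ h

end

/-! ### Moment maps of spinor modules -/

/-- A module of spinors `S` over the quadratic space `D`: a representation of the Clifford algebra
of the symmetric form `form`, and a skew bilinear form on `S` for which each vector of `D` is
self-adjoint. -/
structure SpinorModule (D S : Type*) [AddCommGroup D] [Module ℝ D] [AddCommGroup S]
    [Module ℝ S] where
  /-- the symmetric bilinear form on vectors -/
  form : D →ₗ[ℝ] D →ₗ[ℝ] ℝ
  /-- the Clifford action of vectors on spinors -/
  act : D →ₗ[ℝ] S →ₗ[ℝ] S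
  /-- the invariant skew form on spinors -/
  pair : S →ₗ[ℝ] S →ₗ[ℝ] ℝ
  form_swap : ∀ u w, form u w = form w u
  form_nondegenerate : ∀ u, (∀ w, form u w = 0) → u = 0
  act_act_add : ∀ u w s, act u (act w s) + act w (act u s) = form u w • s
  pair_act : ∀ u s t, pair (act u s) t = pair s (act u t)
  pair_swap : ∀ s t, pair s t = -pair t s

namespace SpinorModule

variable {D S : Type*} [AddCommGroup D] [Module ℝ D] [AddCommGroup S] [Module ℝ S]
  (C : SpinorModule D S)

theorem act_act (u w : D) (s : S) :
    C.act u (C.act w s) = C.form u w • s - C.act w (C.act u s) :=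
  eq_sub_of_add_eq (C.act_act_add u w s)

theorem eq_of_form {u u' : D} (h : ∀ w, C.form u w = C.form u' w) : u = u' :=
  sub_eq_zero.1 (C.form_nondegenerate _ fun w => by rw [map_sub, LinearMap.sub_apply, h, sub_self])

/-- The action `pq - qp` of the Lie algebra of the spin group on spinors. -/
def comm (p q : D) : S →ₗ[ℝ] S := C.act p ∘ₗ C.act q - C.act q ∘ₗ C.act p

/-- The action of `pq - qp` on vectors. -/
def adj (p q : D) : D →ₗ[ℝ] D :=
  (2 : ℝ) • ((C.form q).smulRight p - (C.form p).smulRight q)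

theorem comm_apply (p q : D) (s : S) :
    C.comm p q s = C.act p (C.act q s) - C.act q (C.act p s) := rfl

theorem adj_apply (p q u : D) :
    C.adj p q u = (2 : ℝ) • (C.form q u • p - C.form p u • q) := rfl

/-- `pq - qp` acts compatibly on vectors and on spinors. -/
theorem comm_act (p q u : D) (s : S) :
    C.comm p q (C.act u s) = C.act (C.adj p q u) s + C.act u (C.comm p q s) := by
  simp only [comm_apply, adj_apply, map_sub, map_smul, LinearMap.sub_apply, LinearMap.smul_apply]
  rw [C.act_act q u s, C.act_act p u s, map_sub, map_sub, map_smul, map_smul,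
    C.act_act p u (C.act q s), C.act_act q u (C.act p s)]
  module

theorem pair_comm (p q : D) (s t : S) : C.pair (C.comm p q s) t = -C.pair s (C.comm p q t) := by
  simp only [comm_apply, map_sub, LinearMap.sub_apply, C.pair_act]
  ring

theorem form_adj (p q u w : D) : C.form (C.adj p q u) w = -C.form u (C.adj p q w) := by
  simp only [adj_apply, map_sub, map_smul, LinearMap.sub_apply, LinearMap.smul_apply, smul_eq_mul]
  rw [C.form_swap u p, C.form_swap u q]; ring

/-- The maps `D → S` of the form `u ↦ u X`. -/
def cliffordMaps : Submodule ℝ (D →ₗ[ℝ] S) := LinearMap.range C.act.flip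

theorem mem_cliffordMaps (f : D →ₗ[ℝ] S) : f ∈ C.cliffordMaps ↔ ∃ X, ∀ u, f u = C.act u X := by
  constructor
  · rintro ⟨X, rfl⟩; exact ⟨X, fun u => rfl⟩
  · rintro ⟨X, h⟩; exact ⟨X, LinearMap.ext fun u => (h u).symm⟩

/-- `ρ + i ψ` is annihilated by a complement of `D` in `D ⊗ ℂ`, the graph `{u + i w}` of a complex
structure `u ↦ w`, and `⟨ρ, ψ⟩ < 0`. For forms on a six-dimensional space this says that `ψ = ρ̂`,
up to the parity of `ψ`. -/
def IsConj (ρ ψ : S) : Prop :=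
  (∀ u, ∃ w, C.act u ρ = C.act w ψ ∧ C.act u ψ = -C.act w ρ) ∧ C.pair ρ ψ < 0

/-- No nonzero vector annihilates both of two spinors with nonzero pairing. -/
theorem eq_zero_of_act_eq_zero {ρ ψ : S} (h : C.pair ρ ψ ≠ 0) {u : D} (h1 : C.act u ρ = 0)
    (h2 : C.act u ψ = 0) : u = 0 := by
  refine C.form_nondegenerate u fun w => ?_
  have h3 := congrArg (fun s => C.pair s ψ) (C.act_act_add u w ρ)
  simp only [map_smul, LinearMap.smul_apply, smul_eq_mul, h1, map_zero, add_zero, C.pair_act u,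
    h2] at h3
  exact (mul_eq_zero.1 h3.symm).resolve_right h

theorem eq_of_act_eq {e : D} (he : C.form e e = 2) {s t : S} (h : ∀ u, C.act u s = C.act u t) :
    s = t := by
  have ee : ∀ s, (2 : ℝ) • s = (2 : ℝ) • C.act e (C.act e s) := fun s => by
    rw [← he, ← C.act_act_add e e s, he, two_smul]
  have := ee s
  rw [h e, ← ee t] at this
  exact smul_right_injective S (two_ne_zero (α := ℝ)) this

variable [FiniteDimensional ℝ D]

/-- The identification of `D` with its dual. -/
def toDual : D ≃ₗ[ℝ] Module.Dual ℝ D :=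
  LinearMap.linearEquivOfInjective C.form
    (by
      rw [← LinearMap.ker_eq_bot, LinearMap.ker_eq_bot']
      exact fun u hu => C.form_nondegenerate u fun w => by rw [hu]; rfl)
    (Subspace.dual_finrank_eq).symm

/-- The vector `u` with `(u, w) = ⟨w s, t⟩` for all `w`. -/
def rep : S →ₗ[ℝ] S →ₗ[ℝ] D :=
  LinearMap.compr₂ (LinearMap.mk₂ ℝ (fun s t => (C.pair.flip t) ∘ₗ (C.act.flip s))
    (fun s s' t => by ext; simp) (fun c s t => by ext; simp)
    (fun s t t' => by ext; simp) (fun c s t => by ext; simp)) C.toDual.symm.toLinearMap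

theorem form_rep (s t : S) (w : D) : C.form (C.rep s t) w = C.pair (C.act w s) t := by
  have h : C.toDual (C.rep s t) = (C.pair.flip t) ∘ₗ (C.act.flip s) := by
    simp [rep]
  exact congrArg (fun f : Module.Dual ℝ D => f w) h

/-- Equivariance of `rep`. -/
theorem adj_rep (p q : D) (s t : S) :
    C.adj p q (C.rep s t) = C.rep (C.comm p q s) t + C.rep s (C.comm p q t) := by
  refine C.eq_of_form fun w => ?_
  rw [form_adj, map_add, LinearMap.add_apply, form_rep, form_rep, form_rep]
  have h := C.comm_act p q w s
  have h2 := C.pair_comm p q (C.act w s) t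
  rw [h, map_add, LinearMap.add_apply] at h2
  linarith

/-- The map `u ↦ rep x (u y) z`, whose value for `x = y = z = ρ` is `4 μ(ρ)(u) ρ`. -/
def cubic (x y z : S) : D →ₗ[ℝ] S := C.act.flip z ∘ₗ C.rep x ∘ₗ C.act.flip y

theorem cubic_apply (x y z : S) (u : D) : C.cubic x y z u = C.act (C.rep x (C.act u y)) z := rfl

/-- The symmetrization of `cubic`. -/
def cubicSymm (x y z : S) : D →ₗ[ℝ] S :=
  C.cubic x y z + C.cubic y z x + C.cubic z x y + C.cubic x z y + C.cubic z y x + C.cubic y x z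

/-- The action of `pq - qp` on maps `D → S`. -/
def lie (p q : D) (f : D →ₗ[ℝ] S) : D →ₗ[ℝ] S := C.comm p q ∘ₗ f - f ∘ₗ C.adj p q

omit [FiniteDimensional ℝ D] in
theorem lie_mem (p q : D) {f : D →ₗ[ℝ] S} (hf : f ∈ C.cliffordMaps) :
    C.lie p q f ∈ C.cliffordMaps := by
  rw [mem_cliffordMaps] at hf ⊢
  obtain ⟨X, hX⟩ := hf
  refine ⟨C.comm p q X, fun u => ?_⟩
  simp only [lie, LinearMap.sub_apply, LinearMap.comp_apply, hX, comm_act]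
  abel

theorem lie_cubic (p q : D) (x y z : S) :
    C.lie p q (C.cubic x y z) = C.cubic (C.comm p q x) y z + C.cubic x (C.comm p q y) z +
      C.cubic x y (C.comm p q z) := by
  ext u
  simp only [lie, LinearMap.sub_apply, LinearMap.comp_apply, LinearMap.add_apply, cubic_apply,
    comm_act, adj_rep, map_add]
  abel

theorem lie_cubicSymm (p q : D) (x y z : S) :
    C.lie p q (C.cubicSymm x y z) = C.cubicSymm (C.comm p q x) y z +
      C.cubicSymm x (C.comm p q y) z + C.cubicSymm x y (C.comm p q z) := by
  have h : ∀ f g, C.lie p q (f + g) = C.lie p q f + C.lie p q g := fun f g => by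
    ext u; simp only [lie, LinearMap.sub_apply, LinearMap.comp_apply, LinearMap.add_apply, map_add]
    abel
  simp only [cubicSymm, h, lie_cubic]
  abel

theorem cubicSymm_add (x x' y z : S) :
    C.cubicSymm (x + x') y z = C.cubicSymm x y z + C.cubicSymm x' y z := by
  ext u
  simp only [cubicSymm, LinearMap.add_apply, cubic_apply, map_add]
  abel

theorem cubicSymm_smul (c : ℝ) (x y z : S) :
    C.cubicSymm (c • x) y z = c • C.cubicSymm x y z := by
  ext u
  simp only [cubicSymm, LinearMap.add_apply, cubic_apply, map_smul, LinearMap.smul_apply, smul_add]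

theorem cubicSymm_rotate (x y z : S) : C.cubicSymm x y z = C.cubicSymm y z x := by
  simp only [cubicSymm]; abel

theorem cubicSymm_swap (x y z : S) : C.cubicSymm x y z = C.cubicSymm y x z := by
  simp only [cubicSymm]; abel

/-- The spinors obtained from `s` by scaling and by the infinitesimal spin action. -/
def orbitSpan (s : S) : Submodule ℝ S :=
  Submodule.span ℝ ({s} ∪ Set.range fun pq : D × D => C.comm pq.1 pq.2 s)

theorem cubicSymm_mem_of_mem_orbitSpan {s x y z : S} (hx : x ∈ C.orbitSpan s)
    (h0 : C.cubicSymm s y z ∈ C.cliffordMaps)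
    (h1 : ∀ p q, C.cubicSymm (C.comm p q s) y z ∈ C.cliffordMaps) :
    C.cubicSymm x y z ∈ C.cliffordMaps := by
  induction hx using Submodule.span_induction with
  | mem x hx =>
    rcases hx with rfl | ⟨pq, rfl⟩
    · exact h0
    · exact h1 _ _
  | zero =>
    have h := C.cubicSymm_smul 0 0 y z
    rw [zero_smul, zero_smul] at h
    rw [h]; exact zero_mem _
  | add x x' _ _ h h' => rw [cubicSymm_add]; exact add_mem h h'
  | smul c x _ h => rw [cubicSymm_smul]; exact C.cliffordMaps.smul_mem c h

/-- The property that `u ↦ μ(u) ρ` is of the form `u ↦ u X`, where `μ` is the moment map of `ρ`,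
propagates from a spinor `s` to all spinors in an invariant subspace `E` in which the orbit of `s`
is infinitesimally open up to scale. Indeed the symmetrized cubic map is equivariant and takes
values in the invariant subspace `cliffordMaps` when all three arguments are `s`; by the Leibniz
rule the arguments can be replaced by tangent vectors to the orbit, one after the other. -/
theorem exists_act_eq_of_orbitSpan {E : Submodule ℝ S} (hE : ∀ p q, ∀ x ∈ E, C.comm p q x ∈ E)
    {s : S} (hs : E ≤ C.orbitSpan s)
    (h : ∃ X, ∀ u, C.act (C.rep s (C.act u s)) s = C.act u X) {ρ : S} (hρ : ρ ∈ E) :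
    ∃ X, ∀ u, C.act (C.rep ρ (C.act u ρ)) ρ = C.act u X := by
  have six : ∀ x, C.cubicSymm x x x = (6 : ℝ) • C.cubic x x x := fun x => by
    simp only [cubicSymm]; module
  have h0 : C.cubicSymm s s s ∈ C.cliffordMaps := by
    rw [six]
    exact C.cliffordMaps.smul_mem _ ((C.mem_cliffordMaps _).2 h)
  have h1 : ∀ x ∈ E, C.cubicSymm x s s ∈ C.cliffordMaps := fun x hx => by
    refine C.cubicSymm_mem_of_mem_orbitSpan (hs hx) h0 fun p q => ?_
    have hl := C.lie_mem p q h0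
    -- The Leibniz rule gives three times the same term.
    rw [lie_cubicSymm, C.cubicSymm_swap s (C.comm p q s), ← C.cubicSymm_rotate (C.comm p q s)] at hl
    have h3 : C.cubicSymm (C.comm p q s) s s = (3 : ℝ)⁻¹ • (C.cubicSymm (C.comm p q s) s s +
        C.cubicSymm (C.comm p q s) s s + C.cubicSymm (C.comm p q s) s s) := by module
    rw [h3]
    exact C.cliffordMaps.smul_mem _ hl
  have h2 : ∀ x ∈ E, ∀ y ∈ E, C.cubicSymm x y s ∈ C.cliffordMaps := fun x hx y hy => by
    rw [cubicSymm_swap]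
    refine C.cubicSymm_mem_of_mem_orbitSpan (hs hy) ?_ fun p q => ?_
    · rw [cubicSymm_swap]; exact h1 x hx
    have hl := C.lie_mem p q (h1 x hx)
    -- Of the three terms, one is known to lie in `cliffordMaps` and the other two are equal.
    rw [lie_cubicSymm, C.cubicSymm_rotate x s, C.cubicSymm_swap s (C.comm p q s) x,
      C.cubicSymm_swap x (C.comm p q s), ← C.cubicSymm_rotate x (C.comm p q s) s,
      C.cubicSymm_swap x (C.comm p q s)] at hl
    have h3 : C.cubicSymm (C.comm p q s) x s = (2 : ℝ)⁻¹ • (C.cubicSymm (C.comm p q x) s s +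
        C.cubicSymm (C.comm p q s) x s + C.cubicSymm (C.comm p q s) x s -
        C.cubicSymm (C.comm p q x) s s) := by module
    rw [h3]
    exact C.cliffordMaps.smul_mem _ (sub_mem hl (h1 _ (hE p q x hx)))
  have h3 : ∀ x ∈ E, ∀ y ∈ E, ∀ z ∈ E, C.cubicSymm x y z ∈ C.cliffordMaps :=
    fun x hx y hy z hz => by
    rw [cubicSymm_rotate, cubicSymm_rotate]
    refine C.cubicSymm_mem_of_mem_orbitSpan (hs hz) ?_ fun p q => ?_
    · rw [cubicSymm_rotate]; exact h2 x hx y hy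
    have hl := C.lie_mem p q (h2 x hx y hy)
    rw [lie_cubicSymm, C.cubicSymm_rotate x y (C.comm p q s),
      C.cubicSymm_rotate y (C.comm p q s) x] at hl
    have h3 : C.cubicSymm (C.comm p q s) x y = (C.cubicSymm (C.comm p q x) y s +
        C.cubicSymm x (C.comm p q y) s + C.cubicSymm (C.comm p q s) x y) -
        (C.cubicSymm (C.comm p q x) y s + C.cubicSymm x (C.comm p q y) s) := by abel
    rw [h3]
    exact sub_mem hl (add_mem (h2 _ (hE p q x hx) _ hy) (h2 _ hx _ (hE p q y hy)))
  have h6 := h3 ρ hρ ρ hρ ρ hρ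
  rw [six] at h6
  have h7 := C.cliffordMaps.smul_mem (6 : ℝ)⁻¹ h6
  rw [smul_smul, inv_mul_cancel₀ (by norm_num), one_smul] at h7
  exact (C.mem_cliffordMaps _).1 h7

/-- Clifford multiplication by a vector `e` with `e² = 1` preserves the property that `u ↦ μ(u) ρ`
is of the form `u ↦ u X`: up to sign it intertwines the actions of `u` and of its reflection `R u`
in the hyperplane orthogonal to `e`. -/
theorem exists_act_eq_of_act {e : D} (he : C.form e e = 2) {ρ : S}
    (h : ∃ X, ∀ u, C.act (C.rep ρ (C.act u ρ)) ρ = C.act u X) :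
    ∃ X, ∀ u, C.act (C.rep (C.act e ρ) (C.act u (C.act e ρ))) (C.act e ρ) = C.act u X := by
  obtain ⟨X, hX⟩ := h
  let R : D →ₗ[ℝ] D := LinearMap.id - (C.form e).smulRight e
  have hR : ∀ u, R u = u - C.form e u • e := fun u => rfl
  have ee : ∀ s, C.act e (C.act e s) = s := fun s => by
    have := C.act_act_add e e s
    rw [he] at this
    rw [← two_smul ℝ] at this
    exact smul_right_injective S (two_ne_zero (α := ℝ)) this
  have hue : ∀ u s, C.act u (C.act e s) = -C.act e (C.act (R u) s) := fun u s => by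
    rw [hR, map_sub, map_smul, LinearMap.sub_apply, LinearMap.smul_apply, map_sub, map_smul, ee,
      C.act_act u e, C.form_swap u e]
    abel
  have hRR : ∀ u w, C.form u (R w) = C.form (R u) w := fun u w => by
    simp only [hR, map_sub, map_smul, LinearMap.sub_apply, LinearMap.smul_apply, smul_eq_mul]
    rw [C.form_swap u e]; ring
  have hrep : ∀ u, C.rep (C.act e ρ) (C.act u (C.act e ρ)) = R (C.rep ρ (C.act (R u) ρ)) :=
    fun u => C.eq_of_form fun w => by
    rw [form_rep, ← hRR, form_rep, hue, hue, map_neg, map_neg, LinearMap.neg_apply, neg_neg,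
      C.pair_act, ee]
  have hRR' : ∀ u, R (R u) = u := fun u => by
    simp only [hR, map_sub, map_smul, smul_eq_mul, he]; module
  refine ⟨C.act e X, fun u => ?_⟩
  rw [hrep, hue, hRR', hX, hue]

/-- The moment map `u ↦ rep ρ (u ρ)`, equal to `4 μ(ρ)`. -/
def moment (ρ : S) : D →ₗ[ℝ] D := C.rep ρ ∘ₗ C.act.flip ρ

theorem moment_apply (ρ : S) (u : D) : C.moment ρ u = C.rep ρ (C.act u ρ) := rfl

theorem form_moment (ρ : S) (u w : D) :
    C.form (C.moment ρ u) w = C.pair (C.act w ρ) (C.act u ρ) := by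
  rw [moment_apply, form_rep]

theorem form_moment_swap (ρ : S) (u w : D) :
    C.form (C.moment ρ u) w = -C.form (C.moment ρ w) u := by
  rw [form_moment, form_moment, C.pair_swap]

/-- If `u ↦ μ(u) ρ` is of the form `u ↦ u X`, then the square of the moment map is a scalar. -/
theorem moment_moment {ρ X : S} (hX : ∀ u, C.act (C.moment ρ u) ρ = C.act u X) (u : D) :
    C.moment ρ (C.moment ρ u) = (C.pair ρ X / 2) • u := by
  refine C.eq_of_form fun w => ?_
  have h1 : ∀ u w, C.form (C.moment ρ (C.moment ρ u)) w = C.pair ρ (C.act w (C.act u X)) :=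
    fun u w => by rw [form_moment, hX, C.pair_act]
  have h2 : C.form (C.moment ρ (C.moment ρ u)) w = C.form (C.moment ρ (C.moment ρ w)) u := by
    rw [form_moment_swap, C.form_swap, form_moment_swap, C.form_swap, neg_neg, C.form_swap]
  have h3 := congrArg (C.pair ρ) (C.act_act_add u w X)
  rw [map_add, ← h1, ← h1, ← h2, map_smul, smul_eq_mul] at h3
  rw [map_smul, LinearMap.smul_apply, smul_eq_mul]
  linarith

theorem act_moment {ρ X : S} (hX : ∀ u, C.act (C.moment ρ u) ρ = C.act u X) (u : D) :
    C.act (C.moment ρ u) X = (C.pair ρ X / 2) • C.act u ρ := by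
  rw [← hX, C.moment_moment hX, map_smul, LinearMap.smul_apply]

/-- If the square of the moment map is a negative scalar `-k²`, then `μ / k` is a complex structure,
and `ρ + i k⁻¹ X` is annihilated by its eigenspace. -/
theorem isConj_of_neg {ρ X : S} (hX : ∀ u, C.act (C.moment ρ u) ρ = C.act u X)
    (h : C.pair ρ X < 0) : C.IsConj ρ ((√(-(C.pair ρ X / 2)))⁻¹ • X) := by
  have h0 : 0 < -(C.pair ρ X / 2) := by linarith
  have hk : 0 < √(-(C.pair ρ X / 2)) := Real.sqrt_pos.2 h0
  have hk2 : √(-(C.pair ρ X / 2)) ^ 2 = -(C.pair ρ X / 2) := Real.sq_sqrt h0.le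
  set k := √(-(C.pair ρ X / 2))
  refine ⟨fun u => ⟨-(k⁻¹ • C.moment ρ u), ?_, ?_⟩, ?_⟩
  · simp only [map_neg, map_smul, LinearMap.neg_apply, LinearMap.smul_apply]
    rw [C.act_moment hX]
    have : k⁻¹ * k⁻¹ * -(C.pair ρ X / 2) = 1 := by
      field_simp
      linarith
    have h4 : k⁻¹ • -(k⁻¹ • (C.pair ρ X / 2) • C.act u ρ) =
        (k⁻¹ * k⁻¹ * -(C.pair ρ X / 2)) • C.act u ρ := by module
    rw [h4, this, one_smul]
  · simp only [map_neg, map_smul, LinearMap.neg_apply, LinearMap.smul_apply, hX, neg_neg]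
  · rw [map_smul, smul_eq_mul]
    exact mul_neg_of_pos_of_neg (inv_pos.2 hk) h

/-- For a pure spinor `φ = ρ + i ψ` all `⟨wφ, uφ⟩` vanish; this is the real part. As `4 < dim D`,
there is an annihilator `x + i I x` of `φ` orthogonal to `u` and `w`, which can be moved across the
pairing. -/
theorem form_moment_eq_of_isConj (hD : 4 < Module.finrank ℝ D) {ρ ψ : S} (h : C.IsConj ρ ψ)
    {I : D →ₗ[ℝ] D} (hI : ∀ u, C.act u ρ = C.act (I u) ψ ∧ C.act u ψ = -C.act (I u) ρ) (u w : D) :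
    C.pair (C.act w ρ) (C.act u ρ) = C.pair (C.act w ψ) (C.act u ψ) := by
  have hII : ∀ x, I (I x) = -x := fun x => by
    rw [← sub_eq_zero, sub_neg_eq_add]
    refine C.eq_zero_of_act_eq_zero h.2.ne ?_ ?_
    · rw [map_add, LinearMap.add_apply, (hI x).1]
      have := (hI (I x)).2
      rw [this]; simp
    · rw [map_add, LinearMap.add_apply, ← (hI (I x)).1, (hI x).2]; simp
  -- A nonzero `x` for which `x` and `I x` are orthogonal to `u` and `w`.
  obtain ⟨x, ⟨hux, hwx, huy, hwy⟩, hx0⟩ : ∃ x, (C.form u x = 0 ∧ C.form w x = 0 ∧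
      C.form u (I x) = 0 ∧ C.form w (I x) = 0) ∧ x ≠ 0 := by
    obtain ⟨x, hx, hx0⟩ := (Submodule.ne_bot_iff _).1 (LinearMap.ker_ne_bot_of_finrank_lt
      (f := (C.form u).prod ((C.form w).prod ((C.form u ∘ₗ I).prod (C.form w ∘ₗ I))))
      (by simpa [Module.finrank_prod] using hD))
    refine ⟨x, ?_, hx0⟩
    simpa using hx
  obtain ⟨z, hyz, hxz⟩ : ∃ z, C.form (I x) z = 0 ∧ C.form x z ≠ 0 := by
    by_contra! hcon
    have hle : LinearMap.ker (C.form (I x)) ≤ LinearMap.ker (C.form x) := fun z hz => hcon z hz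
    obtain ⟨c, hc⟩ := Submodule.mem_span_singleton.1 (by
      simpa using mem_span_of_iInf_ker_le_ker (L := fun _ : Unit => C.form (I x)) (K := C.form x)
        (by simpa using hle))
    have hxc : x = c • I x := C.eq_of_form fun z => by rw [← hc]; simp
    have h2 : I x = -(c • x) := by
      conv_lhs => rw [hxc]
      rw [map_smul, hII, smul_neg]
    have h3 : (1 + c ^ 2) • x = 0 := by
      have : x = -((c ^ 2) • x) := by
        conv_lhs => rw [hxc, h2]
        module
      rw [add_smul, one_smul]; nth_rewrite 1 [this]; module
    exact hx0 ((smul_eq_zero.1 h3).resolve_left (by positivity))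
  set y := I x
  have hxρ : C.act x ρ = C.act y ψ := (hI x).1
  have hxψ : C.act x ψ = -C.act y ρ := (hI x).2
  -- Move `x` and `y` past `u` and `w`.
  have anti : ∀ {a b : D}, C.form a b = 0 → ∀ s, C.act a (C.act b s) = -C.act b (C.act a s) :=
    fun hab s => by rw [C.act_act, hab]; simp
  have key : ∀ s t, C.form x z * C.pair (C.act w s) (C.act u t) =
      C.pair (C.act u (C.act w (C.act z s))) (C.act x t) +
        C.pair (C.act u (C.act w (C.act z (C.act x s)))) t := by
    intro s t
    have := C.act_act_add x z s
    have h2 : C.pair (C.act u (C.act w (C.form x z • s))) t =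
        C.form x z * C.pair (C.act w s) (C.act u t) := by
      simp only [map_smul, LinearMap.smul_apply, smul_eq_mul, C.pair_act]
    rw [← h2, ← this, map_add, map_add, map_add, LinearMap.add_apply, ← C.pair_act x]
    congr 1
    rw [anti (show C.form x u = 0 by rw [C.form_swap, hux]),
      anti (show C.form x w = 0 by rw [C.form_swap, hwx])]
    simp
  have comm : ∀ s, C.act u (C.act w (C.act z (C.act y s))) =
      -C.act y (C.act u (C.act w (C.act z s))) := fun s => by
    rw [anti (show C.form z y = 0 by rw [C.form_swap, hyz]), map_neg, map_neg, anti hwy, map_neg,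
      neg_neg, anti huy]
  have e1 := key ρ ρ
  have e2 := key ψ ψ
  rw [hxρ, comm, map_neg, LinearMap.neg_apply, C.pair_act y] at e1
  rw [hxψ, map_neg, map_neg, map_neg, map_neg, comm, neg_neg, C.pair_act y] at e2
  have e3 : C.form x z * (C.pair (C.act w ρ) (C.act u ρ) - C.pair (C.act w ψ) (C.act u ψ)) = 0 := by
    rw [mul_sub, e1, e2]
    ring
  exact sub_eq_zero.1 ((mul_eq_zero.1 e3).resolve_left hxz)

/-- The spinor `ψ` is determined by `ρ`: it is a multiple of the spinor `X` with `μ(u) ρ = u X`. -/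
theorem IsConj.eq_smul (hD : 4 < Module.finrank ℝ D) {e : D} (he : C.form e e = 2) {ρ ψ X : S}
    (h : C.IsConj ρ ψ) (hX : ∀ u, C.act (C.moment ρ u) ρ = C.act u X) :
    X = (-C.pair ρ ψ / 2) • ψ := by
  have h0 := h.2.ne
  -- The complex structure is a multiple of the sum of the moment maps.
  have hJ : ∀ x y, C.act x ρ = C.act y ψ → C.act x ψ = -C.act y ρ →
      C.moment ρ x + C.moment ψ x = C.pair ρ ψ • y := fun x y h1 h2 => by
    refine C.eq_of_form fun w => ?_
    rw [map_add, LinearMap.add_apply, form_moment, form_moment, map_smul, LinearMap.smul_apply,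
      smul_eq_mul, h1, h2, map_neg, C.pair_act w ρ, C.act_act w y ψ, map_sub,
      map_smul, smul_eq_mul, C.form_swap w y, ← C.pair_act y, C.pair_swap (C.act w ψ)]
    ring
  let I : D →ₗ[ℝ] D := (C.pair ρ ψ)⁻¹ • (C.moment ρ + C.moment ψ)
  have hI : ∀ u, C.act u ρ = C.act (I u) ψ ∧ C.act u ψ = -C.act (I u) ρ := fun u => by
    obtain ⟨y, h1, h2⟩ := h.1 u
    have : I u = y := by
      simp only [I, LinearMap.smul_apply, LinearMap.add_apply, hJ u y h1 h2, smul_smul,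
        inv_mul_cancel₀ h0, one_smul]
    rw [this]; exact ⟨h1, h2⟩
  have hM : ∀ u, C.moment ρ u = (C.pair ρ ψ / 2) • I u := fun u => by
    have h1 : C.moment ψ u = C.moment ρ u := C.eq_of_form fun w => by
      rw [form_moment, form_moment, C.form_moment_eq_of_isConj hD h hI]
    have h2 := hJ u _ (hI u).1 (hI u).2
    rw [h1, ← two_smul ℝ] at h2
    have h3 := congrArg (fun x => (2 : ℝ)⁻¹ • x) h2
    simp only [smul_smul] at h3
    rw [inv_mul_cancel₀ two_ne_zero, one_smul] at h3
    rw [h3]; congr 1; ring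
  refine C.eq_of_act_eq he fun u => ?_
  rw [← hX, hM, map_smul, map_smul, LinearMap.smul_apply, (hI u).2]
  module

theorem IsConj.pair_eq (hD : 4 < Module.finrank ℝ D) {e : D} (he : C.form e e = 2) {ρ ψ X : S}
    (h : C.IsConj ρ ψ) (hX : ∀ u, C.act (C.moment ρ u) ρ = C.act u X) :
    C.pair ρ X / 2 = -(C.pair ρ ψ / 2) ^ 2 := by
  rw [IsConj.eq_smul C hD he h hX, map_smul, smul_eq_mul]; ring

/-- The derivative of `(μ(u), μ(w))`, where `μ` is the moment map of `ρ + t β`. Although `μ²` need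
not be a scalar for `t ≠ 0`, the first-order term only involves the identity for `ρ`. -/
theorem hasDerivAt_form_moment {ρ X : S} (hX : ∀ u, C.act (C.moment ρ u) ρ = C.act u X) (β : S)
    (u w : D) :
    HasDerivAt (fun t : ℝ => C.form (C.moment (ρ + t • β) u) (C.moment (ρ + t • β) w))
      (-(2 * C.form u w * C.pair β X)) 0 := by
  -- The moment map is quadratic in the spinor.
  let M' : D → D := fun u => C.rep β (C.act u ρ) + C.rep ρ (C.act u β)
  let M'' : D → D := fun u => C.rep β (C.act u β)
  have hM : ∀ (t : ℝ) (u : D),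
      C.moment (ρ + t • β) u = C.moment ρ u + t • M' u + t ^ 2 • M'' u := fun t u => by
    simp only [moment_apply, map_add, map_smul, LinearMap.add_apply, LinearMap.smul_apply, M', M'']
    module
  have hc : ∀ u w, C.form (M' u) (C.moment ρ w) =
      C.form (C.moment ρ w) u * C.pair β ρ - 2 * C.pair β (C.act u (C.act w X)) := fun u w => by
    simp only [M']
    rw [map_add, LinearMap.add_apply, form_rep, form_rep, hX, C.pair_act _ β, C.act_act _ u,
      map_sub, map_smul, smul_eq_mul, hX, C.pair_swap (C.act w X), C.pair_act u β]
    ring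
  have h : HasDerivAt (fun t : ℝ => (C.form (C.moment ρ u) (C.moment ρ w)) +
      t * (C.form (M' u) (C.moment ρ w) + C.form (M' w) (C.moment ρ u)) +
      t ^ 2 * (C.form (M' u) (M' w) + C.form (M'' u) (C.moment ρ w) +
        C.form (C.moment ρ u) (M'' w)) +
      t ^ 3 * (C.form (M' u) (M'' w) + C.form (M'' u) (M' w)) +
      t ^ 4 * C.form (M'' u) (M'' w))
      (C.form (M' u) (C.moment ρ w) + C.form (M' w) (C.moment ρ u)) 0 := by
    have := (((((hasDerivAt_const (0 : ℝ) (C.form (C.moment ρ u) (C.moment ρ w))).add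
      ((hasDerivAt_id (0 : ℝ)).mul_const (C.form (M' u) (C.moment ρ w) +
        C.form (M' w) (C.moment ρ u)))).add
      ((hasDerivAt_pow 2 (0 : ℝ)).mul_const (C.form (M' u) (M' w) +
        C.form (M'' u) (C.moment ρ w) + C.form (C.moment ρ u) (M'' w)))).add
      ((hasDerivAt_pow 3 (0 : ℝ)).mul_const (C.form (M' u) (M'' w) + C.form (M'' u) (M' w)))).add
      ((hasDerivAt_pow 4 (0 : ℝ)).mul_const (C.form (M'' u) (M'' w))))
    refine this.congr_deriv ?_
    simp
  refine (h.congr_deriv ?_).congr_of_eventuallyEq (Filter.Eventually.of_forall fun t => ?_)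
  · rw [hc, hc, C.form_moment_swap ρ w u]
    have := congrArg (C.pair β) (C.act_act_add u w X)
    rw [map_add, map_smul, smul_eq_mul] at this
    linarith
  · simp only [hM, map_add, map_smul, LinearMap.add_apply, LinearMap.smul_apply, smul_eq_mul]
    rw [C.form_swap (M' w)]
    ring

end SpinorModule

/-! ### Mixed forms in dimension six as spinors -/

section
variable {V : Type*} [AddCommGroup V] [Module ℝ V]

theorem HasParity.add {p : ZMod 2} {φ ψ : Mixed V ℝ} (hφ : HasParity p φ) (hψ : HasParity p ψ) :
    HasParity p (φ + ψ) := fun k hk => by simp [hφ k hk, hψ k hk]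

theorem HasParity.smul {p : ZMod 2} (c : ℝ) {φ : Mixed V ℝ} (hφ : HasParity p φ) :
    HasParity p (c • φ) := fun k hk => by simp [hφ k hk]

/-- The forms of a given parity. -/
def paritySubmodule (V : Type*) [AddCommGroup V] [Module ℝ V] (p : ZMod 2) :
    Submodule ℝ (Mixed V ℝ) where
  carrier := {φ | HasParity p φ}
  add_mem' := HasParity.add
  zero_mem' := fun _ _ => rfl
  smul_mem' := fun c _ h => h.smul c

theorem mem_paritySubmodule {p : ZMod 2} {φ : Mixed V ℝ} :
    φ ∈ paritySubmodule V p ↔ HasParity p φ := Iff.rfl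

theorem HasParity.clifford {p : ZMod 2} {φ : Mixed V ℝ} (h : HasParity p φ)
    (u : V × Module.Dual ℝ V) : HasParity (p + 1) (clifford φ u) := by
  intro k hk
  rw [clifford_apply]
  have h1 : interior φ u.1 k = 0 := by
    ext w
    rw [interior_apply, h (k + 1)]
    · simp
    · intro hp
      apply hk
      rw [← hp, Nat.cast_add, Nat.cast_one, add_assoc, CharTwo.add_self_eq_zero (1 : ZMod 2),
        add_zero]
  have h2 : exterior φ u.2 k = 0 := by
    rcases k with _ | k
    · rfl
    · rw [exterior_succ, h k]
      · ext; simp [oneWedge_apply]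
      · intro hp; apply hk; rw [← hp]; push_cast; rfl
  simp [h1, h2]

theorem pairing_ofDegree_six_right (φ : Mixed V ℝ) (τ : V [⋀^Fin 6]→ₗ[ℝ] ℝ) :
    pairing φ (ofDegree 6 τ) = φ 0 ![] • τ := by
  have h : ∀ (k : ℕ) (hk : 6 - k ≠ 6) (h : k + (6 - k) = 6),
      wedge h (φ k) (ofDegree 6 τ (6 - k)) = 0 := by
    intro k hk h
    rw [ofDegree_of_ne hk, wedge_zero]
  simp only [pairing, Fin.sum_univ_seven]
  have e1 := h 1 (by omega) (by omega)
  have e2 := h 2 (by omega) (by omega)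
  have e3 := h 3 (by omega) (by omega)
  have e4 := h 4 (by omega) (by omega)
  have e5 := h 5 (by omega) (by omega)
  have e6 := h 6 (by omega) (by omega)
  have e0 := wedge_zero_left (by omega : 0 + 6 = 6) (φ 0) τ
  simp [e0, e1, e2, e3, e4, e5, e6, ofDegree_self]

/-- The coefficient with respect to a volume form, as a linear map. -/
def coeffₗ (ν : V [⋀^Fin 6]→ₗ[ℝ] ℝ) : (V [⋀^Fin 6]→ₗ[ℝ] ℝ) →ₗ[ℝ] ℝ where
  toFun := coeff ν
  map_add' σ τ := by simp [coeff, mul_add]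
  map_smul' c τ := by simp [coeff]; ring

theorem coeffₗ_apply (ν τ : V [⋀^Fin 6]→ₗ[ℝ] ℝ) : coeffₗ ν τ = coeff ν τ := rfl

theorem apply_epsilon_ne_zero {ν : V [⋀^Fin 6]→ₗ[ℝ] ℝ} (hν : ν ≠ 0) :
    ν (Classical.epsilon fun v => ν v ≠ 0) ≠ 0 := by
  refine Classical.epsilon_spec (p := fun v => ν v ≠ 0) ?_
  by_contra! h
  exact hν (AlternatingMap.ext h)

theorem coeff_self {ν : V [⋀^Fin 6]→ₗ[ℝ] ℝ} (hν : ν ≠ 0) : coeff ν ν = 1 :=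
  inv_mul_cancel₀ (apply_epsilon_ne_zero hν)

variable [FiniteDimensional ℝ V]

/-- Top-degree forms are multiples of a given volume form. -/
theorem coeff_smul (h6 : Module.finrank ℝ V = 6) {ν : V [⋀^Fin 6]→ₗ[ℝ] ℝ} (hν : ν ≠ 0)
    (τ : V [⋀^Fin 6]→ₗ[ℝ] ℝ) : coeff ν τ • ν = τ := by
  let e : Module.Basis (Fin 6) ℝ V := Module.finBasisOfFinrankEq ℝ V h6
  have h1 := AlternatingMap.eq_smul_basis_det e ν
  have h2 := AlternatingMap.eq_smul_basis_det e τ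
  have hne : ν e ≠ 0 := fun h => hν (by rw [h1, h, zero_smul])
  have h3 : τ = (τ e / ν e) • ν := by
    have h4 : (τ e / ν e) • ν = (τ e / ν e) • ν e • e.det := congrArg _ h1
    rw [h4, smul_smul, div_mul_cancel₀ _ hne]; exact h2
  rw [h3, ← coeffₗ_apply, map_smul, coeffₗ_apply, coeff_self hν, smul_eq_mul, mul_one]

/-- Mixed forms on a six-dimensional space `V` as spinors for `V ⊕ V*`. -/
def spinors (h6 : Module.finrank ℝ V = 6) (ν : V [⋀^Fin 6]→ₗ[ℝ] ℝ) :
    SpinorModule (V × Module.Dual ℝ V) (Mixed V ℝ) where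
  form := polar
  act := clifford.flip
  pair := pairingₗ.compr₂ (coeffₗ ν)
  form_swap u w := by simp [polar, add_comm]
  form_nondegenerate u h := by
    have h1 : ∀ w : V × Module.Dual ℝ V, u.2 w.1 + w.2 u.1 = 0 := h
    refine Prod.ext ((Module.forall_dual_apply_eq_zero_iff ℝ u.1).1 fun f => ?_) ?_
    · simpa using h1 (0, f)
    · ext v; simpa using h1 (v, 0)
  act_act_add u w s := clifford_clifford s u w
  pair_act u s t := by
    have h := congrArg (coeffₗ ν) (pairing_clifford h6 s t u)
    simpa only [LinearMap.compr₂_apply, LinearMap.flip_apply, pairingₗ_apply] using h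
  pair_swap s t := by
    change coeffₗ ν (pairing s t) = -coeffₗ ν (pairing t s)
    rw [pairing_swap h6, map_neg]

variable (h6 : Module.finrank ℝ V = 6) (ν : V [⋀^Fin 6]→ₗ[ℝ] ℝ)

theorem spinors_act (u : V × Module.Dual ℝ V) (φ : Mixed V ℝ) :
    (spinors h6 ν).act u φ = clifford φ u := rfl

theorem spinors_pair (φ ψ : Mixed V ℝ) : (spinors h6 ν).pair φ ψ = coeff ν (pairing φ ψ) := rfl

theorem spinors_form (u w : V × Module.Dual ℝ V) : (spinors h6 ν).form u w = u.2 w.1 + w.2 u.1 :=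
  rfl

theorem finrank_vectors (h6 : Module.finrank ℝ V = 6) :
    Module.finrank ℝ (V × Module.Dual ℝ V) = 12 := by
  rw [Module.finrank_prod, Subspace.dual_finrank_eq, h6]

theorem exists_dual_apply_eq_one (h6 : Module.finrank ℝ V = 6) :
    ∃ e : V × Module.Dual ℝ V, e.2 e.1 = 1 := by
  have : Nontrivial V := Module.nontrivial_of_finrank_pos (R := ℝ) (by omega)
  obtain ⟨v, hv⟩ := exists_ne (0 : V)
  obtain ⟨g, hg⟩ : ∃ g : Module.Dual ℝ V, g v ≠ 0 := by
    by_contra! h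
    exact hv ((Module.forall_dual_apply_eq_zero_iff ℝ v).1 h)
  exact ⟨(v, (g v)⁻¹ • g), by simp [inv_mul_cancel₀ hg]⟩

/-- A vector `e` with `e² = 1`. -/
theorem exists_form_eq_two : ∃ e, (spinors h6 ν).form e e = 2 := by
  obtain ⟨e, he⟩ := exists_dual_apply_eq_one h6
  exact ⟨e, by rw [spinors_form, he]; norm_num⟩

/-- The constant form `1`. -/
def one : Mixed V ℝ := ofDegree 0 (AlternatingMap.constOfIsEmpty ℝ V (Fin 0) 1)

omit [FiniteDimensional ℝ V] in
theorem ofDegree_zero_eq (α : V [⋀^Fin 0]→ₗ[ℝ] ℝ) : ofDegree 0 α = α ![] • (one : Mixed V ℝ) := by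
  funext k
  by_cases h : k = 0
  · subst h
    ext w
    have : w = ![] := Subsingleton.elim _ _
    simp [one, ofDegree_self, this]
  · simp [one, ofDegree_of_ne h]

omit [FiniteDimensional ℝ V] in
theorem interior_one (v : V) : interior (one : Mixed V ℝ) v = 0 := interior_ofDegree_zero _ v

theorem exterior_ofDegree_six (h6 : Module.finrank ℝ V = 6) (τ : V [⋀^Fin 6]→ₗ[ℝ] ℝ)
    (ξ : Module.Dual ℝ V) : exterior (ofDegree 6 τ) ξ = 0 := by
  rw [exterior_ofDegree, alternating_eq_zero_of_finrank_lt (by omega) (oneWedge ξ τ)]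
  simp [ofDegree]

/-- The sum of the two opposite pure spinors `1` and `ν`. -/
def base : Mixed V ℝ := one + ofDegree 6 ν

theorem clifford_base (h6 : Module.finrank ℝ V = 6) (ν : V [⋀^Fin 6]→ₗ[ℝ] ℝ) (v : V)
    (ξ : Module.Dual ℝ V) :
    clifford (base ν) (v, ξ) = interior (ofDegree 6 ν) v + exterior one ξ := by
  rw [clifford_apply, base, map_add, map_add, LinearMap.add_apply, LinearMap.add_apply,
    interior_one, exterior_ofDegree_six h6]
  simp

omit [FiniteDimensional ℝ V] in
theorem pairing_one_left (ψ : Mixed V ℝ) : pairing one ψ = ψ 6 := by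
  rw [one, pairing_ofDegree_zero_left]; simp

/-- The moment map of `1 + ν` is `1` on `V` and `-1` on `V*`. -/
theorem moment_base (hν : ν ≠ 0) (u : V × Module.Dual ℝ V) :
    (spinors h6 ν).moment (base ν) u = (u.1, -u.2) := by
  obtain ⟨v, ξ⟩ := u
  refine (spinors h6 ν).eq_of_form fun w => ?_
  obtain ⟨v', ξ'⟩ := w
  rw [SpinorModule.form_moment, spinors_act, spinors_act, clifford_base h6, clifford_base h6,
    spinors_pair, spinors_form, pairing_add_left, pairing_add_right, pairing_add_right]
  have h1 : ∀ ξ v, pairing (exterior one ξ) (interior (ofDegree 6 ν) v) = ξ v • ν := fun ξ v => by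
    have := interior_exterior (ofDegree 6 ν) v ξ
    rw [exterior_ofDegree_six h6, map_zero, LinearMap.zero_apply, zero_add] at this
    rw [pairing_exterior, pairing_one_left, this]
    simp [ofDegree_self]
  have h2 : pairing (interior (ofDegree 6 ν) v') (interior (ofDegree 6 ν) v) = 0 := by
    rw [← pairing_interior h6, pairing_ofDegree_six_right, interior_apply, interior_apply,
      ofDegree_of_ne (by omega)]
    simp
  have h3 : pairing (exterior one ξ' : Mixed V ℝ) (exterior one ξ) = 0 := by
    rw [pairing_exterior, pairing_one_left, one, exterior_ofDegree, exterior_ofDegree,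
      ofDegree_of_ne (by omega)]
  rw [h2, h3, h1, pairing_swap h6, h1, ← coeffₗ_apply]
  simp only [map_add, map_neg, map_zero, map_smul, coeffₗ_apply, coeff_self hν]
  simp

/-- For `ρ = 1 + ν` the property of `exists_act_eq_of_orbitSpan` holds with `X = ν - 1`. -/
theorem cubic_base (hν : ν ≠ 0) : ∃ X, ∀ u, (spinors h6 ν).act ((spinors h6 ν).rep (base ν)
    ((spinors h6 ν).act u (base ν))) (base ν) = (spinors h6 ν).act u X := by
  refine ⟨ofDegree 6 ν - one, fun u => ?_⟩
  rw [← SpinorModule.moment_apply, moment_base h6 ν hν, spinors_act, spinors_act, clifford_base h6,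
    clifford_apply, map_sub, map_sub, LinearMap.sub_apply, LinearMap.sub_apply, interior_one,
    exterior_ofDegree_six h6, map_neg]
  abel

theorem one_mem_orbitSpan : (one : Mixed V ℝ) ∈ (spinors h6 ν).orbitSpan (base ν) ∧
    ofDegree 6 ν ∈ (spinors h6 ν).orbitSpan (base ν) := by
  obtain ⟨⟨v, g⟩, hg : g v = 1⟩ := exists_dual_apply_eq_one h6
  set P := (spinors h6 ν).orbitSpan (base ν)
  have h1 : base ν ∈ P := Submodule.subset_span (Or.inl rfl)
  have h2 : (spinors h6 ν).comm (v, 0) (0, g) (base ν) ∈ P :=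
    Submodule.subset_span (Or.inr ⟨((v, 0), (0, g)), rfl⟩)
  have e1 : interior (exterior (one : Mixed V ℝ) g) v = g v • one := by
    have := interior_exterior (one : Mixed V ℝ) v g
    rwa [interior_one, map_zero, LinearMap.zero_apply, add_zero] at this
  have e2 : exterior (interior (ofDegree 6 ν) v) g = g v • ofDegree 6 ν := by
    have := interior_exterior (ofDegree 6 ν) v g
    rwa [exterior_ofDegree_six h6, map_zero, LinearMap.zero_apply, zero_add] at this
  have h3 : (spinors h6 ν).comm (v, 0) (0, g) (base ν) = g v • (one - ofDegree 6 ν) := by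
    rw [SpinorModule.comm_apply, spinors_act, spinors_act, spinors_act, spinors_act,
      clifford_base h6, clifford_base h6]
    simp [clifford_apply, e1, e2, smul_sub]
  rw [h3, hg, one_smul] at h2
  have h5 : (one : Mixed V ℝ) = (2 : ℝ)⁻¹ • (base ν + (one - ofDegree 6 ν)) := by
    rw [base]; module
  have h6 : ofDegree 6 ν = (2 : ℝ)⁻¹ • (base ν - (one - ofDegree 6 ν)) := by
    rw [base]; module
  exact ⟨h5 ▸ P.smul_mem _ (add_mem h1 h2), h6 ▸ P.smul_mem _ (sub_mem h1 h2)⟩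

omit [FiniteDimensional ℝ V] in
theorem ofDegree_smul {k : ℕ} (c : ℝ) (α : V [⋀^Fin k]→ₗ[ℝ] ℝ) :
    ofDegree k (c • α) = c • ofDegree k α := Pi.single_smul _ _ _

omit [FiniteDimensional ℝ V] in
theorem sum_exterior_interior {ι : Type*} [Fintype ι] [DecidableEq ι] (e : Module.Basis ι ℝ V)
    (k : ℕ) (α : V [⋀^Fin k]→ₗ[ℝ] ℝ) :
    ∑ i, exterior (interior (ofDegree k α) (e i)) (e.coord i) = (k : ℝ) • ofDegree k α := by
  rcases k with _ | k
  · simp [interior_ofDegree_zero]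
  · simp only [interior_ofDegree_succ, exterior_ofDegree]
    rw [← ofDegree_smul]
    push_cast
    rw [← sum_oneWedge_curryLeft e α]
    exact (map_sum (AddMonoidHom.single (fun k => V [⋀^Fin k]→ₗ[ℝ] ℝ) (k + 1)) _ _).symm

omit [FiniteDimensional ℝ V] in
theorem sum_interior_exterior (e : Module.Basis (Fin 6) ℝ V)
    (k : ℕ) (α : V [⋀^Fin k]→ₗ[ℝ] ℝ) :
    ∑ i, interior (exterior (ofDegree k α) (e.coord i)) (e i) = (6 - k : ℝ) • ofDegree k α := by
  have h : ∀ i, interior (exterior (ofDegree k α) (e.coord i)) (e i) =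
      ofDegree k α - exterior (interior (ofDegree k α) (e i)) (e.coord i) := fun i => by
    have := interior_exterior (ofDegree k α) (e i) (e.coord i)
    rw [eq_sub_iff_add_eq, this]; simp
  rw [Finset.sum_congr rfl fun i _ => h i, Finset.sum_sub_distrib, sum_exterior_interior]
  simp only [Finset.sum_const, Finset.card_univ, Fintype.card_fin]
  module

/-- Up to scale, the orbit of `1 + ν` is infinitesimally open in the even forms. -/
theorem even_le_orbitSpan (hν : ν ≠ 0) :
    paritySubmodule V 0 ≤ (spinors h6 ν).orbitSpan (base ν) := by
  obtain ⟨h1, hν'⟩ := one_mem_orbitSpan h6 ν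
  set P := (spinors h6 ν).orbitSpan (base ν)
  have hcomm : ∀ p q, (spinors h6 ν).comm p q (base ν) ∈ P := fun p q =>
    Submodule.subset_span (Or.inr ⟨(p, q), rfl⟩)
  let e : Module.Basis (Fin 6) ℝ V := Module.finBasisOfFinrankEq ℝ V h6
  have hsix : ∀ τ : V [⋀^Fin 6]→ₗ[ℝ] ℝ, ofDegree 6 τ = coeff ν τ • ofDegree 6 ν := fun τ => by
    rw [← ofDegree_smul, coeff_smul h6 hν]
  have cancel : ∀ {c : ℝ} {φ : Mixed V ℝ}, c ≠ 0 → c • φ ∈ P → φ ∈ P := fun hc h =>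
    (P.smul_mem_iff hc).1 h
  -- Elements of `Λ²V*` act on `1 + ν` by multiplying `1`, and elements of `Λ²V` by contracting `ν`.
  have two : ∀ ξ η, exterior (exterior (one : Mixed V ℝ) η) ξ ∈ P := fun ξ η => by
    have := hcomm (0, ξ) (0, η)
    have h2 := exterior_exterior (one : Mixed V ℝ) ξ η
    rw [SpinorModule.comm_apply, spinors_act, spinors_act, spinors_act, spinors_act,
      clifford_base h6, clifford_base h6] at this
    simp only [clifford_apply, map_zero, zero_add] at this
    rw [← eq_neg_iff_add_eq_zero] at h2
    rw [h2, sub_neg_eq_add, ← two_smul ℝ] at this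
    exact cancel two_ne_zero this
  have four : ∀ v w, interior (interior (ofDegree 6 ν) v) w ∈ P := fun v w => by
    have := hcomm (w, 0) (v, 0)
    have h2 := interior_interior (ofDegree 6 ν) w v
    rw [SpinorModule.comm_apply, spinors_act, spinors_act, spinors_act, spinors_act,
      clifford_base h6, clifford_base h6] at this
    simp only [clifford_apply, map_zero, add_zero] at this
    rw [← eq_neg_iff_add_eq_zero] at h2
    rw [h2, sub_neg_eq_add, ← two_smul ℝ] at this
    exact cancel two_ne_zero this
  -- By the Euler formula and its dual this yields all forms of degree `2` and `4`.
  have deg2 : ∀ α : V [⋀^Fin 2]→ₗ[ℝ] ℝ, ofDegree 2 α ∈ P := fun α => by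
    refine cancel (c := ((2 : ℕ) : ℝ)) (by norm_num) ?_
    rw [← sum_exterior_interior e]
    refine sum_mem fun i _ => ?_
    rw [interior_ofDegree_succ]
    have : ofDegree 1 (α.curryLeft (e i)) = ((1 : ℕ) : ℝ) • ofDegree 1 (α.curryLeft (e i)) := by
      simp
    rw [this, ← sum_exterior_interior e, map_sum, LinearMap.sum_apply]
    refine sum_mem fun j _ => ?_
    rw [interior_ofDegree_succ, ofDegree_zero_eq, map_smul, LinearMap.smul_apply, map_smul,
      LinearMap.smul_apply]
    exact P.smul_mem _ (two _ _)
  have deg4 : ∀ α : V [⋀^Fin 4]→ₗ[ℝ] ℝ, ofDegree 4 α ∈ P := fun α => by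
    refine cancel (c := 6 - ((4 : ℕ) : ℝ)) (by norm_num) ?_
    rw [← sum_interior_exterior e]
    refine sum_mem fun i _ => ?_
    rw [exterior_ofDegree]
    have : ofDegree 5 (oneWedge (e.coord i) α) =
        (6 - ((5 : ℕ) : ℝ)) • ofDegree 5 (oneWedge (e.coord i) α) := by
      norm_num
    rw [this, ← sum_interior_exterior e, map_sum, LinearMap.sum_apply]
    refine sum_mem fun j _ => ?_
    rw [exterior_ofDegree, hsix, map_smul, LinearMap.smul_apply, map_smul, LinearMap.smul_apply]
    exact P.smul_mem _ (four _ _)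
  intro φ hφ
  rw [mixed_eq_sum h6 φ]
  refine sum_mem fun k _ => ?_
  have hodd : ∀ k : ℕ, (k : ZMod 2) ≠ 0 → ofDegree k (φ k) ∈ P := fun k hk => by
    rw [hφ k hk, ofDegree, Pi.single_zero]; exact zero_mem _
  fin_cases k
  · change ofDegree 0 (φ 0) ∈ P
    rw [ofDegree_zero_eq]; exact P.smul_mem _ h1
  · exact hodd 1 (by decide)
  · exact deg2 _
  · exact hodd 3 (by decide)
  · exact deg4 _
  · exact hodd 5 (by decide)
  · change ofDegree 6 (φ 6) ∈ P
    rw [hsix]; exact P.smul_mem _ hν'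

/-- For a form `ρ` of either parity, `u ↦ μ(u) · ρ` is of the form `u ↦ u · X`. Odd forms are
reduced to even ones by Clifford multiplication with a vector of square `1`. -/
theorem exists_clifford_moment (hν : ν ≠ 0) {p : ZMod 2} {ρ : Mixed V ℝ} (hρ : HasParity p ρ) :
    ∃ X, ∀ u, clifford ρ ((spinors h6 ν).moment ρ u) = clifford X u := by
  have hEv : ∀ ρ : Mixed V ℝ, HasParity 0 ρ →
      ∃ X, ∀ u, (spinors h6 ν).act ((spinors h6 ν).rep ρ ((spinors h6 ν).act u ρ)) ρ =
        (spinors h6 ν).act u X := fun ρ hρ => by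
    refine (spinors h6 ν).exists_act_eq_of_orbitSpan (E := paritySubmodule V 0) ?_
      (even_le_orbitSpan h6 ν hν) (cubic_base h6 ν hν) hρ
    intro p q x hx
    have h : ∀ u w, HasParity 0 (clifford (clifford x u) w) := fun u w => by
      have := (HasParity.clifford hx u).clifford w
      rwa [zero_add, CharTwo.add_self_eq_zero (1 : ZMod 2)] at this
    exact sub_mem (mem_paritySubmodule.2 (h q p)) (mem_paritySubmodule.2 (h p q))
  have hp : ∀ p : ZMod 2, p = 0 ∨ p = 1 := by decide
  rcases hp p with rfl | rfl
  · exact hEv ρ hρ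
  · obtain ⟨e, he⟩ := exists_form_eq_two h6 ν
    have h2 : HasParity 0 (clifford ρ e) := by
      have := hρ.clifford e
      rwa [CharTwo.add_self_eq_zero (1 : ZMod 2)] at this
    have h3 := (spinors h6 ν).exists_act_eq_of_act he (hEv _ h2)
    have ee : (spinors h6 ν).act e (clifford ρ e) = ρ := by
      have := (spinors h6 ν).act_act_add e e ρ
      rw [he, ← two_smul ℝ] at this
      exact smul_right_injective _ (two_ne_zero (α := ℝ)) this
    rw [ee] at h3
    exact h3

end

/-! ### Complex forms and complex vectors -/

section
variable {V : Type*} [AddCommGroup V] [Module ℝ V]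

theorem complexForm_apply (ρ ψ : Mixed V ℝ) (k : ℕ) (v : Fin k → V) :
    complexForm ρ ψ k v = (ρ k v : ℂ) + Complex.I * (ψ k v : ℂ) := rfl

theorem conj_complexForm (ρ ψ : Mixed V ℝ) : conj (complexForm ρ ψ) = complexForm ρ (-ψ) := by
  funext k; ext v
  change (starRingEnd ℂ) (complexForm ρ ψ k v) = _
  rw [complexForm_apply, complexForm_apply]
  simp

theorem complexForm_eq_zero {ρ ψ : Mixed V ℝ} : complexForm ρ ψ = 0 ↔ ρ = 0 ∧ ψ = 0 := by
  constructor
  · intro h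
    have h1 : ∀ k v, (ρ k v : ℂ) + Complex.I * (ψ k v : ℂ) = 0 := fun k v => by
      rw [← complexForm_apply, h]; rfl
    have h2 : ∀ k v, ρ k v = 0 := fun k v => by simpa using congrArg Complex.re (h1 k v)
    have h3 : ∀ k v, ψ k v = 0 := fun k v => by simpa using congrArg Complex.im (h1 k v)
    exact ⟨funext fun k => AlternatingMap.ext (h2 k), funext fun k => AlternatingMap.ext (h3 k)⟩
  · rintro ⟨rfl, rfl⟩
    funext k; ext v; rw [complexForm_apply]; simp

theorem wedge_complexForm {a b n : ℕ} (h : a + b = n) (ρ ψ ρ' ψ' : Mixed V ℝ) (v : Fin n → V) :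
    wedge h (complexForm ρ ψ a) (complexForm ρ' ψ' b) v =
      ((wedge h (ρ a) (ρ' b) v - wedge h (ψ a) (ψ' b) v : ℝ) : ℂ) +
        Complex.I * ((wedge h (ρ a) (ψ' b) v + wedge h (ψ a) (ρ' b) v : ℝ) : ℂ) := by
  have e := factorial_smul_wedge_apply h (complexForm ρ ψ a) (complexForm ρ' ψ' b) v
  have e1 := factorial_smul_wedge_apply h (ρ a) (ρ' b) v
  have e2 := factorial_smul_wedge_apply h (ψ a) (ψ' b) v
  have e3 := factorial_smul_wedge_apply h (ρ a) (ψ' b) v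
  have e4 := factorial_smul_wedge_apply h (ψ a) (ρ' b) v
  refine factorial_smul_cancel a (factorial_smul_cancel b ?_)
  simp only [smul_smul]
  rw [mul_comm, e]
  simp only [nsmul_eq_mul] at e1 e2 e3 e4 ⊢
  trans ((((a.factorial * b.factorial : ℕ) : ℝ) * wedge h (ρ a) (ρ' b) v -
      ((a.factorial * b.factorial : ℕ) : ℝ) * wedge h (ψ a) (ψ' b) v : ℝ) : ℂ) +
        Complex.I * ((((a.factorial * b.factorial : ℕ) : ℝ) * wedge h (ρ a) (ψ' b) v +
        ((a.factorial * b.factorial : ℕ) : ℝ) * wedge h (ψ a) (ρ' b) v : ℝ) : ℂ)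
  · rw [e1, e2, e3, e4, ← Finset.sum_sub_distrib, ← Finset.sum_add_distrib]
    push_cast
    rw [Finset.mul_sum, ← Finset.sum_add_distrib]
    refine Finset.sum_congr rfl fun σ _ => ?_
    simp only [complexForm_apply, Units.smul_def, zsmul_eq_mul]
    push_cast
    linear_combination ((Equiv.Perm.sign σ : ℤˣ) : ℤ) *
      (ψ a fun i => v (σ (Fin.cast h (Fin.castAdd b i)))) *
      (ψ' b fun j => v (σ (Fin.cast h (Fin.natAdd a j)))) * Complex.I_sq
  · push_cast; ring

theorem pairing_complexForm (ρ ψ ρ' ψ' : Mixed V ℝ) (v : Fin 6 → V) :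
    pairing (complexForm ρ ψ) (complexForm ρ' ψ') v =
      ((pairing ρ ρ' v - pairing ψ ψ' v : ℝ) : ℂ) +
        Complex.I * ((pairing ρ ψ' v + pairing ψ ρ' v : ℝ) : ℂ) := by
  simp only [pairing_apply_eq_sum, wedge_complexForm]
  push_cast
  rw [← Finset.sum_sub_distrib, ← Finset.sum_add_distrib, Finset.mul_sum, ← Finset.sum_add_distrib]
  refine Finset.sum_congr rfl fun k _ => ?_
  ring

/-- The identification of pairs of real vectors with complex vectors, `(x, y) ↦ x + i y`. -/
def complexVectorₗ : ((V × Module.Dual ℝ V) × (V × Module.Dual ℝ V)) →ₗ[ℝ]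
    ((ℂ ⊗[ℝ] V) × (V →ₗ[ℝ] ℂ)) where
  toFun z := ((1 : ℂ) ⊗ₜ z.1.1 + Complex.I ⊗ₜ z.2.1,
    Complex.ofRealCLM.toLinearMap ∘ₗ z.1.2 + Complex.I • (Complex.ofRealCLM.toLinearMap ∘ₗ z.2.2))
  map_add' z w := by
    refine Prod.ext ?_ ?_
    · simp [TensorProduct.tmul_add]; abel
    · ext v; simp; ring
  map_smul' c z := by
    refine Prod.ext ?_ ?_
    · simp
    · ext v; simp; ring

theorem complexVectorₗ_bijective : Function.Bijective (complexVectorₗ (V := V)) := by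
  constructor
  · rw [← LinearMap.ker_eq_bot, LinearMap.ker_eq_bot']
    rintro ⟨⟨a, ξ⟩, ⟨b, η⟩⟩ h
    have h1 : (1 : ℂ) ⊗ₜ[ℝ] a + Complex.I ⊗ₜ[ℝ] b = 0 := congrArg Prod.fst h
    have h2 : ∀ v, (ξ v : ℂ) + Complex.I * (η v : ℂ) = 0 := fun v =>
      congrArg (fun f => f.2 v) h
    have ha := congrArg (fun z => TensorProduct.lid ℝ V (LinearMap.rTensor V Complex.reLm z)) h1
    have hb := congrArg (fun z => TensorProduct.lid ℝ V (LinearMap.rTensor V Complex.imLm z)) h1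
    have hξ : ξ = 0 := by ext v; simpa using congrArg Complex.re (h2 v)
    have hη : η = 0 := by ext v; simpa using congrArg Complex.im (h2 v)
    simp only [map_add, LinearMap.rTensor_tmul, TensorProduct.lid_tmul, map_zero,
      Complex.reLm_coe, Complex.imLm_coe] at ha hb
    simp at ha hb
    simp [ha, hb, hξ, hη]
  · rintro ⟨z, f⟩
    have hz : ∃ a b : V, (1 : ℂ) ⊗ₜ[ℝ] a + Complex.I ⊗ₜ[ℝ] b = z := by
      induction z using TensorProduct.induction_on with
      | zero => exact ⟨0, 0, by simp⟩
      | tmul c v =>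
        refine ⟨c.re • v, c.im • v, ?_⟩
        rw [← TensorProduct.smul_tmul, ← TensorProduct.smul_tmul, ← TensorProduct.add_tmul]
        congr 1
        simp [Complex.re_add_im]
      | add z w hz hw =>
        obtain ⟨a, b, rfl⟩ := hz
        obtain ⟨a', b', rfl⟩ := hw
        refine ⟨a + a', b + b', ?_⟩
        simp only [TensorProduct.tmul_add]; abel
    obtain ⟨a, b, rfl⟩ := hz
    refine ⟨((a, Complex.reLm ∘ₗ f), (b, Complex.imLm ∘ₗ f)), ?_⟩
    refine Prod.ext rfl ?_
    ext v
    change ((f v).re : ℂ) + Complex.I * ((f v).im : ℂ) = f v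
    rw [mul_comm, Complex.re_add_im]

/-- The identification of pairs of real vectors with complex vectors, `(x, y) ↦ x + i y`. -/
def complexVector : ((V × Module.Dual ℝ V) × (V × Module.Dual ℝ V)) ≃ₗ[ℝ]
    ((ℂ ⊗[ℝ] V) × (V →ₗ[ℝ] ℂ)) :=
  LinearEquiv.ofBijective complexVectorₗ complexVectorₗ_bijective

theorem cliffordC_complexVector (ρ ψ : Mixed V ℝ) (x y : V × Module.Dual ℝ V) :
    cliffordC (complexForm ρ ψ) (complexVector (x, y)) =
      complexForm (clifford ρ x - clifford ψ y) (clifford ρ y + clifford ψ x) := by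
  change LinearMap.liftBaseChange ℂ (interior (complexForm ρ ψ))
    ((1 : ℂ) ⊗ₜ x.1 + Complex.I ⊗ₜ y.1) + exterior (complexForm ρ ψ)
    (Complex.ofRealCLM.toLinearMap ∘ₗ x.2 + Complex.I • (Complex.ofRealCLM.toLinearMap ∘ₗ y.2)) = _
  rw [map_add, LinearMap.liftBaseChange_tmul, LinearMap.liftBaseChange_tmul, one_smul]
  funext k; ext v
  have hI := Complex.I_sq
  have h1 : (interior (complexForm ρ ψ) x.1 + Complex.I • interior (complexForm ρ ψ) y.1) k v =
      ((interior ρ x.1 k v - interior ψ y.1 k v : ℝ) : ℂ) +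
        Complex.I * ((interior ρ y.1 k v + interior ψ x.1 k v : ℝ) : ℂ) := by
    change complexForm ρ ψ (k + 1) _ + Complex.I * complexForm ρ ψ (k + 1) _ = _
    rw [complexForm_apply, complexForm_apply]
    simp only [interior_apply]
    push_cast
    change (ρ (k + 1) (Fin.cons x.1 v) : ℂ) + _ * (ψ (k + 1) (Fin.cons x.1 v) : ℂ) +
      _ * ((ρ (k + 1) (Fin.cons y.1 v) : ℂ) + _ * (ψ (k + 1) (Fin.cons y.1 v) : ℂ)) = _
    linear_combination (ψ (k + 1) (Fin.cons y.1 v) : ℂ) * hI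
  have h2 : (exterior (complexForm ρ ψ) (Complex.ofRealCLM.toLinearMap ∘ₗ x.2 +
      Complex.I • (Complex.ofRealCLM.toLinearMap ∘ₗ y.2))) k v =
      ((exterior ρ x.2 k v - exterior ψ y.2 k v : ℝ) : ℂ) +
        Complex.I * ((exterior ρ y.2 k v + exterior ψ x.2 k v : ℝ) : ℂ) := by
    rcases k with _ | k
    · simp [exterior_zero]
    · simp only [exterior_succ, oneWedge_apply, complexForm_apply, zsmul_eq_mul]
      push_cast
      rw [← Finset.sum_sub_distrib, ← Finset.sum_add_distrib, Finset.mul_sum,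
        ← Finset.sum_add_distrib]
      refine Finset.sum_congr rfl fun i _ => ?_
      simp only [LinearMap.add_apply, LinearMap.smul_apply, LinearMap.comp_apply, smul_eq_mul,
        ContinuousLinearMap.coe_coe, Complex.ofRealCLM_apply]
      linear_combination (-1) ^ (i : ℕ) * (y.2 (v i) : ℂ) * (ψ k (i.removeNth v) : ℂ) * hI
  rw [complexForm_apply]
  change (interior (complexForm ρ ψ) x.1 + Complex.I • interior (complexForm ρ ψ) y.1) k v +
    (exterior (complexForm ρ ψ) _) k v = _
  rw [h1, h2]
  simp only [clifford_apply, Pi.add_apply, Pi.sub_apply, AlternatingMap.add_apply,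
    AlternatingMap.sub_apply]
  push_cast
  ring

end

/-! ### The form `ρ̂` and the derivative of the invariant quartic -/

section
variable {V : Type*} [AddCommGroup V] [Module ℝ V] [FiniteDimensional ℝ V]

omit [FiniteDimensional ℝ V] in
theorem mem_annihilator_complexVector (ρ ψ : Mixed V ℝ) (x y : V × Module.Dual ℝ V) :
    complexVector (x, y) ∈ annihilator (complexForm ρ ψ) ↔
      clifford ρ x = clifford ψ y ∧ clifford ψ x = -clifford ρ y := by
  rw [annihilator, LinearMap.mem_ker, cliffordC_complexVector, complexForm_eq_zero, sub_eq_zero,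
    add_comm, ← eq_neg_iff_add_eq_zero]

omit [FiniteDimensional ℝ V] in
/-- A subspace of `D × D` in which the first coordinate determines the second has dimension `dim
D` if and only if it projects onto the first coordinate. -/
theorem finrank_eq_iff_of_graph {D : Type*} [AddCommGroup D] [Module ℝ D] [FiniteDimensional ℝ D]
    (K : Submodule ℝ (D × D)) (hK : ∀ y, ((0, y) : D × D) ∈ K → y = 0) :
    Module.finrank ℝ K = Module.finrank ℝ D ↔ ∀ x, ∃ y, (x, y) ∈ K := by
  let g : K →ₗ[ℝ] D := LinearMap.fst ℝ D D ∘ₗ K.subtype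
  have hinj : Function.Injective g := by
    refine (injective_iff_map_eq_zero g).2 ?_
    rintro ⟨⟨x, y⟩, hz⟩ h0
    have hx : x = 0 := h0
    subst hx
    have := hK y hz
    subst this
    rfl
  have hsurj : Function.Surjective g ↔ ∀ x, ∃ y, (x, y) ∈ K := by
    constructor
    · intro hs x
      obtain ⟨⟨z, hz⟩, rfl⟩ := hs x
      exact ⟨z.2, hz⟩
    · intro hs x
      obtain ⟨y, hy⟩ := hs x
      exact ⟨⟨(x, y), hy⟩, rfl⟩
  rw [← hsurj]
  constructor
  · intro h
    exact (LinearMap.injective_iff_surjective_of_finrank_eq_finrank h).1 hinj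
  · intro hs
    exact (LinearEquiv.ofBijective g ⟨hinj, hs⟩).finrank_eq

/-- Purity of `ρ + i ψ` in real terms: `x + i y` annihilates `ρ + i ψ` if and only if `x ρ = y ψ`
and `x ψ = -y ρ`. -/
theorem isPure_iff (h6 : Module.finrank ℝ V = 6) {ν : V [⋀^Fin 6]→ₗ[ℝ] ℝ} {ρ ψ : Mixed V ℝ}
    (h : coeff ν (pairing ρ ψ) ≠ 0) :
    IsPure (complexForm ρ ψ) ↔
      ∀ x, ∃ y, clifford ρ x = clifford ψ y ∧ clifford ψ x = -clifford ρ y := by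
  let A := (annihilator (complexForm ρ ψ)).restrictScalars ℝ
  let K := A.comap (complexVector (V := V)).toLinearMap
  have hK : ∀ x y, (x, y) ∈ K ↔ clifford ρ x = clifford ψ y ∧ clifford ψ x = -clifford ρ y :=
    mem_annihilator_complexVector ρ ψ
  have hfin : Module.finrank ℝ K = 2 * Module.finrank ℂ (annihilator (complexForm ρ ψ)) := by
    have h1 : Module.finrank ℝ K = Module.finrank ℝ A :=
      ((complexVector (V := V)).ofSubmodule' A).finrank_eq
    have h2 : Module.finrank ℝ A = Module.finrank ℝ (annihilator (complexForm ρ ψ)) := rfl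
    rw [h1, h2, ← Module.finrank_mul_finrank ℝ ℂ (annihilator (complexForm ρ ψ)),
      Complex.finrank_real_complex]
  have hgraph := finrank_eq_iff_of_graph K fun y hy => by
    have hz' := (hK _ _).1 hy
    rw [map_zero, map_zero, eq_comm, zero_eq_neg] at hz'
    exact (spinors h6 ν).eq_zero_of_act_eq_zero h hz'.2 hz'.1
  simp only [hK] at hgraph
  rw [← hgraph, IsPure, h6, hfin, finrank_vectors h6]
  omega

/-- `⟨φ, φ̄⟩ = -2i ⟨ρ, ψ⟩` for `φ = ρ + i ψ`, since the pairing is skew. -/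
theorem coeff_pairing_conj (h6 : Module.finrank ℝ V = 6) (ν : V [⋀^Fin 6]→ₗ[ℝ] ℝ)
    (ρ ψ : Mixed V ℝ) : coeff ν (pairing (complexForm ρ ψ) (conj (complexForm ρ ψ))) =
      ((-2 * coeff ν (pairing ρ ψ) : ℝ) : ℂ) * Complex.I := by
  have hself : ∀ φ : Mixed V ℝ, pairing φ φ = 0 := fun φ => by
    have h := pairing_swap h6 φ φ
    generalize pairing φ φ = τ at h ⊢
    ext v
    have h' := congrArg (fun τ => τ v) h
    simp only [AlternatingMap.neg_apply] at h'
    rw [AlternatingMap.zero_apply]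
    exact self_eq_neg.1 h'
  have hneg : ∀ φ : Mixed V ℝ, pairing φ (-ψ) = -pairing φ ψ := fun φ => by
    rw [← pairingₗ_apply, map_neg, pairingₗ_apply]
  rw [conj_complexForm, coeff, pairing_complexForm, hself, hneg, hneg, hself, pairing_swap h6 ψ ρ,
    coeff]
  simp
  ring

theorem isHat_iff (h6 : Module.finrank ℝ V = 6) {p : ZMod 2} {ν : V [⋀^Fin 6]→ₗ[ℝ] ℝ}
    {ρ ψ : Mixed V ℝ} : IsHat p ν ρ ψ ↔ HasParity p ψ ∧ (spinors h6 ν).IsConj ρ ψ := by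
  rw [IsHat, SpinorModule.IsConj, coeff_pairing_conj h6, spinors_pair]
  have hc : (∃ c : ℝ, 0 < c ∧ ((-2 * coeff ν (pairing ρ ψ) : ℝ) : ℂ) * Complex.I =
      c * Complex.I) ↔ coeff ν (pairing ρ ψ) < 0 := by
    constructor
    · rintro ⟨c, hc, h⟩
      have h2 := mul_right_cancel₀ Complex.I_ne_zero h
      have h3 : -2 * coeff ν (pairing ρ ψ) = c := by exact_mod_cast h2
      linarith
    · intro h
      exact ⟨_, by linarith, rfl⟩
  rw [hc]
  refine and_congr_right fun _ => ?_
  constructor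
  · rintro ⟨h1, h2⟩
    exact ⟨(isPure_iff h6 h2.ne).1 h1, h2⟩
  · rintro ⟨h1, h2⟩
    exact ⟨(isPure_iff h6 h2.ne).2 h1, h2⟩

theorem momentForm_eq (h6 : Module.finrank ℝ V = 6) (ν : V [⋀^Fin 6]→ₗ[ℝ] ℝ) (ρ : Mixed V ℝ)
    (u w : V × Module.Dual ℝ V) : momentForm ν ρ u w =
      1 / 4 * coeffₗ ν (pairing (clifford ρ w) (clifford ρ u)) := by
  have h0 : momentForm ν ρ u w = 1 / 4 * coeffₗ ν (pairing (spinAction u w ρ) ρ) := rfl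
  have hneg : -clifford (clifford ρ u) w = (-1 : ℝ) • clifford (clifford ρ u) w := by module
  have h1 := pairing_clifford h6 (clifford ρ w) ρ u
  have h2 := pairing_clifford h6 (clifford ρ u) ρ w
  have h3 := pairing_swap h6 (clifford ρ u) (clifford ρ w)
  rw [h0, spinAction, pairing_smul_left, sub_eq_add_neg, hneg, pairing_add_left, pairing_smul_left,
    h1, h2, h3]
  simp only [map_smul, map_add, map_neg, smul_eq_mul]
  ring

theorem momentMap_eq (h6 : Module.finrank ℝ V = 6) (ν : V [⋀^Fin 6]→ₗ[ℝ] ℝ) (ρ : Mixed V ℝ) :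
    momentMap ν ρ = (1 / 4 : ℝ) • (spinors h6 ν).moment ρ := by
  refine LinearMap.ext fun u => (spinors h6 ν).eq_of_form fun w => ?_
  refine (polar_momentMap ν ρ u w).trans ?_
  rw [momentForm_eq h6, LinearMap.smul_apply, map_smul, LinearMap.smul_apply,
    SpinorModule.form_moment, smul_eq_mul, spinors_pair, spinors_act, spinors_act, coeffₗ_apply]

/-- The constant is `3 / 4 = 12 / 4²`, where `12 = dim (V ⊕ V*)` and `moment` is `4 μ(ρ)`. -/
theorem quartic_eq (h6 : Module.finrank ℝ V = 6) {ν : V [⋀^Fin 6]→ₗ[ℝ] ℝ} {ρ : Mixed V ℝ} {c : ℝ}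
    (hc : ∀ u, (spinors h6 ν).moment ρ ((spinors h6 ν).moment ρ u) = c • u) :
    quartic ν ρ = 3 / 4 * c := by
  have : momentMap ν ρ * momentMap ν ρ = (c / 16) • LinearMap.id := by
    refine LinearMap.ext fun u => ?_
    rw [momentMap_eq h6]
    simp only [Module.End.mul_apply, LinearMap.smul_apply, map_smul, hc, LinearMap.id_apply]
    module
  rw [quartic, this, map_smul, LinearMap.trace_id, finrank_vectors h6, smul_eq_mul]
  norm_num; ring

theorem quartic_eq_pair (h6 : Module.finrank ℝ V = 6) {ν : V [⋀^Fin 6]→ₗ[ℝ] ℝ} {ρ X : Mixed V ℝ}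
    (hX : ∀ u, clifford ρ ((spinors h6 ν).moment ρ u) = clifford X u) :
    quartic ν ρ = 3 / 8 * coeff ν (pairing ρ X) := by
  rw [quartic_eq h6 ((spinors h6 ν).moment_moment hX), spinors_pair]; ring

omit [FiniteDimensional ℝ V] in
theorem clifford_clifford_self {e : V × Module.Dual ℝ V} (he : e.2 e.1 = 1) (φ : Mixed V ℝ) :
    clifford (clifford φ e) e = φ := by
  have h := clifford_clifford φ e e
  have h2 : polar e e = 2 := by simp [polar, he]; norm_num
  rw [h2, ← two_smul ℝ] at h
  exact smul_right_injective _ (two_ne_zero (α := ℝ)) h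

theorem hasParity_of_clifford_moment (h6 : Module.finrank ℝ V = 6) {p : ZMod 2}
    {ν : V [⋀^Fin 6]→ₗ[ℝ] ℝ} {ρ X : Mixed V ℝ} (hρ : HasParity p ρ)
    (hX : ∀ u, clifford ρ ((spinors h6 ν).moment ρ u) = clifford X u) : HasParity p X := by
  obtain ⟨e, he⟩ := exists_form_eq_two h6 ν
  have he' : e.2 e.1 = 1 := by
    rw [spinors_form] at he; linarith
  rw [← clifford_clifford_self he' X, ← hX]
  have := (hρ.clifford ((spinors h6 ν).moment ρ e)).clifford e
  rwa [add_assoc, CharTwo.add_self_eq_zero (1 : ZMod 2), add_zero] at this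

/-- Existence and formula for `ρ̂`. -/
theorem isHat_of_quartic_neg (h6 : Module.finrank ℝ V = 6) {p : ZMod 2} {ν : V [⋀^Fin 6]→ₗ[ℝ] ℝ}
    {ρ X : Mixed V ℝ} (hρ : HasParity p ρ) (hq : quartic ν ρ < 0)
    (hX : ∀ u, clifford ρ ((spinors h6 ν).moment ρ u) = clifford X u) :
    IsHat p ν ρ ((√(-(coeff ν (pairing ρ X) / 2)))⁻¹ • X) := by
  rw [quartic_eq_pair h6 hX] at hq
  exact (isHat_iff h6).2 ⟨(hasParity_of_clifford_moment h6 hρ hX).smul _,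
    (spinors h6 ν).isConj_of_neg hX (by rw [spinors_pair]; linarith)⟩

theorem IsHat.pairing_lt (h6 : Module.finrank ℝ V = 6) {p : ZMod 2} {ν : V [⋀^Fin 6]→ₗ[ℝ] ℝ}
    {ρ ψ : Mixed V ℝ} (h : IsHat p ν ρ ψ) : coeff ν (pairing ρ ψ) < 0 :=
  ((isHat_iff h6).1 h).2.2

theorem IsHat.eq_smul (h6 : Module.finrank ℝ V = 6) {p : ZMod 2} {ν : V [⋀^Fin 6]→ₗ[ℝ] ℝ}
    {ρ ψ X : Mixed V ℝ} (h : IsHat p ν ρ ψ)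
    (hX : ∀ u, clifford ρ ((spinors h6 ν).moment ρ u) = clifford X u) :
    X = (-coeff ν (pairing ρ ψ) / 2) • ψ := by
  obtain ⟨e, he⟩ := exists_form_eq_two h6 ν
  exact SpinorModule.IsConj.eq_smul _ (by rw [finrank_vectors h6]; norm_num) he
    ((isHat_iff h6).1 h).2 hX

theorem IsHat.pairing_eq (h6 : Module.finrank ℝ V = 6) {p : ZMod 2} {ν : V [⋀^Fin 6]→ₗ[ℝ] ℝ}
    {ρ ψ X : Mixed V ℝ} (h : IsHat p ν ρ ψ)
    (hX : ∀ u, clifford ρ ((spinors h6 ν).moment ρ u) = clifford X u) :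
    √(-(coeff ν (pairing ρ X) / 2)) = -coeff ν (pairing ρ ψ) / 2 := by
  obtain ⟨e, he⟩ := exists_form_eq_two h6 ν
  have h1 := SpinorModule.IsConj.pair_eq _ (by rw [finrank_vectors h6]; norm_num) he
    ((isHat_iff h6).1 h).2 hX
  rw [spinors_pair, spinors_pair] at h1
  have h2 := h.pairing_lt h6
  rw [h1, neg_neg, Real.sqrt_sq_eq_abs, abs_of_neg (by linarith)]
  ring

/-- Uniqueness of `ρ̂`. -/
theorem IsHat.eq (h6 : Module.finrank ℝ V = 6) {p : ZMod 2} {ν : V [⋀^Fin 6]→ₗ[ℝ] ℝ}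
    {ρ ψ X : Mixed V ℝ} (h : IsHat p ν ρ ψ)
    (hX : ∀ u, clifford ρ ((spinors h6 ν).moment ρ u) = clifford X u) :
    ψ = (√(-(coeff ν (pairing ρ X) / 2)))⁻¹ • X := by
  have h1 := h.pairing_eq h6 hX
  have h2 := h.pairing_lt h6
  rw [h1]
  conv_rhs => rw [h.eq_smul h6 hX]
  rw [smul_smul, inv_mul_cancel₀ (by linarith), one_smul]

/-- The spinor `X` is a multiple of the gradient of the invariant quartic. -/
theorem quartic_hasDerivAt (h6 : Module.finrank ℝ V = 6) {p : ZMod 2} {ν : V [⋀^Fin 6]→ₗ[ℝ] ℝ}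
    (hν : ν ≠ 0) {ρ β X : Mixed V ℝ} (hρ : HasParity p ρ) (hβ : HasParity p β)
    (hX : ∀ u, clifford ρ ((spinors h6 ν).moment ρ u) = clifford X u) :
    HasDerivAt (fun t : ℝ => quartic ν (ρ + t • β)) (3 / 2 * coeff ν (pairing β X)) 0 := by
  obtain ⟨e, he⟩ := exists_form_eq_two h6 ν
  have hd := (spinors h6 ν).hasDerivAt_form_moment hX β e e
  -- As `μ² = c` and `μ` is skew, `(μ(e), μ(e)) = -c (e, e) = -2 c`.
  have hq : ∀ t : ℝ, quartic ν (ρ + t • β) = -(3 / 8) * (spinors h6 ν).form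
      ((spinors h6 ν).moment (ρ + t • β) e) ((spinors h6 ν).moment (ρ + t • β) e) := fun t => by
    obtain ⟨Y, hY⟩ := exists_clifford_moment h6 ν hν (hρ.add (hβ.smul t))
    have h1 := (spinors h6 ν).moment_moment hY
    rw [quartic_eq h6 h1, (spinors h6 ν).form_moment_swap, h1, map_smul,
      LinearMap.smul_apply, smul_eq_mul, he]
    ring
  have := hd.const_mul (-(3 / 8))
  refine (this.congr_deriv ?_).congr_of_eventuallyEq (Filter.Eventually.of_forall hq)
  rw [he, spinors_pair]; ring

end

/-! ### Naturality under linear isomorphisms -/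

section
variable {V W : Type*} [AddCommGroup V] [Module ℝ V] [AddCommGroup W] [Module ℝ W]

/-- The pull-back of a mixed form under a linear map. -/
def pull (L : W →ₗ[ℝ] V) (φ : Mixed V ℝ) : Mixed W ℝ := fun k => (φ k).compLinearMap L

theorem pull_apply (L : W →ₗ[ℝ] V) (φ : Mixed V ℝ) (k : ℕ) (v : Fin k → W) :
    pull L φ k v = φ k (fun i => L (v i)) := rfl

theorem HasParity.pull {p : ZMod 2} {φ : Mixed V ℝ} (h : HasParity p φ) (L : W →ₗ[ℝ] V) :
    HasParity p (pull L φ) := fun k hk => by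
  ext v; rw [pull_apply, h k hk]; rfl

theorem wedge_compLinearMap {a b n : ℕ} (h : a + b = n) (α : V [⋀^Fin a]→ₗ[ℝ] ℝ)
    (β : V [⋀^Fin b]→ₗ[ℝ] ℝ) (L : W →ₗ[ℝ] V) :
    wedge h (α.compLinearMap L) (β.compLinearMap L) = (wedge h α β).compLinearMap L := by
  ext v
  refine factorial_smul_cancel a (factorial_smul_cancel b ?_)
  simp only [smul_smul]
  rw [mul_comm, factorial_smul_wedge_apply, AlternatingMap.compLinearMap_apply,
    factorial_smul_wedge_apply]
  rfl

theorem pairing_pull (L : W →ₗ[ℝ] V) (φ ψ : Mixed V ℝ) :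
    pairing (pull L φ) (pull L ψ) = (pairing φ ψ).compLinearMap L := by
  ext v
  rw [AlternatingMap.compLinearMap_apply, pairing, pairing, alternating_sum_apply,
    alternating_sum_apply]
  refine Finset.sum_congr rfl fun k _ => ?_
  rw [AlternatingMap.smul_apply, AlternatingMap.smul_apply, pull, pull, wedge_compLinearMap]
  rfl

/-- The isomorphism `V ⊕ V* ≅ W ⊕ W*` induced by an isomorphism `W ≅ V`. -/
def pullVector (L : W ≃ₗ[ℝ] V) : (V × Module.Dual ℝ V) ≃ₗ[ℝ] (W × Module.Dual ℝ W) :=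
  L.symm.prodCongr L.dualMap

theorem pullVector_apply (L : W ≃ₗ[ℝ] V) (u : V × Module.Dual ℝ V) :
    pullVector L u = (L.symm u.1, u.2 ∘ₗ L.toLinearMap) := rfl

theorem clifford_pull (L : W ≃ₗ[ℝ] V) (φ : Mixed V ℝ) (u : V × Module.Dual ℝ V) :
    clifford (pull L.toLinearMap φ) (pullVector L u) = pull L.toLinearMap (clifford φ u) := by
  funext k; ext v
  rw [clifford_apply, pull_apply, clifford_apply, pullVector_apply]
  simp only [Pi.add_apply, AlternatingMap.add_apply, interior_apply]
  congr 1
  · rw [pull_apply]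
    congr 1
    funext i
    refine Fin.cases ?_ (fun j => ?_) i
    · simp
    · simp
  · rcases k with _ | k
    · rfl
    · rw [exterior_succ, exterior_succ, oneWedge_apply, oneWedge_apply]
      rfl

theorem compLinearMap_ne_zero {ν : V [⋀^Fin 6]→ₗ[ℝ] ℝ} (hν : ν ≠ 0) (L : W ≃ₗ[ℝ] V) :
    ν.compLinearMap L.toLinearMap ≠ 0 := fun h => hν <| by
  ext v
  have := congrArg (fun f => f fun i => L.symm (v i)) h
  simpa using this

variable [FiniteDimensional ℝ V] [FiniteDimensional ℝ W]

omit [FiniteDimensional ℝ W] in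
theorem coeff_compLinearMap (h6 : Module.finrank ℝ V = 6) {ν : V [⋀^Fin 6]→ₗ[ℝ] ℝ} (hν : ν ≠ 0)
    (L : W ≃ₗ[ℝ] V) (τ : V [⋀^Fin 6]→ₗ[ℝ] ℝ) :
    coeff (ν.compLinearMap L.toLinearMap) (τ.compLinearMap L.toLinearMap) = coeff ν τ := by
  have hν' := compLinearMap_ne_zero hν L
  have : τ.compLinearMap L.toLinearMap = coeff ν τ • ν.compLinearMap L.toLinearMap := by
    conv_lhs => rw [← coeff_smul h6 hν τ]
    rfl
  rw [this, ← coeffₗ_apply, map_smul, coeffₗ_apply, coeff_self hν', smul_eq_mul, mul_one]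

variable (h6 : Module.finrank ℝ V = 6) (h6' : Module.finrank ℝ W = 6)
  {ν : V [⋀^Fin 6]→ₗ[ℝ] ℝ} (hν : ν ≠ 0) (L : W ≃ₗ[ℝ] V)
include h6 hν

omit [FiniteDimensional ℝ W] in
theorem coeff_pairing_pull (φ ψ : Mixed V ℝ) :
    coeff (ν.compLinearMap L.toLinearMap)
      (pairing (pull L.toLinearMap φ) (pull L.toLinearMap ψ)) = coeff ν (pairing φ ψ) := by
  rw [pairing_pull, coeff_compLinearMap h6 hν]

theorem moment_pull (ρ : Mixed V ℝ) (u : V × Module.Dual ℝ V) :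
    (spinors h6' (ν.compLinearMap L.toLinearMap)).moment (pull L.toLinearMap ρ) (pullVector L u) =
      pullVector L ((spinors h6 ν).moment ρ u) := by
  refine (spinors h6' (ν.compLinearMap L.toLinearMap)).eq_of_form fun w => ?_
  obtain ⟨w, rfl⟩ := (pullVector L).surjective w
  rw [SpinorModule.form_moment, spinors_pair, spinors_act, spinors_act, clifford_pull,
    clifford_pull, coeff_pairing_pull h6 hν L]
  have h1 := (spinors h6 ν).form_moment ρ u w
  rw [spinors_pair, spinors_act, spinors_act] at h1
  rw [← h1, spinors_form, spinors_form, pullVector_apply, pullVector_apply]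
  simp

theorem clifford_moment_pull {ρ X : Mixed V ℝ}
    (hX : ∀ u, clifford ρ ((spinors h6 ν).moment ρ u) = clifford X u)
    (u : W × Module.Dual ℝ W) : clifford (pull L.toLinearMap ρ)
      ((spinors h6' (ν.compLinearMap L.toLinearMap)).moment (pull L.toLinearMap ρ) u) =
        clifford (pull L.toLinearMap X) u := by
  obtain ⟨u, rfl⟩ := (pullVector L).surjective u
  rw [moment_pull h6 h6' hν, clifford_pull, hX, clifford_pull]

include h6' in
theorem quartic_pull {p : ZMod 2} {ρ : Mixed V ℝ} (hρ : HasParity p ρ) :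
    quartic (ν.compLinearMap L.toLinearMap) (pull L.toLinearMap ρ) = quartic ν ρ := by
  obtain ⟨X, hX⟩ := exists_clifford_moment h6 ν hν hρ
  rw [quartic_eq_pair h6 hX, quartic_eq_pair h6' (clifford_moment_pull h6 h6' hν L hX),
    coeff_pairing_pull h6 hν]

include h6' in
theorem IsHat.pull {p : ZMod 2} {ρ ψ : Mixed V ℝ} (h : IsHat p ν ρ ψ) :
    IsHat p (ν.compLinearMap L.toLinearMap) (pull L.toLinearMap ρ) (pull L.toLinearMap ψ) := by
  rw [isHat_iff h6']
  obtain ⟨h1, h2, h3⟩ := (isHat_iff h6).1 h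
  refine ⟨h1.pull _, fun u => ?_, ?_⟩
  · obtain ⟨u, rfl⟩ := (pullVector L).surjective u
    obtain ⟨w, hw1, hw2⟩ := h2 u
    rw [spinors_act, spinors_act] at hw1 hw2
    refine ⟨pullVector L w, ?_⟩
    rw [spinors_act, spinors_act, spinors_act, spinors_act, clifford_pull, clifford_pull,
      clifford_pull, clifford_pull, hw1, hw2]
    exact ⟨rfl, rfl⟩
  · rw [spinors_pair] at h3 ⊢
    rwa [coeff_pairing_pull h6 hν]

end

/-! ### Smooth families of mixed forms -/

section
variable {V : Type*} [AddCommGroup V] [Module ℝ V] [FiniteDimensional ℝ V]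

/-- A multiple of the gradient of the invariant quartic: the spinor `X` with `μ(ρ)(u) · ρ = u · X`
for all vectors `u`, obtained by inserting a vector `u` with `u² = 1`. -/
def gradient (h6 : Module.finrank ℝ V = 6) (ν : V [⋀^Fin 6]→ₗ[ℝ] ℝ) (ρ : Mixed V ℝ) : Mixed V ℝ :=
  clifford (clifford ρ ((spinors h6 ν).moment ρ (exists_dual_apply_eq_one h6).choose))
    (exists_dual_apply_eq_one h6).choose

theorem clifford_moment (h6 : Module.finrank ℝ V = 6) {ν : V [⋀^Fin 6]→ₗ[ℝ] ℝ} (hν : ν ≠ 0)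
    {p : ZMod 2} {ρ : Mixed V ℝ} (hρ : HasParity p ρ) (u : V × Module.Dual ℝ V) :
    clifford ρ ((spinors h6 ν).moment ρ u) = clifford (gradient h6 ν ρ) u := by
  obtain ⟨X, hX⟩ := exists_clifford_moment h6 ν hν hρ
  rw [gradient, hX, hX, clifford_clifford_self (exists_dual_apply_eq_one h6).choose_spec]

/-- The expansion of a vector of `V ⊕ V*` in a basis of `V` and the dual basis. -/
theorem vector_eq_sum {ι : Type*} [Fintype ι] [DecidableEq ι] (h6 : Module.finrank ℝ V = 6)
    (ν : V [⋀^Fin 6]→ₗ[ℝ] ℝ) (b : Module.Basis ι ℝ V) (u : V × Module.Dual ℝ V) :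
    u = ∑ i, ((spinors h6 ν).form u (0, b.coord i) • ((b i, 0) : V × Module.Dual ℝ V) +
      (spinors h6 ν).form u (b i, 0) • ((0, b.coord i) : V × Module.Dual ℝ V)) := by
  refine Prod.ext ?_ ?_
  · rw [Prod.fst_sum]
    simp [spinors_form, b.sum_repr]
  · rw [Prod.snd_sum]
    simp [spinors_form, b.sum_dual_apply_smul_coord]

/-- A formula for the gradient in which `e` and the basis do not depend on `ρ` and `ν`, so that its
smoothness in `ρ` and `ν` is apparent. -/
theorem gradient_eq_sum {ι : Type*} [Fintype ι] [DecidableEq ι] (h6 : Module.finrank ℝ V = 6)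
    (b : Module.Basis ι ℝ V) : ∃ e : V × Module.Dual ℝ V, ∀ (ν : V [⋀^Fin 6]→ₗ[ℝ] ℝ)
      (ρ : Mixed V ℝ), gradient h6 ν ρ =
      ∑ i, (coeff ν (pairing (clifford ρ (0, b.coord i)) (clifford ρ e)) •
          clifford (clifford ρ (b i, 0)) e +
        coeff ν (pairing (clifford ρ (b i, 0)) (clifford ρ e)) •
          clifford (clifford ρ (0, b.coord i)) e) := by
  refine ⟨(exists_dual_apply_eq_one h6).choose, fun ν ρ => ?_⟩
  rw [gradient]
  set e := (exists_dual_apply_eq_one h6).choose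
  have h := vector_eq_sum h6 ν b ((spinors h6 ν).moment ρ e)
  simp only [SpinorModule.form_moment, spinors_pair, spinors_act] at h
  have h2 := congrArg (fun u => clifford (clifford ρ u) e) h
  rw [h2]
  simp only [map_sum, map_add, map_smul, LinearMap.sum_apply, LinearMap.add_apply,
    LinearMap.smul_apply]

omit [FiniteDimensional ℝ V] in
theorem coeff_eq_div (b : Module.Basis (Fin 6) ℝ V) {ν : V [⋀^Fin 6]→ₗ[ℝ] ℝ} (hν : ν ≠ 0)
    (τ : V [⋀^Fin 6]→ₗ[ℝ] ℝ) : coeff ν τ = τ b / ν b := by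
  have := Module.Finite.of_basis b
  have h6 : Module.finrank ℝ V = 6 := by rw [Module.finrank_eq_card_basis b, Fintype.card_fin]
  have hb : ν b ≠ 0 := (AlternatingMap.map_basis_ne_zero_iff b ν).2 hν
  rw [eq_div_iff hb, ← smul_eq_mul, ← AlternatingMap.smul_apply, coeff_smul h6 hν]

end

section
variable {V : Type*} [AddCommGroup V] [Module ℝ V] [FiniteDimensional ℝ V]
  [TopologicalSpace V] [IsTopologicalAddGroup V] [ContinuousSMul ℝ V] [T2Space V]
  {F : Type*} [AddCommGroup F] [Module ℝ F] [TopologicalSpace F] [ContinuousAdd F]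
  [ContinuousSMul ℝ F]

omit [TopologicalSpace V] [IsTopologicalAddGroup V] [ContinuousSMul ℝ V] [T2Space V]
  [TopologicalSpace F] [ContinuousAdd F] [ContinuousSMul ℝ F] [FiniteDimensional ℝ V] in
theorem alternating_apply_eq_sum {ι : Type*} [Fintype ι] (b : Module.Basis ι ℝ V) {k : ℕ}
    (α : V [⋀^Fin k]→ₗ[ℝ] F) (v : Fin k → V) :
    α v = ∑ s : Fin k → ι, (∏ i, b.repr (v i) (s i)) • α (fun i => b (s i)) := by
  classical
  have h : v = fun i => ∑ j, b.repr (v i) j • b j := by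
    funext i; rw [b.sum_repr]
  conv_lhs => rw [h]
  rw [← AlternatingMap.coe_multilinearMap, MultilinearMap.map_sum]
  refine Finset.sum_congr rfl fun s _ => ?_
  exact MultilinearMap.map_smul_univ (α : MultilinearMap ℝ (fun _ => V) F)
    (fun i => b.repr (v i) (s i)) (fun i => b (s i))

/-- Alternating maps on a finite-dimensional space are continuous. -/
def toContinuousAlternating {k : ℕ} (α : V [⋀^Fin k]→ₗ[ℝ] F) : V [⋀^Fin k]→L[ℝ] F :=
  { α with
    cont := by
      let b := Module.finBasis ℝ V
      have : (fun v => α v) =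
          fun v => ∑ s : Fin k → _, (∏ i, b.repr (v i) (s i)) • α (fun i => b (s i)) :=
        funext fun v => alternating_apply_eq_sum b α v
      change Continuous (fun v => α v)
      rw [this]
      refine continuous_finsetSum _ fun s _ => Continuous.smul ?_ continuous_const
      refine continuous_finsetProd _ fun i _ => ?_
      exact (LinearMap.continuous_of_finiteDimensional (b.coord (s i))).comp (continuous_apply i) }

end

section
variable {E : Type*} [NormedAddCommGroup E] [NormedSpace ℝ E] [FiniteDimensional ℝ E]
  {F : Type*} [NormedAddCommGroup F] [NormedSpace ℝ F]
  {P : Type*} [NormedAddCommGroup P] [NormedSpace ℝ P] {S : Set P}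

/-- A family of alternating maps on a finite-dimensional space is smooth if its values are. -/
theorem contDiffWithinAt_of_apply [FiniteDimensional ℝ F] {k : ℕ} {f : P → E [⋀^Fin k]→L[ℝ] F}
    {y : P} (h : ∀ v, ContDiffWithinAt ℝ ∞ (fun y => f y v) S y) :
    ContDiffWithinAt ℝ ∞ f S y := by
  let b := Module.finBasis ℝ E
  let ev : (E [⋀^Fin k]→L[ℝ] F) →ₗ[ℝ] ((Fin k → Fin (Module.finrank ℝ E)) → F) :=
    LinearMap.pi fun s => (ContinuousAlternatingMap.apply ℝ E F (fun i => b (s i))).toLinearMap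
  have hev : LinearMap.ker ev = ⊥ := by
    refine LinearMap.ker_eq_bot'.2 fun α hα => ?_
    ext v
    have h1 := alternating_apply_eq_sum b α.toAlternatingMap v
    refine h1.trans ?_
    have h2 : ∀ s : Fin k → _, α.toAlternatingMap (fun i => b (s i)) = 0 := fun s =>
      congrFun hα s
    simp [h2]
  obtain ⟨g, hg⟩ := ev.exists_leftInverse_of_injective hev
  have hf : f = fun y => (LinearMap.toContinuousLinearMap g) (fun s => f y (fun i => b (s i))) := by
    funext y
    exact (LinearMap.congr_fun hg (f y)).symm
  rw [hf]
  exact (LinearMap.toContinuousLinearMap g).contDiff.comp_contDiffWithinAt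
    (contDiffWithinAt_pi.2 fun s => h _)

theorem contDiffOn_of_apply [FiniteDimensional ℝ F] {k : ℕ} {f : P → E [⋀^Fin k]→L[ℝ] F}
    (h : ∀ v, ContDiffOn ℝ ∞ (fun y => f y v) S) : ContDiffOn ℝ ∞ f S :=
  fun y hy => contDiffWithinAt_of_apply fun v => h v y hy

omit [FiniteDimensional ℝ E] in
theorem _root_.ContDiffOn.alternating_apply {k : ℕ} {n : WithTop ℕ∞}
    {f : P → E [⋀^Fin k]→L[ℝ] F} (h : ContDiffOn ℝ n f S)
    (v : Fin k → E) : ContDiffOn ℝ n (fun y => f y v) S :=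
  (ContinuousAlternatingMap.apply ℝ E F v).contDiff.comp_contDiffOn h

/-- A family of mixed forms is smooth if its values are. -/
def SmoothFamily {V : Type*} [AddCommGroup V] [Module ℝ V] (S : Set P) (ρ : P → Mixed V ℝ) : Prop :=
  ∀ k v, ContDiffOn ℝ ∞ (fun y => ρ y k v) S

end

namespace SmoothFamily

variable {V : Type*} [AddCommGroup V] [Module ℝ V]
  {P : Type*} [NormedAddCommGroup P] [NormedSpace ℝ P] {S : Set P}
  {ρ ψ : P → Mixed V ℝ}

theorem add (hρ : SmoothFamily S ρ) (hψ : SmoothFamily S ψ) :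
    SmoothFamily S (fun y => ρ y + ψ y) := fun k v => (hρ k v).add (hψ k v)

theorem smul {f : P → ℝ} (hf : ContDiffOn ℝ ∞ f S) (hρ : SmoothFamily S ρ) :
    SmoothFamily S (fun y => f y • ρ y) := fun k v => hf.mul (hρ k v)

theorem sum {ι : Type*} {s : Finset ι} {ρ : ι → P → Mixed V ℝ}
    (hρ : ∀ i ∈ s, SmoothFamily S (ρ i)) : SmoothFamily S (fun y => ∑ i ∈ s, ρ i y) := fun k v => by
  have : (fun y => (∑ i ∈ s, ρ i y) k v) = fun y => ∑ i ∈ s, ρ i y k v := by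
    funext y
    rw [Finset.sum_apply, alternating_sum_apply]
  rw [this]
  exact ContDiffOn.sum fun i hi => hρ i hi k v

theorem clifford (hρ : SmoothFamily S ρ) (u : V × Module.Dual ℝ V) :
    SmoothFamily S (fun y => clifford (ρ y) u) := fun k v => by
  have h1 : ContDiffOn ℝ ∞ (fun y => interior (ρ y) u.1 k v) S := hρ (k + 1) (Fin.cons u.1 v)
  have h2 : ContDiffOn ℝ ∞ (fun y => exterior (ρ y) u.2 k v) S := by
    rcases k with _ | k
    · exact contDiffOn_const
    · simp only [exterior_succ_apply]
      exact ContDiffOn.sum fun i _ => contDiffOn_const.mul (contDiffOn_const.mul (hρ k _))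
  exact h1.add h2

theorem wedge (hρ : SmoothFamily S ρ) (hψ : SmoothFamily S ψ) {a b n : ℕ} (h : a + b = n)
    (v : Fin n → V) : ContDiffOn ℝ ∞ (fun y => wedge h (ρ y a) (ψ y b) v) S := by
  simp only [wedge_apply_eq_sum]
  exact contDiffOn_const.mul
    (ContDiffOn.sum fun σ _ => contDiffOn_const.mul ((hρ a _).mul (hψ b _)))

theorem pairing (hρ : SmoothFamily S ρ) (hψ : SmoothFamily S ψ) (v : Fin 6 → V) :
    ContDiffOn ℝ ∞ (fun y => pairing (ρ y) (ψ y) v) S := by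
  simp only [pairing_apply_eq_sum]
  exact ContDiffOn.sum fun k _ => contDiffOn_const.mul (hρ.wedge hψ _ v)

variable {ν : P → V [⋀^Fin 6]→ₗ[ℝ] ℝ} (hν : ∀ v, ContDiffOn ℝ ∞ (fun y => ν y v) S)
  (hν0 : ∀ y ∈ S, ν y ≠ 0) [FiniteDimensional ℝ V] (h6 : Module.finrank ℝ V = 6)
include hν hν0 h6

theorem coeff_pairing (hρ : SmoothFamily S ρ) (hψ : SmoothFamily S ψ) :
    ContDiffOn ℝ ∞ (fun y => coeff (ν y) (StableForm.pairing (ρ y) (ψ y))) S := by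
  let b := Module.finBasisOfFinrankEq ℝ V h6
  refine ((hρ.pairing hψ b).div (hν b) fun y hy => ?_).congr fun y hy =>
    coeff_eq_div b (hν0 y hy) _
  exact (AlternatingMap.map_basis_ne_zero_iff b (ν y)).2 (hν0 y hy)

theorem gradient (hρ : SmoothFamily S ρ) : SmoothFamily S (fun y => gradient h6 (ν y) (ρ y)) := by
  let b := Module.finBasisOfFinrankEq ℝ V h6
  obtain ⟨e, he⟩ := gradient_eq_sum h6 b
  simp only [he]
  refine SmoothFamily.sum fun i _ => SmoothFamily.add ?_ ?_
  · exact SmoothFamily.smul (coeff_pairing hν hν0 h6 (hρ.clifford _) (hρ.clifford _))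
      ((hρ.clifford _).clifford _)
  · exact SmoothFamily.smul (coeff_pairing hν hν0 h6 (hρ.clifford _) (hρ.clifford _))
      ((hρ.clifford _).clifford _)

theorem quartic {p : ZMod 2} (hρ : SmoothFamily S ρ) (hp : ∀ y ∈ S, HasParity p (ρ y)) :
    ContDiffOn ℝ ∞ (fun y => quartic (ν y) (ρ y)) S :=
  (contDiffOn_const.mul (coeff_pairing hν hν0 h6 hρ (hρ.gradient hν hν0 h6))).congr fun y hy =>
    quartic_eq_pair h6 (clifford_moment h6 (hν0 y hy) (hp y hy))

end SmoothFamily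

/-! ### Differential forms in charts -/

section
open Set Filter Topology

variable {M : Type*} [TopologicalSpace M] [ChartedSpace E6 M]
  {F : Type*} [NormedAddCommGroup F] [NormedSpace ℝ F] {k : ℕ}

/-- The differential of the inverse of the chart at `j`, between model spaces. -/
def chartDeriv (j : M) (y : E6) : E6 →L[ℝ] E6 :=
  mfderiv (𝓡 6) (𝓡 6) (chartAt E6 j).symm y

/-- The value of a form, as a form on the model space. -/
def Form.toModel (τ : Form M F k) (x : M) : E6 [⋀^Fin k]→L[ℝ] F := τ x

theorem Form.inChart_eq (τ : Form M F k) (j : M) (y : E6) : τ.inChart j y =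
    (τ.toModel ((chartAt E6 j).symm y)).compContinuousLinearMap (chartDeriv j y) := rfl

/-- The transition map from the chart at `i` to the chart at `j`. -/
def transition (i j : M) : E6 → E6 := chartAt E6 j ∘ (chartAt E6 i).symm

/-- The domain of the transition map. -/
def overlap (i j : M) : Set E6 :=
  (chartAt E6 i).target ∩ (chartAt E6 i).symm ⁻¹' (chartAt E6 j).source

theorem isOpen_overlap (i j : M) : IsOpen (overlap i j) :=
  (chartAt E6 i).isOpen_inter_preimage_symm (chartAt E6 j).open_source

theorem transition_mem {i j : M} {y : E6} (hy : y ∈ overlap i j) :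
    transition i j y ∈ (chartAt E6 j).target := (chartAt E6 j).map_source hy.2

theorem symm_transition {i j : M} {y : E6} (hy : y ∈ overlap i j) :
    (chartAt E6 j).symm (transition i j y) = (chartAt E6 i).symm y :=
  (chartAt E6 j).left_inv hy.2

theorem transition_mem_overlap {i j : M} {y : E6} (hy : y ∈ overlap i j) :
    transition i j y ∈ overlap j i :=
  ⟨transition_mem hy, by
    rw [mem_preimage, symm_transition hy]; exact (chartAt E6 i).map_target hy.1⟩

theorem transition_transition {i j : M} {y : E6} (hy : y ∈ overlap i j) :
    transition j i (transition i j y) = y := by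
  rw [transition, Function.comp_apply, symm_transition hy, (chartAt E6 i).right_inv hy.1]

theorem injOn_transition (i j : M) : InjOn (transition i j) (overlap i j) :=
  fun y hy z hz h => by rw [← transition_transition hy, h, transition_transition hz]

theorem image_transition (i j : M) : transition i j '' overlap i j = overlap j i := by
  ext z
  constructor
  · rintro ⟨y, hy, rfl⟩
    exact transition_mem_overlap hy
  · intro hz
    exact ⟨transition j i z, transition_mem_overlap hz, transition_transition hz⟩

variable [IsManifold (𝓡 6) ∞ M]

theorem contDiffOn_transition (i j : M) : ContDiffOn ℝ ∞ (transition i j) (overlap i j) := by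
  have h1 : ContMDiffOn (𝓡 6) (𝓡 6) ∞ (chartAt E6 i).symm (chartAt E6 i).target :=
    contMDiffOn_chart_symm
  have h2 : ContMDiffOn (𝓡 6) (𝓡 6) ∞ (chartAt E6 j) (chartAt E6 j).source := contMDiffOn_chart
  exact contMDiffOn_iff_contDiffOn.1
    (h2.comp (h1.mono inter_subset_left) fun y hy => hy.2)

theorem contDiffAt_transition {i j : M} {y : E6} (hy : y ∈ overlap i j) :
    ContDiffAt ℝ ∞ (transition i j) y :=
  (contDiffOn_transition i j).contDiffAt ((isOpen_overlap i j).mem_nhds hy)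

theorem hasFDerivAt_transition {i j : M} {y : E6} (hy : y ∈ overlap i j) :
    HasFDerivAt (transition i j) (fderiv ℝ (transition i j) y) y :=
  ((contDiffAt_transition hy).differentiableAt (by simp)).hasFDerivAt

theorem hasMFDerivAt_symm {j : M} {y : E6} (hy : y ∈ (chartAt E6 j).target) :
    HasMFDerivAt (𝓡 6) (𝓡 6) (chartAt E6 j).symm y (chartDeriv j y) :=
  have : IsManifold (𝓡 6) 1 M := IsManifold.of_le (n := ∞) (by simp)
  ((mdifferentiable_chart (I := 𝓡 6) j).mdifferentiableAt_symm hy).hasMFDerivAt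

theorem chartDeriv_eq {i j : M} {y : E6} (hy : y ∈ overlap i j) :
    chartDeriv i y = chartDeriv j (transition i j y) ∘L fderiv ℝ (transition i j) y := by
  have h1 := (hasMFDerivAt_symm (transition_mem hy)).comp y
    (hasMFDerivAt_iff_hasFDerivAt.2 (hasFDerivAt_transition hy))
  have h2 : (chartAt E6 i).symm =ᶠ[𝓝 y] (chartAt E6 j).symm ∘ transition i j :=
    ((isOpen_overlap i j).mem_nhds hy |> eventually_of_mem) fun z hz => (symm_transition hz).symm
  exact hasMFDerivAt_unique (hasMFDerivAt_symm hy.1) (h1.congr_of_eventuallyEq h2)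

theorem chartDeriv_bijective {j : M} {y : E6} (hy : y ∈ (chartAt E6 j).target) :
    Function.Bijective (chartDeriv j y) :=
  have : IsManifold (𝓡 6) 1 M := IsManifold.of_le (n := ∞) (by simp)
  (mdifferentiable_chart (I := 𝓡 6) j).symm.mfderiv_bijective hy

/-- Change of charts. -/
theorem Form.inChart_eq_pullback (τ : Form M F k) {i j : M} {y : E6} (hy : y ∈ overlap i j) :
    τ.inChart i y = (τ.inChart j (transition i j y)).compContinuousLinearMap
      (fderiv ℝ (transition i j) y) := by
  rw [τ.inChart_eq, τ.inChart_eq, symm_transition hy, chartDeriv_eq hy]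
  rfl

theorem Form.inChart_eventuallyEq (τ : Form M F k) {i j : M} {y : E6} (hy : y ∈ overlap i j) :
    τ.inChart i =ᶠ[𝓝 y] fun z => (τ.inChart j (transition i j z)).compContinuousLinearMap
      (fderiv ℝ (transition i j) z) :=
  eventually_of_mem ((isOpen_overlap i j).mem_nhds hy) fun _ hz => τ.inChart_eq_pullback hz

/-- A form vanishes at a point if it does in a chart. -/
theorem Form.apply_eq_zero (τ : Form M F k) {j : M} {y : E6} (hy : y ∈ (chartAt E6 j).target)
    (h : τ.inChart j y = 0) : τ ((chartAt E6 j).symm y) = 0 := by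
  refine ContinuousAlternatingMap.ext fun v => ?_
  choose w hw using fun i => (chartDeriv_bijective hy).2 (v i)
  have := congrArg (fun f => f w) h
  rw [τ.inChart_eq] at this
  have h2 : (τ.toModel ((chartAt E6 j).symm y)) (fun i => chartDeriv j y (w i)) = 0 := this
  rw [funext hw] at h2
  exact h2

theorem Form.eq_zero_of_inChart (τ : Form M F k)
    (h : ∀ j, ∀ y ∈ (chartAt E6 j).target, τ.inChart j y = 0) : τ = 0 := by
  funext x
  have := τ.apply_eq_zero ((chartAt E6 x).map_source (mem_chart_source E6 x))
    (h x _ ((chartAt E6 x).map_source (mem_chart_source E6 x)))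
  rw [(chartAt E6 x).left_inv (mem_chart_source E6 x)] at this
  exact this

/-- Alternating maps can be pulled back smoothly. -/
theorem contDiffAt_compContinuousLinearMap [FiniteDimensional ℝ F] {y : E6}
    {f : E6 → E6 [⋀^Fin k]→L[ℝ] F} {A : E6 → E6 →L[ℝ] E6} (hf : ContDiffAt ℝ ∞ f y)
    (hA : ContDiffAt ℝ ∞ A y) :
    ContDiffAt ℝ ∞ (fun y => (f y).compContinuousLinearMap (A y)) y := by
  refine contDiffWithinAt_of_apply fun v => ?_
  rw [contDiffWithinAt_univ]
  let b := (EuclideanSpace.basisFun (Fin 6) ℝ).toBasis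
  have : (fun y => (f y).compContinuousLinearMap (A y) v) = fun y =>
      ∑ s : Fin k → Fin 6, (∏ i, b.repr (A y (v i)) (s i)) • f y (fun i => b (s i)) :=
    funext fun y => alternating_apply_eq_sum b (f y).toAlternatingMap _
  rw [this]
  refine ContDiffAt.sum fun s _ => ContDiffAt.smul (contDiffAt_prod fun i _ => ?_)
    ((ContinuousAlternatingMap.apply ℝ E6 F (fun i => b (s i))).contDiff.contDiffAt.comp y hf)
  exact (LinearMap.toContinuousLinearMap (b.coord (s i))).contDiff.contDiffAt.comp y
    (hA.clm_apply contDiffAt_const)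

/-- Smoothness can be checked in one chart around each point. -/
theorem Form.isSmooth_of_local [FiniteDimensional ℝ F] (τ : Form M F k)
    (h : ∀ x, ∃ j, x ∈ (chartAt E6 j).source ∧ ContDiffAt ℝ ∞ (τ.inChart j) (chartAt E6 j x)) :
    τ.IsSmooth := by
  intro i y hy
  obtain ⟨j, hj, hτ⟩ := h ((chartAt E6 i).symm y)
  have hov : y ∈ overlap i j := ⟨hy, hj⟩
  have hτ' : ContDiffAt ℝ ∞ (τ.inChart j) (transition i j y) := hτ
  refine ContDiffAt.contDiffWithinAt ?_
  refine ContDiffAt.congr_of_eventuallyEq ?_ (τ.inChart_eventuallyEq hov)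
  exact contDiffAt_compContinuousLinearMap (hτ'.comp y (contDiffAt_transition hov))
    ((contDiffAt_transition hov).fderiv_right (by simp))

/-- The exterior derivative can be computed in any chart. -/
theorem Form.inChart_d {τ : Form M F k} (hτ : τ.IsSmooth) {j : M} {y : E6}
    (hy : y ∈ (chartAt E6 j).target) : τ.d.inChart j y = extDeriv (τ.inChart j) y := by
  set x := (chartAt E6 j).symm y with hx
  have hov : y ∈ overlap j x := ⟨hy, mem_chart_source E6 x⟩
  have h1 := (τ.inChart_eventuallyEq hov).extDeriv_eq
  have h2 : DifferentiableAt ℝ (τ.inChart x) (transition j x y) :=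
    ((hτ x).contDiffAt
      ((chartAt E6 x).open_target.mem_nhds (transition_mem hov))).differentiableAt (by simp)
  rw [h1, extDeriv_pullback h2 (contDiffAt_transition hov)
    (by
      rw [minSmoothness_of_isRCLikeNormedField]
      exact WithTop.coe_le_coe.2 (le_top : (2 : ℕ∞) ≤ ⊤))]
  rw [Form.inChart_eq]
  have h3 : (τ.d).toModel x = (extDeriv (τ.inChart x) (transition j x y)).compContinuousLinearMap
    (mfderiv (𝓡 6) (𝓡 6) (chartAt E6 x) x) := rfl
  rw [← hx, h3]
  have : IsManifold (𝓡 6) 1 M := IsManifold.of_le (n := ∞) (by simp)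
  have h4 := ((mdifferentiable_chart (I := 𝓡 6) x).mdifferentiableAt hov.2).hasMFDerivAt.comp y
    (hasMFDerivAt_symm hy)
  let D : E6 →L[ℝ] E6 := mfderiv (𝓡 6) (𝓡 6) (chartAt E6 x) x
  have h5 : HasFDerivAt (transition j x) (D ∘L chartDeriv j y) y :=
    hasMFDerivAt_iff_hasFDerivAt.1 h4
  ext v
  change extDeriv (τ.inChart x) (transition j x y) _ = extDeriv (τ.inChart x) (transition j x y) _
  congr 1
  funext l
  exact (DFunLike.congr_fun h5.fderiv (v l)).symm

end

/-! ### Mixed forms in charts and the smoothness of `ρ̂` -/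

section
open Set Filter Topology

theorem finrank_E6 : Module.finrank ℝ E6 = 6 := by simp

variable {M : Type*} [TopologicalSpace M] [ChartedSpace E6 M]

theorem finrank_tangentSpace (x : M) : Module.finrank ℝ (TangentSpace (𝓡 6) x) = 6 := finrank_E6

/-- The expression of a mixed form in the chart at `j`, at `y`. -/
def MixedForm.inChart (ρ : MixedForm M ℝ) (j : M) (y : E6) : Mixed E6 ℝ :=
  fun k => ((ρ k).inChart j y).toAlternatingMap

theorem MixedForm.IsSmooth.smoothFamily {ρ : MixedForm M ℝ} (hρ : ρ.IsSmooth) (j : M) :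
    SmoothFamily (chartAt E6 j).target (ρ.inChart j) :=
  fun k v => (hρ k j).alternating_apply v

theorem MixedForm.HasParity.at {p : ZMod 2} {ρ : MixedForm M ℝ} (h : ρ.HasParity p) (x : M) :
    StableForm.HasParity p (ρ.at x) := fun k hk => by
  have : ρ k = 0 := h k hk
  ext v
  rw [MixedForm.at, this]; rfl

theorem MixedForm.HasParity.inChart {p : ZMod 2} {ρ : MixedForm M ℝ} (h : ρ.HasParity p) (j : M)
    (y : E6) : StableForm.HasParity p (ρ.inChart j y) := fun k hk => by
  have : ρ k = 0 := h k hk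
  ext v
  rw [MixedForm.inChart, this]; rfl

/-- The pairing of two mixed forms on `M`, as a multiple of the volume form `ν`. -/
def pairingForm (ν : Form M ℝ 6) (ρ ψ : MixedForm M ℝ) : Form M ℝ 6 := fun x =>
  coeff (ν x).toAlternatingMap (pairing (ρ.at x) (ψ.at x)) • ν x

variable [IsManifold (𝓡 6) ∞ M]

/-- The differential of the inverse of a chart, as an isomorphism. -/
def chartEquiv (j : M) {y : E6} (hy : y ∈ (chartAt E6 j).target) :
    E6 ≃ₗ[ℝ] TangentSpace (𝓡 6) ((chartAt E6 j).symm y) :=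
  LinearEquiv.ofBijective (mfderiv (𝓡 6) (𝓡 6) (chartAt E6 j).symm y ∘L
      (NormedSpace.fromTangentSpace y).symm.toContinuousLinearMap).toLinearMap
    (chartDeriv_bijective hy)

variable {j : M} {y : E6} (hy : y ∈ (chartAt E6 j).target)

theorem MixedForm.inChart_eq_pull (ρ : MixedForm M ℝ) :
    ρ.inChart j y = pull (chartEquiv j hy).toLinearMap (ρ.at ((chartAt E6 j).symm y)) := rfl

theorem Form.inChart_eq_comp {k : ℕ} (τ : Form M ℝ k) : (τ.inChart j y).toAlternatingMap =
    (τ ((chartAt E6 j).symm y)).toAlternatingMap.compLinearMap (chartEquiv j hy).toLinearMap := rfl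

theorem toAlternatingMap_ne_zero {V : Type*} [AddCommGroup V] [Module ℝ V] [TopologicalSpace V]
    {k : ℕ} {τ : V [⋀^Fin k]→L[ℝ] ℝ} (h : τ ≠ 0) : τ.toAlternatingMap ≠ 0 := fun h0 =>
  h (ContinuousAlternatingMap.toAlternatingMap_injective h0)

include hy

theorem inChart_ne_zero {ν : Form M ℝ 6} (hν : ∀ x, ν x ≠ 0) :
    (ν.inChart j y).toAlternatingMap ≠ 0 := by
  rw [Form.inChart_eq_comp hy]
  exact compLinearMap_ne_zero (toAlternatingMap_ne_zero (hν _)) _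

theorem inChart_apply_basis_ne_zero {ν : Form M ℝ 6} (hν : ∀ x, ν x ≠ 0) :
    ν.inChart j y (EuclideanSpace.basisFun (Fin 6) ℝ) ≠ 0 := by
  have := (AlternatingMap.map_basis_ne_zero_iff (EuclideanSpace.basisFun (Fin 6) ℝ).toBasis
    (ν.inChart j y).toAlternatingMap).2 (inChart_ne_zero hy hν)
  rw [OrthonormalBasis.coe_toBasis] at this
  exact this

theorem quartic_inChart {ν : Form M ℝ 6} (hν : ∀ x, ν x ≠ 0) {p : ZMod 2} {ρ : MixedForm M ℝ}
    (hp : ρ.HasParity p) : quartic (ν.inChart j y).toAlternatingMap (ρ.inChart j y) =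
      quartic (ν ((chartAt E6 j).symm y)).toAlternatingMap (ρ.at ((chartAt E6 j).symm y)) := by
  rw [Form.inChart_eq_comp hy, ρ.inChart_eq_pull hy]
  exact quartic_pull (finrank_tangentSpace _) finrank_E6 (toAlternatingMap_ne_zero (hν _)) _
    (hp.at _)

theorem pairingForm_inChart {ν : Form M ℝ 6} (hν : ∀ x, ν x ≠ 0) (ρ ψ : MixedForm M ℝ)
    (v : Fin 6 → E6) : (pairingForm ν ρ ψ).inChart j y v =
      pairing (ρ.inChart j y) (ψ.inChart j y) v := by
  have h := coeff_smul (finrank_tangentSpace _) (toAlternatingMap_ne_zero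
    (hν ((chartAt E6 j).symm y))) (pairing (ρ.at ((chartAt E6 j).symm y))
      (ψ.at ((chartAt E6 j).symm y)))
  have h3 : (pairingForm ν ρ ψ).inChart j y v =
      (coeff (ν ((chartAt E6 j).symm y)).toAlternatingMap (pairing (ρ.at ((chartAt E6 j).symm y))
        (ψ.at ((chartAt E6 j).symm y))) • (ν ((chartAt E6 j).symm y)).toAlternatingMap)
          (fun i => chartEquiv j hy (v i)) := rfl
  rw [ρ.inChart_eq_pull hy, ψ.inChart_eq_pull hy, pairing_pull, h3, h,
    AlternatingMap.compLinearMap_apply]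
  simp only [LinearEquiv.coe_coe]

omit hy

variable {p : ZMod 2} {ν : Form M ℝ 6} {ρ : MixedForm M ℝ}

omit [IsManifold (𝓡 6) ∞ M] in
theorem isHat_hat (hν : ∀ x, ν x ≠ 0) (hp : ρ.HasParity p) (hs : IsStable ν ρ) (x : M) :
    IsHat p (ν x).toAlternatingMap (ρ.at x) ((hat p ν ρ).at x) := by
  have h6 := finrank_tangentSpace x
  have hν' := toAlternatingMap_ne_zero (hν x)
  obtain ⟨ψ, h0⟩ : ∃ ψ, IsHat p (ν x).toAlternatingMap (ρ.at x) ψ :=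
    ⟨_, isHat_of_quartic_neg h6 (hp.at x) (hs x) (clifford_moment h6 hν' (hp.at x))⟩
  -- `hat` only considers continuous alternating maps, which is no restriction in finite dimension.
  have hT2 : T2Space (TangentSpace (𝓡 6) x) := inferInstanceAs (T2Space E6)
  have h : ∃ ψ : (k : ℕ) → TangentSpace (𝓡 6) x [⋀^Fin k]→L[ℝ] ℝ,
      IsHat p (ν x).toAlternatingMap (ρ.at x) (fun k => (ψ k).toAlternatingMap) :=
    ⟨fun k => toContinuousAlternating (ψ k), h0⟩
  have h1 : (hat p ν ρ).at x = fun k => (h.choose k).toAlternatingMap := by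
    funext k
    rw [MixedForm.at, hat, dif_pos h]
  rw [h1]
  exact h.choose_spec

omit [IsManifold (𝓡 6) ∞ M] in
theorem hat_hasParity (hν : ∀ x, ν x ≠ 0) (hp : ρ.HasParity p) (hs : IsStable ν ρ) :
    (hat p ν ρ).HasParity p := fun k hk => by
  funext x
  exact ContinuousAlternatingMap.toAlternatingMap_injective ((isHat_hat hν hp hs x).1 k hk)

theorem isHat_inChart (hν : ∀ x, ν x ≠ 0) (hp : ρ.HasParity p) (hs : IsStable ν ρ)
    (hy : y ∈ (chartAt E6 j).target) :
    IsHat p (ν.inChart j y).toAlternatingMap (ρ.inChart j y) ((hat p ν ρ).inChart j y) := by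
  rw [Form.inChart_eq_comp hy, ρ.inChart_eq_pull hy, MixedForm.inChart_eq_pull hy]
  exact (isHat_hat hν hp hs _).pull (finrank_tangentSpace _) finrank_E6
    (toAlternatingMap_ne_zero (hν _)) _

/-- An explicit formula for `ρ̂` in a chart. -/
theorem hat_inChart (hν : ∀ x, ν x ≠ 0) (hp : ρ.HasParity p) (hs : IsStable ν ρ)
    (hy : y ∈ (chartAt E6 j).target) : (hat p ν ρ).inChart j y =
      (√(-(coeff (ν.inChart j y).toAlternatingMap (pairing (ρ.inChart j y)
        (gradient finrank_E6 (ν.inChart j y).toAlternatingMap (ρ.inChart j y))) / 2)))⁻¹ •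
      gradient finrank_E6 (ν.inChart j y).toAlternatingMap (ρ.inChart j y) :=
  (isHat_inChart hν hp hs hy).eq finrank_E6
    (clifford_moment finrank_E6 (inChart_ne_zero hy hν) (hp.inChart j y))

theorem hat_isSmooth (hν : ν.IsVolumeForm) (hρ : ρ.IsSmooth) (hp : ρ.HasParity p)
    (hs : IsStable ν ρ) : (hat p ν ρ).IsSmooth := by
  intro k j
  refine contDiffOn_of_apply fun v => ?_
  have hν' : ∀ v, ContDiffOn ℝ ∞ (fun y => (ν.inChart j y).toAlternatingMap v)
      (chartAt E6 j).target := fun v => (hν.isSmooth j).alternating_apply v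
  have hν0 : ∀ y ∈ (chartAt E6 j).target, (ν.inChart j y).toAlternatingMap ≠ 0 := fun y hy =>
    inChart_ne_zero hy hν.ne_zero
  have h1 := hρ.smoothFamily j
  have h2 := h1.gradient hν' hν0 finrank_E6
  have h3 := SmoothFamily.coeff_pairing hν' hν0 finrank_E6 h1 h2
  have hneg : ∀ y ∈ (chartAt E6 j).target, 0 < -(coeff (ν.inChart j y).toAlternatingMap
      (pairing (ρ.inChart j y)
        (gradient finrank_E6 (ν.inChart j y).toAlternatingMap (ρ.inChart j y))) / 2) := by
    intro y hy
    have h4 := hs ((chartAt E6 j).symm y)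
    rw [← quartic_inChart hy hν.ne_zero hp, quartic_eq_pair finrank_E6
      (clifford_moment finrank_E6 (hν0 y hy) (hp.inChart j y))] at h4
    linarith
  have h5 := ((h3.div_const 2).neg.sqrt fun y hy => (hneg y hy).ne').inv fun y hy =>
    (Real.sqrt_pos.2 (hneg y hy)).ne'
  refine ((h2.smul h5) k v).congr fun y hy => ?_
  exact congrArg (fun φ : Mixed E6 ℝ => φ k v) (hat_inChart hν.ne_zero hp hs hy)

end

/-! ### Integration of six-forms -/

section
open Set Filter Topology MeasureTheory

variable {M : Type*} [TopologicalSpace M] [ChartedSpace E6 M]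

/-- The density of a `6`-form in a chart, with respect to the orientation given by `ν`. -/
def density (ν τ : Form M ℝ 6) (j : M) (y : E6) : ℝ :=
  (SignType.sign (ν.inChart j y (EuclideanSpace.basisFun (Fin 6) ℝ)) : ℝ) *
    τ.inChart j y (EuclideanSpace.basisFun (Fin 6) ℝ)

/-- The integral of a `6`-form over the domain of a chart. -/
def chartIntegral (ν τ : Form M ℝ 6) (j : M) : ℝ :=
  ∫ y in (chartAt E6 j).target, density ν τ j y

theorem density_eq_zero {ν τ : Form M ℝ 6} {j : M} {y : E6}
    (h : τ ((chartAt E6 j).symm y) = 0) : density ν τ j y = 0 := by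
  have : τ.inChart j y = 0 := by
    rw [Form.inChart, h]; rfl
  rw [density, this]
  exact mul_zero _

theorem density_smul (ν τ : Form M ℝ 6) (f : M → ℝ) (j : M) (y : E6) :
    density ν (fun x => f x • τ x) j y = f ((chartAt E6 j).symm y) * density ν τ j y :=
  mul_left_comm _ _ _

theorem apply_compContinuousLinearMap_basis (τ : E6 [⋀^Fin 6]→L[ℝ] ℝ) (A : E6 →L[ℝ] E6) :
    τ.compContinuousLinearMap A (EuclideanSpace.basisFun (Fin 6) ℝ) =
      A.det * τ (EuclideanSpace.basisFun (Fin 6) ℝ) := by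
  let b := (EuclideanSpace.basisFun (Fin 6) ℝ).toBasis
  have hb : ⇑b = EuclideanSpace.basisFun (Fin 6) ℝ := OrthonormalBasis.coe_toBasis _
  have h1 := AlternatingMap.eq_smul_basis_det b τ.toAlternatingMap
  have h2 := congrArg (fun f => f (A ∘ b)) h1
  rw [AlternatingMap.smul_apply] at h2
  have h3 : b.det (A ∘ b) = LinearMap.det (A : E6 →ₗ[ℝ] E6) * b.det b :=
    b.det_comp (A : E6 →ₗ[ℝ] E6) b
  rw [h3, b.det_self, mul_one, smul_eq_mul, mul_comm] at h2
  rw [hb] at h2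
  exact h2

variable [IsManifold (𝓡 6) ∞ M]

/-- Densities transform with the absolute value of the Jacobian: its sign is absorbed by the
orientation sign of the charts. -/
theorem density_transition (ν τ : Form M ℝ 6) {i j : M} {y : E6} (hy : y ∈ overlap i j) :
    density ν τ i y =
      |(fderiv ℝ (transition i j) y).det| * density ν τ j (transition i j y) := by
  rw [density, density, ν.inChart_eq_pullback hy, τ.inChart_eq_pullback hy,
    apply_compContinuousLinearMap_basis, apply_compContinuousLinearMap_basis, sign_mul]
  rw [SignType.coe_mul, ← sign_mul_self]
  ring

/-- The integral of a form supported in two charts can be computed in either of them. -/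
theorem chartIntegral_eq (ν : Form M ℝ 6) {τ : Form M ℝ 6} {i j : M}
    (h : ∀ x, x ∉ (chartAt E6 i).source ∩ (chartAt E6 j).source → τ x = 0) :
    chartIntegral ν τ i = chartIntegral ν τ j := by
  have h1 : ∀ i j : M, (∀ x, x ∉ (chartAt E6 i).source ∩ (chartAt E6 j).source → τ x = 0) →
      chartIntegral ν τ i = ∫ y in overlap i j, density ν τ i y := fun i j h => by
    refine setIntegral_eq_of_subset_of_forall_sdiff_eq_zero
      (chartAt E6 i).open_target.measurableSet inter_subset_left fun y hy => ?_
    exact density_eq_zero (h _ fun hx => hy.2 ⟨hy.1, hx.2⟩)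
  rw [h1 i j h, h1 j i fun x hx => h x fun h2 => hx h2.symm, ← image_transition i j,
    integral_image_eq_integral_abs_det_fderiv_smul volume (isOpen_overlap i j).measurableSet
      (fun y hy => (hasFDerivAt_transition hy).hasFDerivWithinAt) (injOn_transition i j)]
  exact setIntegral_congr_fun (isOpen_overlap i j).measurableSet fun y hy =>
    density_transition ν τ hy

variable [CompactSpace M] [T2Space M]

theorem partition_subordinate : (partition M).IsSubordinate fun x => (chartAt E6 x).source :=
  (SmoothPartitionOfUnity.exists_isSubordinate_chartAt_source (𝓡 6) M).choose_spec

variable (M) in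
/-- The finite set of indices of the nonzero functions of the partition of unity. -/
def indices : Finset M :=
  ((partition M).locallyFinite.finite_nonempty_of_compact).toFinset

theorem partition_eq_zero {i : M} (hi : i ∉ indices M) (x : M) : partition M i x = 0 := by
  by_contra h
  exact hi ((Finite.mem_toFinset _).2 ⟨x, h⟩)

theorem sum_partition (x : M) : ∑ i ∈ indices M, partition M i x = 1 := by
  rw [← (partition M).sum_eq_one (mem_univ x)]
  refine (finsum_eq_sum_of_support_subset _ fun i hi => ?_).symm
  by_contra h
  exact hi (partition_eq_zero h x)

theorem integral_eq_sum (ν τ : Form M ℝ 6) : integral ν τ = ∑ i ∈ indices M,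
    ∫ y in (chartAt E6 i).target, partition M i ((chartAt E6 i).symm y) * density ν τ i y := by
  rw [integral, finsum_eq_sum_of_support_subset (s := indices M)]
  · simp only [density, mul_assoc]
  · intro i hi
    by_contra h
    refine hi ?_
    simp [partition_eq_zero h]

omit [CompactSpace M] [T2Space M] [IsManifold (𝓡 6) ∞ M] [ChartedSpace E6 M]
  [TopologicalSpace M] in
theorem integrableOn_of_eq_zero {U K : Set E6} (hU : IsOpen U) (hK : IsCompact K) (hKU : K ⊆ U)
    {f : E6 → ℝ} (hf : ContinuousOn f U) (h0 : ∀ y ∈ U \ K, f y = 0) : IntegrableOn f U :=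
  ((hf.mono hKU).integrableOn_compact hK).of_forall_sdiff_eq_zero hU.measurableSet h0

omit [CompactSpace M] [T2Space M] [IsManifold (𝓡 6) ∞ M] in
theorem isCompact_image_chart {K : Set M} (hK : IsCompact K) {j : M}
    (hKj : K ⊆ (chartAt E6 j).source) : IsCompact (chartAt E6 j '' K) :=
  hK.image_of_continuousOn ((chartAt E6 j).continuousOn.mono hKj)

omit [CompactSpace M] [T2Space M] [IsManifold (𝓡 6) ∞ M] in
theorem image_chart_subset {K : Set M} {j : M} (hKj : K ⊆ (chartAt E6 j).source) :
    chartAt E6 j '' K ⊆ (chartAt E6 j).target := by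
  rintro _ ⟨x, hx, rfl⟩
  exact (chartAt E6 j).map_source (hKj hx)

omit [CompactSpace M] [T2Space M] [IsManifold (𝓡 6) ∞ M] in
theorem symm_notMem {K : Set M} {j : M} {y : E6}
    (hy : y ∈ (chartAt E6 j).target \ chartAt E6 j '' K) : (chartAt E6 j).symm y ∉ K :=
  fun h => hy.2 ⟨_, h, (chartAt E6 j).right_inv hy.1⟩

theorem integrableOn_partition_mul (i : M) {g : E6 → ℝ}
    (hg : ContinuousOn g (chartAt E6 i).target) :
    IntegrableOn (fun y => partition M i ((chartAt E6 i).symm y) * g y) (chartAt E6 i).target := by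
  have hK := partition_subordinate i
  refine integrableOn_of_eq_zero (chartAt E6 i).open_target
    (isCompact_image_chart (isClosed_tsupport _).isCompact hK) (image_chart_subset hK)
    (((partition M i).contMDiff.continuous.comp_continuousOn
      (chartAt E6 i).continuousOn_symm).mul hg) fun y hy => ?_
  rw [image_eq_zero_of_notMem_tsupport (symm_notMem hy), zero_mul]

/-- The integral of a form supported in a chart can be computed in that chart. -/
theorem integral_eq_chartIntegral {ν τ : Form M ℝ 6} {j : M}
    (h : ∀ x, x ∉ (chartAt E6 j).source → τ x = 0)
    (hτ : IntegrableOn (density ν τ j) (chartAt E6 j).target) :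
    integral ν τ = chartIntegral ν τ j := by
  rw [integral_eq_sum]
  have h1 : ∀ i ∈ indices M, ∫ y in (chartAt E6 i).target,
      partition M i ((chartAt E6 i).symm y) * density ν τ i y =
      ∫ y in (chartAt E6 j).target,
        partition M i ((chartAt E6 j).symm y) * density ν τ j y := fun i _ => by
    simp only [← density_smul]
    refine chartIntegral_eq ν fun x hx => ?_
    by_cases hx' : x ∈ (chartAt E6 j).source
    · have : partition M i x = 0 :=
        image_eq_zero_of_notMem_tsupport fun h => hx ⟨partition_subordinate i h, hx'⟩
      simp [this]
    · simp [h x hx']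
  rw [Finset.sum_congr rfl h1, chartIntegral, ← integral_finsetSum]
  · simp only [← Finset.sum_mul, sum_partition, one_mul]
  · intro i _
    refine hτ.bdd_mul (c := 1) ?_ ?_
    · exact ((partition M i).contMDiff.continuous.comp_continuousOn
        (chartAt E6 j).continuousOn_symm).aestronglyMeasurable
        (chartAt E6 j).open_target.measurableSet
    · refine Eventually.of_forall fun y => ?_
      rw [Real.norm_eq_abs, abs_of_nonneg ((partition M).nonneg i _)]
      exact (partition M).le_one i _

end

/-! ### The Leibniz rule for the pairing -/

section
open Set Filter Topology MeasureTheory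

/-- The integral of a derivative of a compactly supported function vanishes. -/
theorem setIntegral_fderiv_eq_zero {U K : Set E6} (hU : IsOpen U) (hK : IsCompact K) (hKU : K ⊆ U)
    {f : E6 → ℝ} (hf : ContDiffOn ℝ 1 f U) (h0 : ∀ y ∈ U \ K, f y = 0) (v : E6) :
    IntegrableOn (fun y => fderiv ℝ f y v) U ∧ ∫ y in U, fderiv ℝ f y v = 0 := by
  classical
  let g := U.indicator f
  have hgf : ∀ y ∈ U, g =ᶠ[𝓝 y] f := fun y hy =>
    eventually_of_mem (hU.mem_nhds hy) fun z hz => indicator_of_mem hz f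
  have hg0 : ∀ y ∉ K, g =ᶠ[𝓝 y] fun _ => 0 := fun y hy =>
    eventually_of_mem (hK.isClosed.isOpen_compl.mem_nhds hy) fun z hz => by
      by_cases hzU : z ∈ U
      · exact (indicator_of_mem hzU f).trans (h0 z ⟨hzU, hz⟩)
      · exact indicator_of_notMem hzU f
  have hg : ContDiff ℝ 1 g := contDiff_iff_contDiffAt.2 fun y => by
    by_cases hy : y ∈ K
    · exact (hf.contDiffAt (hU.mem_nhds (hKU hy))).congr_of_eventuallyEq (hgf y (hKU hy))
    · exact contDiffAt_const.congr_of_eventuallyEq (hg0 y hy)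
  have hsupp : HasCompactSupport g := HasCompactSupport.intro hK fun y hy => (hg0 y hy).eq_of_nhds
  have hg' : Continuous fun y => fderiv ℝ g y v :=
    (hg.continuous_fderiv (by simp)).clm_apply continuous_const
  have hsupp' : HasCompactSupport fun y => fderiv ℝ g y v :=
    HasCompactSupport.intro hK fun y hy => by
      rw [(hg0 y hy).fderiv_eq, fderiv_fun_const]; rfl
  have hint : Integrable fun y => fderiv ℝ g y v := hg'.integrable_of_hasCompactSupport hsupp'
  have hcongr : EqOn (fun y => fderiv ℝ g y v) (fun y => fderiv ℝ f y v) U := fun y hy => by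
    change fderiv ℝ g y v = fderiv ℝ f y v
    rw [(hgf y hy).fderiv_eq]
  refine ⟨hint.integrableOn.congr_fun hcongr hU.measurableSet, ?_⟩
  rw [← setIntegral_congr_fun hU.measurableSet hcongr,
    setIntegral_eq_integral_of_forall_compl_eq_zero fun y hy => ?_]
  · have h1 := integral_mul_fderiv_eq_neg_fderiv_mul_of_integrable (μ := volume) (𝕜 := ℝ)
      (f := fun _ : E6 => (1 : ℝ)) (g := g) (v := v) ?_ ?_ ?_ (fun _ _ => by fun_prop)
      (fun x _ => hg.differentiable (by simp) x)
    · simpa using h1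
    · simp
    · simpa using hint
    · simpa using hg.continuous.integrable_of_hasCompactSupport hsupp
  · rw [(hg0 y fun h => hy (hKU h)).fderiv_eq, fderiv_fun_const]; rfl

theorem fderiv_apply_eq_of_hasDerivAt {g : E6 → ℝ} {y w : E6} {c : ℝ} (hg : DifferentiableAt ℝ g y)
    (hc : HasDerivAt (fun t : ℝ => g (y + t • w)) c 0) : fderiv ℝ g y w = c :=
  HasDerivAt.unique (hg.hasFDerivAt.hasLineDerivAt w) hc

section
variable {V : Type*} [AddCommGroup V] [Module ℝ V] {ρ ψ : ℝ → Mixed V ℝ} {ρ' ψ' : Mixed V ℝ} {t : ℝ}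

theorem hasDerivAt_wedge (hρ : ∀ k v, HasDerivAt (fun t => ρ t k v) (ρ' k v) t)
    (hψ : ∀ k v, HasDerivAt (fun t => ψ t k v) (ψ' k v) t) {a b n : ℕ} (h : a + b = n)
    (v : Fin n → V) : HasDerivAt (fun t => wedge h (ρ t a) (ψ t b) v)
      (wedge h (ρ' a) (ψ t b) v + wedge h (ρ t a) (ψ' b) v) t := by
  simp only [wedge_apply_eq_sum]
  rw [← mul_add, ← Finset.sum_add_distrib]
  refine (HasDerivAt.fun_sum fun σ _ => ?_).const_mul _
  rw [← mul_add]
  exact ((hρ a _).mul (hψ b _)).const_mul _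

theorem hasDerivAt_pairing (hρ : ∀ k v, HasDerivAt (fun t => ρ t k v) (ρ' k v) t)
    (hψ : ∀ k v, HasDerivAt (fun t => ψ t k v) (ψ' k v) t)
    (v : Fin 6 → V) : HasDerivAt (fun t => pairing (ρ t) (ψ t) v)
      (pairing ρ' (ψ t) v + pairing (ρ t) ψ' v) t := by
  simp only [pairing_apply_eq_sum]
  rw [← Finset.sum_add_distrib]
  refine HasDerivAt.fun_sum fun k _ => ?_
  rw [← mul_add]
  exact (hasDerivAt_wedge hρ hψ _ v).const_mul _

theorem hasDerivAt_exterior (hρ : ∀ k v, HasDerivAt (fun t => ρ t k v) (ρ' k v) t)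
    (ξ : Module.Dual ℝ V) (k : ℕ) (v : Fin k → V) :
    HasDerivAt (fun t => exterior (ρ t) ξ k v) (exterior ρ' ξ k v) t := by
  rcases k with _ | k
  · exact hasDerivAt_const t (0 : ℝ)
  · simp only [exterior_succ_apply]
    exact HasDerivAt.fun_sum fun i _ => ((hρ k _).const_mul _).const_mul _

end

variable {M : Type*} [TopologicalSpace M] [ChartedSpace E6 M]

/-- The derivative of a mixed form in a chart, in a direction `v`. -/
def MixedForm.partialDeriv (ρ : MixedForm M ℝ) (j : M) (y v : E6) : Mixed E6 ℝ :=
  fun k => (fderiv ℝ ((ρ k).inChart j) y v).toAlternatingMap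

theorem Form.IsSmooth.differentiableAt {F : Type*} [NormedAddCommGroup F] [NormedSpace ℝ F]
    {k : ℕ} {τ : Form M F k} (hτ : τ.IsSmooth) {j : M} {y : E6}
    (hy : y ∈ (chartAt E6 j).target) : DifferentiableAt ℝ (τ.inChart j) y :=
  ((hτ j).contDiffAt ((chartAt E6 j).open_target.mem_nhds hy)).differentiableAt (by simp)

theorem MixedForm.IsSmooth.hasDerivAt {ρ : MixedForm M ℝ} (hρ : ρ.IsSmooth) {j : M} {y : E6}
    (hy : y ∈ (chartAt E6 j).target) (w : E6) (k : ℕ) (v : Fin k → E6) :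
    HasDerivAt (fun t : ℝ => ρ.inChart j (y + t • w) k v) (ρ.partialDeriv j y w k v) 0 := by
  have h1 : HasFDerivAt ((ρ k).inChart j) (fderiv ℝ ((ρ k).inChart j) y) y :=
    ((hρ k).differentiableAt hy).hasFDerivAt
  have h2 : HasDerivAt (fun t : ℝ => (ρ k).inChart j (y + t • w))
      (fderiv ℝ ((ρ k).inChart j) y w) 0 := h1.hasLineDerivAt w
  exact (ContinuousAlternatingMap.apply ℝ E6 ℝ v).hasFDerivAt.comp_hasDerivAt (0 : ℝ) h2

variable [IsManifold (𝓡 6) ∞ M]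

/-- The exterior derivative is `∑ᵢ eⁱ ∧ ∂ᵢ`. -/
theorem MixedForm.inChart_d {ρ : MixedForm M ℝ} (hρ : ρ.IsSmooth) {j : M} {y : E6}
    (hy : y ∈ (chartAt E6 j).target) (b : Module.Basis (Fin 6) ℝ E6) :
    ρ.d.inChart j y = ∑ i, exterior (ρ.partialDeriv j y (b i)) (b.coord i) := by
  funext k
  rw [Finset.sum_apply]
  rcases k with _ | k
  · simp only [exterior_zero, Finset.sum_const_zero]
    rfl
  · have h1 : ρ.d.inChart j y (k + 1) = ((ρ k).d.inChart j y).toAlternatingMap := rfl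
    rw [h1, Form.inChart_d (hρ k) hy]
    ext v
    rw [alternating_sum_apply]
    simp only [exterior_succ, oneWedge_apply]
    rw [Finset.sum_comm]
    change extDeriv ((ρ k).inChart j) y v = _
    rw [extDeriv, ContinuousAlternatingMap.alternatizeUncurryFin_apply]
    refine Finset.sum_congr rfl fun l _ => ?_
    rw [← Finset.smul_sum]
    congr 1
    conv_lhs => rw [← b.sum_repr (v l)]
    rw [map_sum, ContinuousAlternatingMap.sum_apply]
    refine Finset.sum_congr rfl fun i _ => ?_
    rw [map_smul]
    rfl

/-- The Leibniz rule for `∑ᵢ ∂ᵢ ⟨ψ, eⁱ ∧ α⟩`. -/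
theorem sum_fderiv_pairing {ψ α : MixedForm M ℝ} (hψ : ψ.IsSmooth) (hα : α.IsSmooth) {j : M}
    {y : E6} (hy : y ∈ (chartAt E6 j).target) (b : Module.Basis (Fin 6) ℝ E6) (v : Fin 6 → E6) :
    ∑ i, fderiv ℝ (fun y => pairing (ψ.inChart j y) (exterior (α.inChart j y) (b.coord i)) v) y
      (b i) = pairing (ψ.d.inChart j y) (α.inChart j y) v +
        pairing (ψ.inChart j y) (α.d.inChart j y) v := by
  have hd : ∀ i, fderiv ℝ (fun y => pairing (ψ.inChart j y)
      (exterior (α.inChart j y) (b.coord i)) v) y (b i) =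
      pairing (ψ.partialDeriv j y (b i)) (exterior (α.inChart j y) (b.coord i)) v +
      pairing (ψ.inChart j y) (exterior (α.partialDeriv j y (b i)) (b.coord i)) v := fun i => by
    have h1 := hasDerivAt_pairing (hψ.hasDerivAt hy (b i))
      (hasDerivAt_exterior (hα.hasDerivAt hy (b i)) (b.coord i)) v
    simp only [zero_smul, add_zero] at h1
    have h2 := (hψ.smoothFamily j).pairing (ψ := fun y => exterior (α.inChart j y) (b.coord i))
      (by simpa [clifford_apply] using (hα.smoothFamily j).clifford (0, b.coord i)) v
    have h3 := (h2.contDiffAt ((chartAt E6 j).open_target.mem_nhds hy)).differentiableAt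
      (by simp)
    exact fderiv_apply_eq_of_hasDerivAt h3 h1
  rw [Finset.sum_congr rfl fun i _ => hd i, Finset.sum_add_distrib, MixedForm.inChart_d hψ hy b,
    MixedForm.inChart_d hα hy b]
  have hl : ∀ (f : Fin 6 → Mixed E6 ℝ) (χ : Mixed E6 ℝ),
      pairing (∑ i, f i) χ = ∑ i, pairing (f i) χ := fun f χ => by
    simp only [← pairingₗ_apply]
    rw [map_sum, LinearMap.sum_apply]
  have hr : ∀ (f : Fin 6 → Mixed E6 ℝ) (χ : Mixed E6 ℝ),
      pairing χ (∑ i, f i) = ∑ i, pairing χ (f i) := fun f χ => by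
    simp only [← pairingₗ_apply]
    rw [map_sum]
  rw [hl, hr, alternating_sum_apply, alternating_sum_apply]
  simp only [pairing_exterior]

end

/-! ### Integration by parts -/

section
open Set Filter Topology MeasureTheory

variable {M : Type*} [TopologicalSpace M] [ChartedSpace E6 M]
  {F : Type*} [NormedAddCommGroup F] [NormedSpace ℝ F] {k : ℕ}

theorem Form.inChart_add (τ σ : Form M F k) (j : M) :
    (τ + σ).inChart j = τ.inChart j + σ.inChart j := rfl

theorem Form.inChart_zero (j : M) : (0 : Form M F k).inChart j = 0 := rfl

theorem Form.isSmooth_zero : (0 : Form M F k).IsSmooth := fun j => by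
  rw [Form.inChart_zero]; exact contDiffOn_const

theorem Form.IsSmooth.add {τ σ : Form M F k} (hτ : τ.IsSmooth) (hσ : σ.IsSmooth) :
    (τ + σ).IsSmooth := fun j => (hτ j).add (hσ j)

theorem Form.d_add {τ σ : Form M F k} (hτ : τ.IsSmooth) (hσ : σ.IsSmooth) :
    (τ + σ).d = τ.d + σ.d := by
  funext x
  have hx := (chartAt E6 x).map_source (mem_chart_source E6 x)
  rw [Form.d, Form.inChart_add, extDeriv_add (hτ.differentiableAt hx) (hσ.differentiableAt hx)]
  rfl

theorem Form.d_eq_zero_of_eventually {τ : Form M F k} {x : M} (h : ∀ᶠ z in 𝓝 x, τ z = 0) :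
    τ.d x = 0 := by
  have h1 : Tendsto (chartAt E6 x).symm (𝓝 (chartAt E6 x x)) (𝓝 x) := by
    have := (chartAt E6 x).continuousAt_symm ((chartAt E6 x).map_source (mem_chart_source E6 x))
    rwa [ContinuousAt, (chartAt E6 x).left_inv (mem_chart_source E6 x)] at this
  have h2 : τ.inChart x =ᶠ[𝓝 (chartAt E6 x x)] 0 := by
    filter_upwards [h1.eventually h] with y hy
    rw [Form.inChart, hy]; rfl
  have h3 : extDeriv (0 : E6 → E6 [⋀^Fin k]→L[ℝ] F) (chartAt E6 x x) = 0 := by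
    have := extDeriv_smul (x := chartAt E6 x x) (0 : ℝ) (0 : E6 → E6 [⋀^Fin k]→L[ℝ] F)
    rwa [zero_smul, zero_smul] at this
  rw [Form.d, h2.extDeriv_eq, h3]
  rfl

theorem Form.d_zero : (0 : Form M F k).d = 0 := by
  funext x
  exact Form.d_eq_zero_of_eventually (Eventually.of_forall fun _ => rfl)

theorem MixedForm.IsSmooth.add {α β : MixedForm M F} (hα : α.IsSmooth) (hβ : β.IsSmooth) :
    (α + β).IsSmooth := fun k => (hα k).add (hβ k)

theorem MixedForm.d_add {α β : MixedForm M F} (hα : α.IsSmooth) (hβ : β.IsSmooth) :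
    (α + β).d = α.d + β.d := by
  funext k
  rcases k with _ | k
  · exact (add_zero (0 : Form M F 0)).symm
  · exact Form.d_add (hα k) (hβ k)

theorem MixedForm.d_zero : (0 : MixedForm M F).d = 0 := by
  funext k
  rcases k with _ | k
  · rfl
  · exact Form.d_zero

theorem MixedForm.HasParity.d {p : ZMod 2} {α : MixedForm M F} (h : α.HasParity (p + 1)) :
    α.d.HasParity p := fun k hk => by
  rcases k with _ | k
  · rfl
  · have : α k = 0 := h k fun h2 => hk (by
      push_cast; rw [h2, add_assoc, CharTwo.add_self_eq_zero (1 : ZMod 2), add_zero])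
    change (α k).d = 0
    rw [this, Form.d_zero]

variable [IsManifold (𝓡 6) ∞ M]

theorem Form.IsSmooth.d {τ : Form M F k} (hτ : τ.IsSmooth) : τ.d.IsSmooth := fun j => by
  have h1 : ContDiffOn ℝ ∞ (fun y => fderiv ℝ (τ.inChart j) y) (chartAt E6 j).target :=
    (hτ j).fderiv_of_isOpen (chartAt E6 j).open_target (by simp)
  refine ((ContinuousAlternatingMap.alternatizeUncurryFinCLM ℝ E6 F
    (n := k)).contDiff.comp_contDiffOn h1).congr fun y hy => ?_
  rw [Form.inChart_d hτ hy, Function.comp_apply,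
    ContinuousAlternatingMap.alternatizeUncurryFinCLM_apply]
  rfl

theorem MixedForm.IsSmooth.d {α : MixedForm M F} (hα : α.IsSmooth) : α.d.IsSmooth := fun k => by
  rcases k with _ | k
  · exact Form.isSmooth_zero
  · exact (hα k).d

theorem MixedForm.IsSmooth.smul {α : MixedForm M F} (hα : α.IsSmooth) {f : M → ℝ}
    (hf : ContMDiff (𝓡 6) 𝓘(ℝ) ∞ f) :
    MixedForm.IsSmooth (fun k x => f x • α k x : MixedForm M F) := fun k j => by
  have h1 : ContMDiffOn (𝓡 6) (𝓡 6) ∞ (chartAt E6 j).symm (chartAt E6 j).target :=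
    contMDiffOn_chart_symm
  have h2 : ContDiffOn ℝ ∞ (fun y => f ((chartAt E6 j).symm y)) (chartAt E6 j).target :=
    contMDiffOn_iff_contDiffOn.1 (hf.comp_contMDiffOn h1)
  exact h2.smul (hα k j)

section

variable {ν : Form M ℝ 6} (hν : ν.IsVolumeForm)
include hν

theorem eventually_sign_eq {j : M} {y : E6} (hy : y ∈ (chartAt E6 j).target) :
    ∀ᶠ z in 𝓝 y, SignType.sign (ν.inChart j z (EuclideanSpace.basisFun (Fin 6) ℝ)) =
      SignType.sign (ν.inChart j y (EuclideanSpace.basisFun (Fin 6) ℝ)) := by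
  have h1 : ContinuousAt (fun z => ν.inChart j z (EuclideanSpace.basisFun (Fin 6) ℝ)) y :=
    (((hν.isSmooth j).alternating_apply _).contDiffAt
      ((chartAt E6 j).open_target.mem_nhds hy)).continuousAt
  have h2 := (continuousAt_sign_of_ne_zero (inChart_apply_basis_ne_zero hy hν.ne_zero)).tendsto.comp
    h1.tendsto
  rw [nhds_discrete SignType, tendsto_pure] at h2
  exact h2

theorem density_pairingForm (ψ φ : MixedForm M ℝ) {j : M} {y : E6}
    (hy : y ∈ (chartAt E6 j).target) : density ν (pairingForm ν ψ φ) j y =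
      (SignType.sign (ν.inChart j y (EuclideanSpace.basisFun (Fin 6) ℝ)) : ℝ) *
        pairing (ψ.inChart j y) (φ.inChart j y) (EuclideanSpace.basisFun (Fin 6) ℝ) := by
  rw [density, pairingForm_inChart hy hν.ne_zero]

/-- The product of the orientation sign of a chart with a smooth function. -/
theorem contDiffOn_sign_mul {j : M} {f : E6 → ℝ} (hf : ContDiffOn ℝ ∞ f (chartAt E6 j).target) :
    ContDiffOn ℝ ∞ (fun y =>
      (SignType.sign (ν.inChart j y (EuclideanSpace.basisFun (Fin 6) ℝ)) : ℝ) * f y)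
      (chartAt E6 j).target := fun y hy => by
  refine ContDiffAt.contDiffWithinAt ?_
  have h1 := (contDiffAt_const (𝕜 := ℝ) (n := ∞) (x := y)
    (c := (SignType.sign (ν.inChart j y (EuclideanSpace.basisFun (Fin 6) ℝ)) : ℝ))).mul
    (hf.contDiffAt ((chartAt E6 j).open_target.mem_nhds hy))
  refine h1.congr_of_eventuallyEq ?_
  filter_upwards [eventually_sign_eq hν hy] with z hz
  rw [hz]

theorem contDiffOn_density_pairingForm {ψ φ : MixedForm M ℝ} (hψ : ψ.IsSmooth) (hφ : φ.IsSmooth)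
    (j : M) : ContDiffOn ℝ ∞ (density ν (pairingForm ν ψ φ) j) (chartAt E6 j).target :=
  (contDiffOn_sign_mul hν ((hψ.smoothFamily j).pairing (hφ.smoothFamily j) _)).congr fun _ hy =>
    density_pairingForm hν ψ φ hy

/-- Integration by parts in a chart, `∫ ⟨ψ, dα⟩ = -∫ ⟨dψ, α⟩`: the divergence theorem for the
vector field with components `⟨ψ, eⁱ ∧ α⟩`, up to the orientation sign of the chart, which is
locally constant. -/
theorem chartIntegral_pairingForm_d {ψ α : MixedForm M ℝ} (hψ : ψ.IsSmooth) (hα : α.IsSmooth)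
    {j : M} {K : Set M} (hK : IsCompact K) (hKj : K ⊆ (chartAt E6 j).source)
    (h0 : ∀ x ∉ K, ∀ k, α k x = 0) :
    IntegrableOn (density ν (pairingForm ν ψ α.d) j) (chartAt E6 j).target ∧
      chartIntegral ν (pairingForm ν ψ α.d) j = -chartIntegral ν (pairingForm ν ψ.d α) j := by
  set U := (chartAt E6 j).target with hU
  have hUo : IsOpen U := (chartAt E6 j).open_target
  let b := (EuclideanSpace.basisFun (Fin 6) ℝ).toBasis
  let e : Fin 6 → E6 := EuclideanSpace.basisFun (Fin 6) ℝ
  let s : E6 → ℝ := fun y => (SignType.sign (ν.inChart j y e) : ℝ)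
  have hK' := isCompact_image_chart hK hKj
  have hKU := image_chart_subset hKj
  have hα0 : ∀ y ∈ U \ chartAt E6 j '' K, α.inChart j y = 0 := fun y hy => by
    funext k
    rw [MixedForm.inChart, Form.inChart, h0 _ (symm_notMem hy) k]
    rfl
  let f : Fin 6 → E6 → ℝ := fun i y =>
    pairing (ψ.inChart j y) (exterior (α.inChart j y) (b.coord i)) e
  have hf : ∀ i, ContDiffOn ℝ ∞ (f i) U := fun i =>
    (hψ.smoothFamily j).pairing (ψ := fun y => exterior (α.inChart j y) (b.coord i))
      (by simpa [clifford_apply] using (hα.smoothFamily j).clifford (0, b.coord i)) e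
  have hp0 : ∀ φ : Mixed E6 ℝ, pairing φ 0 e = 0 := fun φ => by
    rw [← pairingₗ_apply, map_zero]; rfl
  have hdiv : ∀ i, IntegrableOn (fun y => fderiv ℝ (fun y => s y * f i y) y (b i)) U ∧
      ∫ y in U, fderiv ℝ (fun y => s y * f i y) y (b i) = 0 := fun i =>
    setIntegral_fderiv_eq_zero hUo hK' hKU
      ((contDiffOn_sign_mul hν (hf i)).of_le (by simp)) (fun y hy => by
        have : f i y = 0 := by
          change pairing (ψ.inChart j y) (exterior (α.inChart j y) (b.coord i)) e = 0
          rw [hα0 y hy, map_zero, LinearMap.zero_apply, hp0]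
        rw [this, mul_zero]) (b i)
  have hd : ∀ y ∈ U, ∑ i, fderiv ℝ (fun y => s y * f i y) y (b i) =
      density ν (pairingForm ν ψ.d α) j y + density ν (pairingForm ν ψ α.d) j y := fun y hy => by
    rw [density_pairingForm hν _ _ hy, density_pairingForm hν _ _ hy, ← mul_add,
      ← sum_fderiv_pairing hψ hα hy b, Finset.mul_sum]
    refine Finset.sum_congr rfl fun i _ => ?_
    have h1 : (fun y => s y * f i y) =ᶠ[𝓝 y] fun z => s y * f i z := by
      filter_upwards [eventually_sign_eq hν hy] with z hz
      simp only [s, e, hz]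
    have h2 : DifferentiableAt ℝ (f i) y :=
      ((hf i).contDiffAt (hUo.mem_nhds hy)).differentiableAt (by simp)
    rw [h1.fderiv_eq, fderiv_const_mul h2, smul_apply, smul_eq_mul]
  have hi1 : IntegrableOn (density ν (pairingForm ν ψ.d α) j) U :=
    integrableOn_of_eq_zero hUo hK' hKU
      (contDiffOn_density_pairingForm hν hψ.d hα j).continuousOn fun y hy => by
        rw [density_pairingForm hν _ _ hy.1, hα0 y hy, hp0, mul_zero]
  have hi : IntegrableOn (fun y => ∑ i, fderiv ℝ (fun y => s y * f i y) y (b i)) U :=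
    integrable_finsetSum _ fun i _ => (hdiv i).1
  have hi2 : IntegrableOn (density ν (pairingForm ν ψ α.d) j) U :=
    (hi.sub hi1).congr_fun (fun y hy => by
      simp only [Pi.sub_apply]
      rw [hd y hy, add_sub_cancel_left]) hUo.measurableSet
  refine ⟨hi2, ?_⟩
  have h3 : ∫ y in U, ∑ i, fderiv ℝ (fun y => s y * f i y) y (b i) = 0 := by
    rw [integral_finsetSum _ fun i _ => (hdiv i).1]
    exact Finset.sum_eq_zero fun i _ => (hdiv i).2
  rw [setIntegral_congr_fun hUo.measurableSet hd, integral_add hi1 hi2] at h3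
  rw [chartIntegral, chartIntegral]
  linarith

variable [CompactSpace M] [T2Space M]

/-- Integration by parts, for a form supported in a chart. -/
theorem integral_pairingForm_d {ψ α : MixedForm M ℝ} (hψ : ψ.IsSmooth) (hα : α.IsSmooth)
    {j : M} {K : Set M} (hK : IsCompact K) (hKj : K ⊆ (chartAt E6 j).source)
    (h0 : ∀ x ∉ K, ∀ k, α k x = 0) :
    integral ν (pairingForm ν ψ α.d) = -chartIntegral ν (pairingForm ν ψ.d α) j := by
  obtain ⟨h1, h2⟩ := chartIntegral_pairingForm_d hν hψ hα hK hKj h0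
  rw [← h2]
  refine integral_eq_chartIntegral (fun x hx => ?_) h1
  have h3 : α.d.at x = 0 := by
    funext k
    rcases k with _ | k
    · rfl
    · have h4 : (α k).d x = 0 := Form.d_eq_zero_of_eventually
        (eventually_of_mem (hK.isClosed.isOpen_compl.mem_nhds fun h => hx (hKj h))
          fun z hz => h0 z hz k)
      change ((α k).d x).toAlternatingMap = 0
      rw [h4]; rfl
  have h5 : pairing (ψ.at x) 0 = 0 := by rw [← pairingₗ_apply, map_zero]
  rw [pairingForm, h3, h5, ← coeffₗ_apply, map_zero, zero_smul]

theorem integral_pairingForm_add {ψ α β : MixedForm M ℝ} (hψ : ψ.IsSmooth) (hα : α.IsSmooth)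
    (hβ : β.IsSmooth) : integral ν (pairingForm ν ψ (α + β)) =
      integral ν (pairingForm ν ψ α) + integral ν (pairingForm ν ψ β) := by
  simp only [integral_eq_sum]
  rw [← Finset.sum_add_distrib]
  refine Finset.sum_congr rfl fun i _ => ?_
  rw [← integral_add
    (integrableOn_partition_mul i (contDiffOn_density_pairingForm hν hψ hα i).continuousOn)
    (integrableOn_partition_mul i (contDiffOn_density_pairingForm hν hψ hβ i).continuousOn)]
  refine setIntegral_congr_fun (chartAt E6 i).open_target.measurableSet fun y hy => ?_
  have h1 : (α + β).inChart i y = α.inChart i y + β.inChart i y := rfl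
  simp only [density_pairingForm hν _ _ hy, h1]
  rw [pairing_add_right, AlternatingMap.add_apply]
  ring

/-- If `dψ = 0` then `∫ ⟨ψ, dα⟩ = 0` for all `α`. -/
theorem integral_pairingForm_d_eq_zero {ψ : MixedForm M ℝ} (hψ : ψ.IsSmooth) (hd : ψ.d = 0)
    {α : MixedForm M ℝ} (hα : α.IsSmooth) : integral ν (pairingForm ν ψ α.d) = 0 := by
  let β : M → MixedForm M ℝ := fun i k x => partition M i x • α k x
  have hβ : ∀ i, (β i).IsSmooth := fun i => hα.smul (partition M i).contMDiff
  have h1 : ∀ i, integral ν (pairingForm ν ψ (β i).d) = 0 := fun i => by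
    rw [integral_pairingForm_d hν hψ (hβ i) (isClosed_tsupport (partition M i)).isCompact
      (partition_subordinate i) fun x hx k => ?_, hd, chartIntegral, neg_eq_zero]
    · rw [← integral_zero (α := E6) ℝ (μ := volume.restrict (chartAt E6 i).target)]
      refine setIntegral_congr_fun (chartAt E6 i).open_target.measurableSet fun y hy => ?_
      have h2 : (0 : MixedForm M ℝ).inChart i y = 0 := rfl
      have h3 : pairing (0 : Mixed E6 ℝ) ((β i).inChart i y) = 0 := by
        rw [← pairingₗ_apply, map_zero, LinearMap.zero_apply]
      rw [density_pairingForm hν _ _ hy, h2, h3]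
      exact mul_zero _
    · change partition M i x • α k x = 0
      rw [image_eq_zero_of_notMem_tsupport hx, zero_smul]
  have h2 : ∀ s : Finset M, (∑ i ∈ s, β i).IsSmooth ∧
      integral ν (pairingForm ν ψ (∑ i ∈ s, β i).d) = 0 := fun s => by
    classical
    induction s using Finset.induction_on with
    | empty =>
      have h0 : (0 : MixedForm M ℝ).IsSmooth := fun k => Form.isSmooth_zero
      have h := integral_pairingForm_add hν hψ h0 h0
      rw [add_zero] at h
      rw [Finset.sum_empty, MixedForm.d_zero]
      exact ⟨h0, by linarith⟩
    | insert i s hi ih =>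
      rw [Finset.sum_insert hi, MixedForm.d_add (hβ i) ih.1,
        integral_pairingForm_add hν hψ (hβ i).d ih.1.d, h1, ih.2, add_zero]
      exact ⟨(hβ i).add ih.1, rfl⟩
  have h3 : ∑ i ∈ indices M, β i = α := by
    funext k x
    rw [Finset.sum_apply, Finset.sum_apply]
    change ∑ i ∈ indices M, partition M i x • α k x = _
    rw [← Finset.sum_smul, sum_partition, one_smul]
  rw [← h3]
  exact (h2 _).2

end

end

/-! ### The first variation of the volume functional -/

section
open Set Filter Topology MeasureTheory

/-- Differentiation under the integral sign, for a weight supported in a compact set. -/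
theorem hasDerivAt_setIntegral_mul {U K : Set E6} (hU : IsOpen U) (hK : IsCompact K) (hKU : K ⊆ U)
    {w : E6 → ℝ} (hw : ContinuousOn w U) (hw0 : ∀ y ∈ U \ K, w y = 0) {O : Set (ℝ × E6)}
    (hO : IsOpen O) (hKO : ({0} : Set ℝ) ×ˢ K ⊆ O) {f : ℝ × E6 → ℝ} (hf : ContDiffOn ℝ 1 f O)
    {f' : E6 → ℝ} (hf' : ∀ y ∈ K, HasDerivAt (fun t => f (t, y)) (f' y) 0) :
    HasDerivAt (fun t => ∫ y in U, w y * f (t, y)) (∫ y in U, w y * f' y) 0 := by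
  have hres : ∀ g : E6 → ℝ, ∫ y in U, w y * g y = ∫ y in K, w y * g y := fun g =>
    setIntegral_eq_of_subset_of_forall_sdiff_eq_zero hU.measurableSet hKU fun y hy => by
      rw [hw0 y hy, zero_mul]
  simp only [hres]
  let D : ℝ × E6 → ℝ := fun z => fderiv ℝ f z (1, 0)
  have hD : ContinuousOn D O :=
    (hf.continuousOn_fderiv_of_isOpen hO (by simp)).clm_apply continuousOn_const
  have hder : ∀ z ∈ O, HasDerivAt (fun t => f (t, z.2)) (D z) z.1 := fun z hz => by
    have h1 : HasFDerivAt f (fderiv ℝ f z) z :=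
      ((hf.contDiffAt (hO.mem_nhds hz)).differentiableAt (by simp)).hasFDerivAt
    have h2 : HasDerivAt (fun t : ℝ => (t, z.2)) ((1 : ℝ), (0 : E6)) z.1 :=
      (hasDerivAt_id z.1).prodMk (hasDerivAt_const z.1 z.2)
    exact HasFDerivAt.comp_hasDerivAt (f := fun t : ℝ => (t, z.2)) z.1 h1 h2
  -- A product neighbourhood of `{0} × K` in `O`, on which the derivative is uniformly bounded.
  obtain ⟨u, v, hu, hv, h0u, hKv, huv⟩ := generalized_tube_lemma isCompact_singleton hK hO hKO
  obtain ⟨ε, hε, hεu⟩ := Metric.nhds_basis_closedBall.mem_iff.1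
    (hu.mem_nhds (h0u (mem_singleton 0)))
  have hsub : ∀ t ∈ Metric.closedBall (0 : ℝ) ε, ∀ y ∈ K, (t, y) ∈ O := fun t ht y hy =>
    huv ⟨hεu ht, hKv hy⟩
  have hwK : ContinuousOn w K := hw.mono hKU
  obtain ⟨C, hC⟩ := ((isCompact_closedBall (0 : ℝ) ε).prod hK).exists_bound_of_continuousOn
    (f := fun z : ℝ × E6 => w z.2 * D z)
    ((hwK.comp continuousOn_snd fun z hz => hz.2).mul (hD.mono fun z hz => hsub _ hz.1 _ hz.2))
  have hball : Metric.ball (0 : ℝ) ε ⊆ Metric.closedBall 0 ε := Metric.ball_subset_closedBall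
  have hcont : ∀ t ∈ Metric.closedBall (0 : ℝ) ε, ∀ g : ℝ × E6 → ℝ, ContinuousOn g O →
      ContinuousOn (fun y => w y * g (t, y)) K := fun t ht g hg =>
    hwK.mul (hg.comp (continuousOn_const.prodMk continuousOn_id) fun y hy => hsub t ht y hy)
  have h0 : (0 : ℝ) ∈ Metric.closedBall (0 : ℝ) ε := Metric.mem_closedBall_self hε.le
  have h := (hasDerivAt_integral_of_dominated_loc_of_deriv_le (μ := volume.restrict K)
    (F := fun t y => w y * f (t, y)) (F' := fun t y => w y * D (t, y)) (x₀ := (0 : ℝ))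
    (bound := fun _ => C) (Metric.ball_mem_nhds 0 hε)
    (eventually_of_mem (Metric.ball_mem_nhds 0 hε) fun t ht =>
      (hcont t (hball ht) f hf.continuousOn).aestronglyMeasurable hK.measurableSet)
    ((hcont 0 h0 f hf.continuousOn).integrableOn_compact hK)
    ((hcont 0 h0 D hD).aestronglyMeasurable hK.measurableSet)
    ((ae_restrict_iff' hK.measurableSet).2 <| Eventually.of_forall fun y hy t ht =>
      hC (t, y) ⟨hball ht, hy⟩)
    (integrableOn_const hK.measure_ne_top)
    ((ae_restrict_iff' hK.measurableSet).2 <| Eventually.of_forall fun y hy t ht =>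
      (hder (t, y) (hsub t (hball ht) y hy)).const_mul _)).2
  refine h.congr_deriv (setIntegral_congr_fun hK.measurableSet fun y hy => ?_)
  rw [(hder (0, y) (hsub 0 h0 y hy)).unique (hf' y hy)]

/-- The derivative of `√(-q/3)` at a stable form. -/
theorem hasDerivAt_sqrt_quartic {V : Type*} [AddCommGroup V] [Module ℝ V] [FiniteDimensional ℝ V]
    (h6 : Module.finrank ℝ V = 6) {ν : V [⋀^Fin 6]→ₗ[ℝ] ℝ} (hν : ν ≠ 0) {p : ZMod 2}
    {ρ ψ β : Mixed V ℝ} (hρ : HasParity p ρ) (hβ : HasParity p β) (h : IsHat p ν ρ ψ) :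
    HasDerivAt (fun t : ℝ => √(-quartic ν (ρ + t • β) / 3)) (1 / 2 * coeff ν (pairing ψ β)) 0 := by
  have hX := clifford_moment h6 hν hρ
  have hlt := h.pairing_lt h6
  have hXψ := h.eq_smul h6 hX
  set c := coeff ν (pairing ρ ψ) with hc
  have hpair : ∀ φ : Mixed V ℝ, coeff ν (pairing φ (gradient h6 ν ρ)) =
      -c / 2 * coeff ν (pairing φ ψ) := fun φ => by
    rw [hXψ, pairing_smul_right, ← coeffₗ_apply, map_smul, smul_eq_mul, coeffₗ_apply]
  have hq : -quartic ν ρ / 3 = (-c / 4) ^ 2 := by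
    rw [quartic_eq_pair h6 hX, hpair, ← hc]; ring
  have hd := quartic_hasDerivAt h6 hν hρ hβ hX
  rw [hpair] at hd
  have h0 : -quartic ν (ρ + (0 : ℝ) • β) / 3 = (-c / 4) ^ 2 := by rw [zero_smul, add_zero, hq]
  have hpos : 0 < -c / 4 := by linarith
  have hs := (hd.fun_neg.div_const 3).sqrt (by rw [h0]; positivity)
  refine hs.congr_deriv ?_
  have hswap : coeff ν (pairing β ψ) = -coeff ν (pairing ψ β) := by
    rw [pairing_swap h6, ← coeffₗ_apply, map_neg, coeffₗ_apply]
  rw [h0, Real.sqrt_sq hpos.le, hswap]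
  have : c ≠ 0 := hlt.ne
  field_simp
  ring

/-- The derivative of the integral of `√(-q/3)` along a smooth family of stable forms. -/
theorem hasDerivAt_setIntegral_sqrt_quartic {U K : Set E6} (hU : IsOpen U) (hK : IsCompact K)
    (hKU : K ⊆ U) {w : E6 → ℝ} (hw : ContinuousOn w U) (hw0 : ∀ y ∈ U \ K, w y = 0)
    {N : E6 → E6 [⋀^Fin 6]→ₗ[ℝ] ℝ} (hN : ∀ v, ContDiffOn ℝ ∞ (fun y => N y v) U)
    (hN0 : ∀ y ∈ U, N y ≠ 0) {p : ZMod 2} {R B Ψ : E6 → Mixed E6 ℝ} (hR : SmoothFamily U R)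
    (hB : SmoothFamily U B) (hRp : ∀ y, HasParity p (R y)) (hBp : ∀ y, HasParity p (B y))
    (hq0 : ∀ y ∈ U, quartic (N y) (R y) < 0) (hΨ : ∀ y ∈ U, IsHat p (N y) (R y) (Ψ y)) :
    HasDerivAt (fun t : ℝ => ∫ y in U, w y * √(-quartic (N y) (R y + t • B y) / 3))
      (∫ y in U, w y * (1 / 2 * coeff (N y) (pairing (Ψ y) (B y)))) 0 := by
  have hN' : ∀ v, ContDiffOn ℝ ∞ (fun z : ℝ × E6 => N z.2 v) (univ ×ˢ U) := fun v =>
    (hN v).comp contDiffOn_snd fun z hz => hz.2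
  have h1 : ∀ {α : E6 → Mixed E6 ℝ}, SmoothFamily U α →
      SmoothFamily (univ ×ˢ U) (fun z : ℝ × E6 => α z.2) := fun hα k v =>
    (hα k v).comp contDiffOn_snd fun z hz => hz.2
  have hR' : SmoothFamily (univ ×ˢ U) (fun z : ℝ × E6 => R z.2 + z.1 • B z.2) :=
    (h1 hR).add (SmoothFamily.smul contDiffOn_fst (h1 hB))
  obtain ⟨q, hqd⟩ : ∃ q : ℝ × E6 → ℝ, ∀ z, q z = quartic (N z.2) (R z.2 + z.1 • B z.2) :=
    ⟨_, fun _ => rfl⟩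
  have hq : ContDiffOn ℝ ∞ q (univ ×ˢ U) :=
    (hR'.quartic hN' (fun z hz => hN0 z.2 hz.2) finrank_E6 fun z _ =>
      (hRp z.2).add ((hBp z.2).smul z.1)).congr fun z _ => hqd z
  have hf : ContDiffOn ℝ 1 (fun z => √(-q z / 3)) ((univ ×ˢ U) ∩ q ⁻¹' Iio 0) := by
    refine (((hq.mono inter_subset_left).of_le (by simp)).neg.div_const 3).sqrt fun z hz => ?_
    have : q z < 0 := hz.2
    exact ne_of_gt (by linarith)
  have hd : ∀ y ∈ K, HasDerivAt (fun t => √(-q (t, y) / 3))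
      (1 / 2 * coeff (N y) (pairing (Ψ y) (B y))) 0 := fun y hy => by
    simp only [hqd]
    exact hasDerivAt_sqrt_quartic finrank_E6 (hN0 y (hKU hy)) (hRp y) (hBp y) (hΨ y (hKU hy))
  have h := hasDerivAt_setIntegral_mul hU hK hKU hw hw0
    (hq.continuousOn.isOpen_inter_preimage (isOpen_univ.prod hU) isOpen_Iio) ?_ hf hd
  · simp only [hqd] at h
    exact h
  -- The set where `q < 0` is an open neighbourhood of `{0} × K`.
  · rintro ⟨t, y⟩ ⟨ht, hy⟩
    obtain rfl : t = 0 := ht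
    refine ⟨⟨mem_univ _, hKU hy⟩, ?_⟩
    rw [mem_preimage, mem_Iio, hqd, zero_smul, add_zero]
    exact hq0 y (hKU hy)

variable {M : Type*} [TopologicalSpace M] [ChartedSpace E6 M] [IsManifold (𝓡 6) ∞ M]
  [CompactSpace M] [T2Space M]

omit [CompactSpace M] [T2Space M] in
theorem density_phi {ν : Form M ℝ 6} (hν : ∀ x, ν x ≠ 0) {p : ZMod 2} {ρ : MixedForm M ℝ}
    (hp : ρ.HasParity p) {i : M} {y : E6} (hy : y ∈ (chartAt E6 i).target) :
    density ν (phi ν ρ) i y =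
      √(-quartic (ν.inChart i y).toAlternatingMap (ρ.inChart i y) / 3) * density ν ν i y := by
  rw [quartic_inChart hy hν hp]
  exact density_smul ν ν (fun x => √(-quartic (ν x).toAlternatingMap (ρ.at x) / 3)) i y

omit [IsManifold (𝓡 6) ∞ M] [CompactSpace M] [T2Space M] in
theorem MixedForm.inChart_add_smul (ρ β : MixedForm M ℝ) (t : ℝ) (i : M) (y : E6) :
    (ρ + t • β).inChart i y = ρ.inChart i y + t • β.inChart i y := rfl

omit [IsManifold (𝓡 6) ∞ M] [CompactSpace M] [T2Space M] in
theorem MixedForm.HasParity.add_smul {p : ZMod 2} {ρ β : MixedForm M ℝ} (hρ : ρ.HasParity p)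
    (hβ : β.HasParity p) (t : ℝ) : (ρ + t • β).HasParity p := fun k hk => by
  rw [Pi.add_apply, Pi.smul_apply, hρ k hk, hβ k hk, smul_zero, add_zero]

/-- The first variation of the volume functional: `δV(β) = ½ ∫ ⟨ρ̂, β⟩`. -/
theorem hasDerivAt_volumeFunctional {ν : Form M ℝ 6} (hν : ν.IsVolumeForm) {p : ZMod 2}
    {ρ β : MixedForm M ℝ} (hρ : ρ.IsSmooth) (hp : ρ.HasParity p) (hs : IsStable ν ρ)
    (hβ : β.IsSmooth) (hβp : β.HasParity p) :
    HasDerivAt (fun t : ℝ => volumeFunctional ν (ρ + t • β))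
      (1 / 2 * integral ν (pairingForm ν (hat p ν ρ) β)) 0 := by
  simp only [volumeFunctional, integral_eq_sum, Finset.mul_sum]
  refine HasDerivAt.fun_sum fun i _ => ?_
  have hU : IsOpen (chartAt E6 i).target := (chartAt E6 i).open_target
  have hK := partition_subordinate i
  have hw : ContinuousOn (fun y => partition M i ((chartAt E6 i).symm y) * density ν ν i y)
      (chartAt E6 i).target :=
    ((partition M i).contMDiff.continuous.comp_continuousOn (chartAt E6 i).continuousOn_symm).mul
      (contDiffOn_sign_mul hν ((hν.isSmooth i).alternating_apply _)).continuousOn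
  have hmain := hasDerivAt_setIntegral_sqrt_quartic hU
    (isCompact_image_chart (isClosed_tsupport (partition M i)).isCompact hK)
    (image_chart_subset hK) hw
    (fun y hy => by rw [image_eq_zero_of_notMem_tsupport (symm_notMem hy), zero_mul])
    (N := fun y => (ν.inChart i y).toAlternatingMap) (hν.isSmooth i).alternating_apply
    (fun y hy => inChart_ne_zero hy hν.ne_zero) (hρ.smoothFamily i) (hβ.smoothFamily i)
    (hp.inChart i) (hβp.inChart i)
    (fun y hy => by rw [quartic_inChart hy hν.ne_zero hp]; exact hs _)
    (fun y hy => isHat_inChart hν.ne_zero hp hs hy)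
  have hfun : ∀ t : ℝ, ∫ y in (chartAt E6 i).target, partition M i ((chartAt E6 i).symm y) *
      density ν (phi ν (ρ + t • β)) i y = ∫ y in (chartAt E6 i).target,
      partition M i ((chartAt E6 i).symm y) * density ν ν i y *
        √(-quartic (ν.inChart i y).toAlternatingMap
          (ρ.inChart i y + t • β.inChart i y) / 3) := fun t =>
    setIntegral_congr_fun hU.measurableSet fun y hy => by
      simp only
      rw [density_phi hν.ne_zero (hp.add_smul hβp t) hy, MixedForm.inChart_add_smul]
      ring
  simp only [hfun]
  refine hmain.congr_deriv ?_
  rw [← integral_const_mul]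
  refine setIntegral_congr_fun hU.measurableSet fun y hy => ?_
  have h1 := coeff_smul finrank_E6 (inChart_ne_zero hy hν.ne_zero)
    (pairing ((hat p ν ρ).inChart i y) (β.inChart i y))
  have h2 : pairing ((hat p ν ρ).inChart i y) (β.inChart i y)
      (EuclideanSpace.basisFun (Fin 6) ℝ) = coeff (ν.inChart i y).toAlternatingMap
        (pairing ((hat p ν ρ).inChart i y) (β.inChart i y)) *
          ν.inChart i y (EuclideanSpace.basisFun (Fin 6) ℝ) := by
    conv_lhs => rw [← h1]
    rfl
  rw [density_pairingForm hν _ _ hy, h2, density]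
  ring

end

/-! ### Closedness from test forms -/

section
variable {V : Type*} [AddCommGroup V] [Module ℝ V]

/-- The even or odd part of a mixed form. -/
def parityPart (p : ZMod 2) (φ : Mixed V ℝ) : Mixed V ℝ :=
  fun k => if (k : ZMod 2) = p then φ k else 0

theorem hasParity_parityPart (p : ZMod 2) (φ : Mixed V ℝ) : HasParity p (parityPart p φ) :=
  fun _ hk => if_neg hk

/-- The pairing of a six-dimensional space only pairs forms of the same parity. -/
theorem pairing_parityPart {p : ZMod 2} {φ : Mixed V ℝ} (hφ : HasParity p φ) (ψ : Mixed V ℝ) :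
    pairing φ (parityPart p ψ) = pairing φ ψ := by
  rw [pairing, pairing]
  refine Finset.sum_congr rfl fun k _ => ?_
  congr 1
  by_cases hk : ((k : ℕ) : ZMod 2) = p
  · have h6 : (((6 - (k : ℕ) : ℕ)) : ZMod 2) = p := by
      rw [Nat.cast_sub (by omega), hk]
      have : ((6 : ℕ) : ZMod 2) = 0 := by decide
      rw [this, zero_sub, CharTwo.neg_eq]
    rw [parityPart, if_pos h6]
  · rw [hφ k hk, zero_wedge, zero_wedge]

end

section
open Set Filter Topology MeasureTheory

variable {M : Type*} [TopologicalSpace M] [ChartedSpace E6 M]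

open Classical in
/-- The form on `M` given in the chart at `j` by `g a`, for a function `g` on the model space and
constant forms `a`, extended by zero. -/
def bumpForm (j : M) (g : E6 → ℝ) (a : (k : ℕ) → E6 [⋀^Fin k]→L[ℝ] ℝ) : MixedForm M ℝ := fun k x =>
  if x ∈ (chartAt E6 j).source then g (chartAt E6 j x) • (a k).compContinuousLinearMap
    ((NormedSpace.fromTangentSpace (chartAt E6 j x)).toContinuousLinearMap ∘L
      mfderiv (𝓡 6) (𝓡 6) (chartAt E6 j) x)
  else 0

theorem bumpForm_eq_zero {j : M} {g : E6 → ℝ} (a : (k : ℕ) → E6 [⋀^Fin k]→L[ℝ] ℝ)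
    {x : M} (hx : x ∉ (chartAt E6 j).symm '' tsupport g) (k : ℕ) : bumpForm j g a k x = 0 := by
  rw [bumpForm]
  split_ifs with h
  · rw [image_eq_zero_of_notMem_tsupport fun h2 => hx ⟨_, h2, (chartAt E6 j).left_inv h⟩, zero_smul]
  · rfl

theorem isCompact_image_tsupport {j : M} {g : E6 → ℝ} (hg : HasCompactSupport g)
    (hgj : tsupport g ⊆ (chartAt E6 j).target) :
    IsCompact ((chartAt E6 j).symm '' tsupport g) ∧
      (chartAt E6 j).symm '' tsupport g ⊆ (chartAt E6 j).source := by
  refine ⟨hg.isCompact.image_of_continuousOn ((chartAt E6 j).continuousOn_symm.mono hgj), ?_⟩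
  rintro _ ⟨y, hy, rfl⟩
  exact (chartAt E6 j).map_target (hgj hy)

variable [IsManifold (𝓡 6) ∞ M]

theorem bumpForm_inChart (j : M) (g : E6 → ℝ) (a : (k : ℕ) → E6 [⋀^Fin k]→L[ℝ] ℝ) (k : ℕ) {y : E6}
    (hy : y ∈ (chartAt E6 j).target) : (bumpForm j g a k).inChart j y = g y • a k := by
  have : IsManifold (𝓡 6) 1 M := IsManifold.of_le (n := ∞) (by simp)
  have hx := (chartAt E6 j).map_target hy
  have h1 := (mdifferentiable_chart (I := 𝓡 6) j).comp_symm_deriv hy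
  ext v
  rw [Form.inChart, bumpForm, if_pos hx, (chartAt E6 j).right_inv hy]
  change g y * a k _ = g y * a k v
  congr 2
  funext i
  exact DFunLike.congr_fun h1 (v i)

theorem bumpForm_isSmooth [T2Space M] {j : M} {g : E6 → ℝ} (hg : ContDiff ℝ ∞ g)
    (hgc : HasCompactSupport g) (hgj : tsupport g ⊆ (chartAt E6 j).target)
    (a : (k : ℕ) → E6 [⋀^Fin k]→L[ℝ] ℝ) : (bumpForm j g a).IsSmooth := fun k => by
  refine Form.isSmooth_of_local _ fun x => ?_
  by_cases hx : x ∈ (chartAt E6 j).source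
  · refine ⟨j, hx, ?_⟩
    have h1 : ContDiffAt ℝ ∞ (fun y => g y • a k) (chartAt E6 j x) :=
      (hg.smul contDiff_const).contDiffAt
    exact h1.congr_of_eventuallyEq (eventually_of_mem ((chartAt E6 j).open_target.mem_nhds
      ((chartAt E6 j).map_source hx)) fun y hy => bumpForm_inChart j g a k hy)
  · refine ⟨x, mem_chart_source E6 x, ?_⟩
    obtain ⟨h1, h2⟩ := isCompact_image_tsupport hgc hgj
    have h3 := (chartAt E6 x).continuousAt_symm ((chartAt E6 x).map_source (mem_chart_source E6 x))
    rw [ContinuousAt, (chartAt E6 x).left_inv (mem_chart_source E6 x)] at h3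
    have h4 := h3.eventually (h1.isClosed.isOpen_compl.mem_nhds fun h => hx (h2 h))
    refine (contDiffAt_const (c := (0 : E6 [⋀^Fin k]→L[ℝ] ℝ))).congr_of_eventuallyEq ?_
    filter_upwards [h4] with y hy
    rw [Form.inChart, bumpForm_eq_zero a hy]
    rfl

variable [CompactSpace M] [T2Space M]

/-- If `∫ ⟨ψ, dα⟩ = 0` for all `α`, then `dψ = 0`. -/
theorem d_eq_zero_of_integral {ν : Form M ℝ 6} (hν : ν.IsVolumeForm) {p : ZMod 2}
    {ψ : MixedForm M ℝ} (hψ : ψ.IsSmooth) (hp : ψ.HasParity p)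
    (h : ∀ α : MixedForm M ℝ, α.IsSmooth → α.HasParity (p + 1) →
      integral ν (pairingForm ν ψ α.d) = 0) : ψ.d = 0 := by
  have hp' : ψ.d.HasParity (p + 1) := MixedForm.HasParity.d (by
    rwa [add_assoc, CharTwo.add_self_eq_zero (1 : ZMod 2), add_zero])
  have key : ∀ (j : M) (a : Mixed E6 ℝ), HasParity (p + 1) a → ∀ y ∈ (chartAt E6 j).target,
      pairing (ψ.d.inChart j y) a (EuclideanSpace.basisFun (Fin 6) ℝ) = 0 := by
    intro j a ha
    let s : E6 → ℝ := fun y =>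
      (SignType.sign (ν.inChart j y (EuclideanSpace.basisFun (Fin 6) ℝ)) : ℝ)
    let f : E6 → ℝ := fun y =>
      s y * pairing (ψ.d.inChart j y) a (EuclideanSpace.basisFun (Fin 6) ℝ)
    have hU : IsOpen (chartAt E6 j).target := (chartAt E6 j).open_target
    have hf : ContinuousOn f (chartAt E6 j).target :=
      (contDiffOn_sign_mul hν ((hψ.d.smoothFamily j).pairing (ψ := fun _ => a)
        (fun k v => contDiffOn_const) _)).continuousOn
    -- The fundamental lemma of the calculus of variations, with test forms `g a` for constant `a`.
    have hae := hU.ae_eq_zero_of_integral_contDiff_smul_eq_zero (μ := volume) (f := f)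
      (hf.locallyIntegrableOn hU.measurableSet) fun g hg hgc hgj => by
        let α := bumpForm j g fun k => toContinuousAlternating (a k)
        obtain ⟨h1, h2⟩ := isCompact_image_tsupport hgc hgj
        have hα : α.IsSmooth := bumpForm_isSmooth hg hgc hgj _
        have hαp : α.HasParity (p + 1) := fun k hk => by
          funext x
          change bumpForm j g _ k x = 0
          rw [bumpForm, ha k hk]
          split_ifs
          · exact smul_zero _
          · rfl
        have h3 := integral_pairingForm_d hν hψ hα h1 h2 fun x hx k => bumpForm_eq_zero _ hx k
        rw [h α hα hαp, eq_comm, neg_eq_zero, chartIntegral] at h3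
        rw [← setIntegral_eq_integral_of_forall_compl_eq_zero (s := (chartAt E6 j).target), ← h3]
        · refine setIntegral_congr_fun hU.measurableSet fun y hy => ?_
          have h4 : α.inChart j y = g y • a := by
            funext k
            rw [MixedForm.inChart, bumpForm_inChart j g _ k hy]
            rfl
          rw [density_pairingForm hν _ _ hy, h4, pairing_smul_right, AlternatingMap.smul_apply]
          exact mul_left_comm _ _ _
        · intro y hy
          rw [image_eq_zero_of_notMem_tsupport fun h5 => hy (hgj h5), zero_smul]
    have h0 : EqOn f 0 (chartAt E6 j).target := by
      refine Measure.eqOn_open_of_ae_eq (μ := volume) ?_ hU hf continuousOn_const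
      exact (ae_restrict_iff' hU.measurableSet).2 hae
    intro y hy
    have h1 := h0 hy
    refine (mul_eq_zero.1 h1).resolve_left ?_
    have h2 := inChart_apply_basis_ne_zero hy hν.ne_zero
    rcases lt_or_gt_of_ne h2 with h3 | h3
    · simp [s, sign_neg h3]
    · simp [s, sign_pos h3]
  have hzero : ∀ (j : M), ∀ y ∈ (chartAt E6 j).target, ψ.d.inChart j y = 0 := fun j y hy => by
    -- Only test forms of parity `p + 1` are available, but `dψ` pairs trivially with the others.
    refine eq_zero_of_pairing_eq_zero finrank_E6 (inChart_ne_zero hy hν.ne_zero) _ fun χ => ?_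
    rw [← pairing_parityPart (hp'.inChart j y)]
    have h1 := key j _ (hasParity_parityPart (p + 1) χ) y hy
    by_contra h2
    have h3 := (AlternatingMap.map_basis_ne_zero_iff
      (EuclideanSpace.basisFun (Fin 6) ℝ).toBasis _).2 h2
    refine h3 ?_
    rw [OrthonormalBasis.coe_toBasis, h1]
  funext k
  exact Form.eq_zero_of_inChart _ fun j y hy =>
    ContinuousAlternatingMap.toAlternatingMap_injective (congrFun (hzero j y hy) k)

end

/-! ### Generalized Calabi–Yau structures -/

section
open Set Filter Topology

variable {M : Type*} [TopologicalSpace M] [ChartedSpace E6 M]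

theorem MixedForm.complexForm_apply (ρ ψ : MixedForm M ℝ) (k : ℕ) (x : M)
    (v : Fin k → TangentSpace (𝓡 6) x) :
    ρ.complexForm ψ k x v = (ρ k x v : ℂ) + Complex.I * (ψ k x v : ℂ) := rfl

theorem MixedForm.complexForm_inChart_apply (ρ ψ : MixedForm M ℝ) (k : ℕ) (j : M) (y : E6)
    (v : Fin k → E6) : (ρ.complexForm ψ k).inChart j y v =
      ((ρ k).inChart j y v : ℂ) + Complex.I * ((ψ k).inChart j y v : ℂ) := rfl

theorem MixedForm.complexForm_at (ρ ψ : MixedForm M ℝ) (x : M) :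
    (ρ.complexForm ψ).at x = StableForm.complexForm (ρ.at x) (ψ.at x) := rfl

theorem MixedForm.IsSmooth.complexForm {ρ ψ : MixedForm M ℝ} (hρ : ρ.IsSmooth) (hψ : ψ.IsSmooth) :
    (ρ.complexForm ψ).IsSmooth := fun k j => by
  refine contDiffOn_of_apply fun v => ?_
  simp only [MixedForm.complexForm_inChart_apply]
  have h : ∀ {α : MixedForm M ℝ}, α.IsSmooth →
      ContDiffOn ℝ ∞ (fun y => ((α k).inChart j y v : ℂ)) (chartAt E6 j).target := fun hα =>
    Complex.ofRealCLM.contDiff.comp_contDiffOn ((hα k j).alternating_apply v)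
  exact (h hρ).add (contDiffOn_const.mul (h hψ))

theorem MixedForm.complexForm_d {ρ ψ : MixedForm M ℝ} (hρ : ρ.IsSmooth) (hψ : ψ.IsSmooth) :
    (ρ.complexForm ψ).d = ρ.d.complexForm ψ.d := by
  funext k
  rcases k with _ | k
  · funext x
    ext v
    rw [MixedForm.complexForm_apply]
    change (0 : ℂ) = ((0 : ℝ) : ℂ) + Complex.I * ((0 : ℝ) : ℂ)
    simp
  · funext x
    ext v
    have hx := (chartAt E6 x).map_source (mem_chart_source E6 x)
    rw [MixedForm.complexForm_apply]
    have h1 := (hρ k).differentiableAt hx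
    have h2 := (hψ k).differentiableAt hx
    have h3 := (hρ.complexForm hψ k).differentiableAt hx
    change extDeriv ((ρ.complexForm ψ k).inChart x) (chartAt E6 x x) _ =
      ((extDeriv ((ρ k).inChart x) (chartAt E6 x x) _ : ℝ) : ℂ) +
        Complex.I * ((extDeriv ((ψ k).inChart x) (chartAt E6 x x) _ : ℝ) : ℂ)
    rw [extDeriv_apply h1, extDeriv_apply h2, extDeriv_apply h3]
    push_cast
    rw [Finset.mul_sum, ← Finset.sum_add_distrib]
    refine Finset.sum_congr rfl fun i _ => ?_
    have ha : ∀ w : Fin k → E6, fderiv ℝ (fun y => (ρ.complexForm ψ k).inChart x y w)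
        (chartAt E6 x x) = Complex.ofRealCLM ∘L
          fderiv ℝ (fun y => (ρ k).inChart x y w) (chartAt E6 x x) +
        Complex.I • (Complex.ofRealCLM ∘L
          fderiv ℝ (fun y => (ψ k).inChart x y w) (chartAt E6 x x)) := fun w => by
      have hd : ∀ {τ : Form M ℝ k}, τ.IsSmooth →
          HasFDerivAt (fun y => (τ.inChart x y w : ℂ)) (Complex.ofRealCLM ∘L
            fderiv ℝ (fun y => τ.inChart x y w) (chartAt E6 x x)) (chartAt E6 x x) := fun hτ =>
        Complex.ofRealCLM.hasFDerivAt.comp _ ((((hτ x).alternating_apply w).contDiffAt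
          ((chartAt E6 x).open_target.mem_nhds hx)).differentiableAt (by simp)).hasFDerivAt
      exact ((hd (hρ k)).add ((hd (hψ k)).const_mul Complex.I)).fderiv
    rw [ha]
    simp only [add_apply, smul_apply, ContinuousLinearMap.comp_apply,
      Complex.ofRealCLM_apply, smul_eq_mul, zsmul_eq_mul]
    push_cast
    ring

theorem MixedForm.complexForm_eq_zero_iff {ρ ψ : MixedForm M ℝ} :
    ρ.complexForm ψ = 0 ↔ ρ = 0 ∧ ψ = 0 := by
  constructor
  · intro h
    have h1 : ∀ k x v, (ρ k x v : ℂ) + Complex.I * (ψ k x v : ℂ) = 0 := fun k x v => by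
      rw [← MixedForm.complexForm_apply, h]; rfl
    refine ⟨?_, ?_⟩
    · funext k x; ext v
      simpa using congrArg Complex.re (h1 k x v)
    · funext k x; ext v
      simpa using congrArg Complex.im (h1 k x v)
  · rintro ⟨rfl, rfl⟩
    funext k x; ext v
    rw [MixedForm.complexForm_apply]
    change ((0 : ℝ) : ℂ) + Complex.I * ((0 : ℝ) : ℂ) = 0
    simp

variable [IsManifold (𝓡 6) ∞ M]

/-- At each point `ρ + i ρ̂` is a pure spinor with nonzero norm, and it is smooth, so only the
closedness of `ρ̂` remains. -/
theorem isGeneralizedCalabiYau_iff {ν : Form M ℝ 6} (hν : ν.IsVolumeForm) {p : ZMod 2}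
    {ρ : MixedForm M ℝ} (hρ : ρ.IsSmooth) (hp : ρ.HasParity p) (hclosed : ρ.d = 0)
    (hs : IsStable ν ρ) :
    IsGeneralizedCalabiYau (ρ.complexForm (hat p ν ρ)) ↔ (hat p ν ρ).d = 0 := by
  have hsm := hat_isSmooth hν hρ hp hs
  have hd := MixedForm.complexForm_d hρ hsm
  constructor
  · intro h
    have h1 := h.closed
    rw [hd, MixedForm.complexForm_eq_zero_iff] at h1
    exact h1.2
  · intro h
    have hpar : (ρ.complexForm (hat p ν ρ)).HasParity p := fun k hk => by
      funext x; ext v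
      rw [MixedForm.complexForm_apply, hp k hk, hat_hasParity hν.ne_zero hp hs k hk]
      change ((0 : ℝ) : ℂ) + Complex.I * ((0 : ℝ) : ℂ) = 0
      simp
    refine ⟨hρ.complexForm hsm, ?_, ?_, fun x => ?_, fun x h0 => ?_⟩
    · have h01 : ∀ r : ZMod 2, r = 0 ∨ r = 1 := by decide
      rcases h01 p with rfl | rfl
      · exact Or.inl hpar
      · exact Or.inr hpar
    · rw [hd, MixedForm.complexForm_eq_zero_iff]
      exact ⟨hclosed, h⟩
    · exact (isHat_hat hν.ne_zero hp hs x).2.1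
    · obtain ⟨c, hc, h1⟩ := (isHat_hat hν.ne_zero hp hs x).2.2
      rw [MixedForm.complexForm_at] at h0
      rw [h0, coeff] at h1
      have h2 : (0 : ℂ) = c * Complex.I := by
        rw [← h1]
        exact (smul_zero _).symm
      have h3 := congrArg Complex.im h2
      simp at h3
      exact hc.ne h3

end
end StableForm
end

theorem theorem1 {M : Type*} [TopologicalSpace M] [ChartedSpace (EuclideanSpace ℝ (Fin 6)) M]
    [IsManifold (𝓡 6) ∞ M] [CompactSpace M] [T2Space M]
    (ν : StableForm.Form M ℝ 6) (hν : ν.IsVolumeForm)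
    (p : ZMod 2) (ρ : StableForm.MixedForm M ℝ) (hρ : ρ.IsSmooth) (hp : ρ.HasParity p)
    (hclosed : ρ.d = 0) (hstable : StableForm.IsStable ν ρ) :
    (StableForm.IsCriticalInClass p ν ρ ↔
      StableForm.IsGeneralizedCalabiYau (ρ.complexForm (StableForm.hat p ν ρ))) ∧
    (StableForm.IsGeneralizedCalabiYau (ρ.complexForm (StableForm.hat p ν ρ)) ↔
      (StableForm.hat p ν ρ).d = 0) := by
  have hgcy := StableForm.isGeneralizedCalabiYau_iff hν hρ hp hclosed hstable
  refine ⟨?_, hgcy⟩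
  rw [hgcy]
  have hsm := StableForm.hat_isSmooth hν hρ hp hstable
  have hpar := StableForm.hat_hasParity hν.ne_zero hp hstable
  have hvar : ∀ α : StableForm.MixedForm M ℝ, α.IsSmooth → α.HasParity (p + 1) →
      HasDerivAt (fun t : ℝ => StableForm.volumeFunctional ν (ρ + t • α.d))
        (1 / 2 * StableForm.integral ν
          (StableForm.pairingForm ν (StableForm.hat p ν ρ) α.d)) 0 := fun α hα hαp =>
    StableForm.hasDerivAt_volumeFunctional hν hρ hp hstable hα.d hαp.d
  constructor
  · intro hcrit
    refine StableForm.d_eq_zero_of_integral hν hsm hpar fun α hα hαp => ?_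
    have := (hvar α hα hαp).unique (hcrit α hα hαp)
    linarith
  · intro hd α hα hαp
    have h := hvar α hα hαp
    rwa [StableForm.integral_pairingForm_d_eq_zero hν hsm hd hα, mul_zero] at h
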